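/- **Theorem 1.1.** Let $L,T>0$, $\overline U_0>0$, $\lambda>0$ be constants with $\overline U_0<\lambda^{-1}$, and let $H=L^2(0,L)\times L^2(0,L)$. Let $f,g$ be functions on $(0,L)\times(0,T)$ and let $u_0,\psi_0\in L^2(0,L)$, all independent of $\varepsilon$. For $\varepsilon>0$, the *viscous problem* is $$u^\varepsilon_t+\overline U_0u^\varepsilon_x+\psi^\varepsilon_x-2\varepsilon u^\varepsilon_{xx}=f,\qquad \psi^\varepsilon_t+\overline U_0\psi^\varepsilon_x+\lambda^{-2}u^\varepsilon_x=g\qquad\text{in }(0,L)\times(0,T),$$ $$u^\varepsilon(0,t)=u^\varepsilon(L,t)=\psi^\varepsilon(0,t)=0\quad(0<t<T),\qquad u^\varepsilon(\cdot,0)=u_0,\quad \psi^\varepsilon(\cdot,0)=\psi_0,$$ and the *inviscid problem* is $$u^0_t+\overline U_0u^0_x+\psi^0_x=f,\qquad \psi^0_t+\overline U_0\psi^0_x+\lambda^{-2}u^0_x=g\qquad\text{in }(0,L)\times(0,T),$$ $$u^0(0,t)+\overline U_0\lambda^2\psi^0(0,t)=0,\quad u^0(L,t)=0\quad(0<t<T),\qquad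 u^0(\cdot,0)=u_0,\quad \psi^0(\cdot,0)=\psi_0.$$ Derivatives are weak derivatives, the equations hold almost everywhere, and boundary values are traces. Let $$D(A)=\{(u,\psi)\in H:\ u_x,\psi_x,u_{xx}\in L^2(0,L),\ u(0)=\psi(0)=u(L)=0\},$$ $$D(A^0)=\{(u,\psi)\in H:\ u_x,\psi_x\in L^2(0,L),\ u(0)+\overline U_0\lambda^2\psi(0)=0,\ u(L)=0\},$$ $$\mathcal F=C([0,T];H)\cap L^\infty(0,T;D(A)),\qquad \mathcal F^0=C([0,T];H)\cap L^\infty(0,T;D(A^0)),$$ $$\mathcal K=\{(u,\psi)\in\mathcal F:\ \psi_{xt},\psi_{xx}\in L^\infty(0,T;L^2(0,L)),\ (u_t,\psi_t)\in C([0,T];H)\},$$ $$\mathcal K^0=\{(u,\psi)\in\mathcal F^0:\ \psi_{xt},u_{xx},\psi_{xx}\in L^\infty(0,T;L^2(0,L)),\ (u_t,\psi_t)\in C([0,T];H)\}.$$ Let $(u^0,\psi^0)\in\mathcal K^0$ be a solution of the inviscid problem. Put $r=\frac{1}{2\overline U_0\lambda^2}-\frac{\overline U_0}{2}>0$ and define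 the boundary-layer correctors by $$\theta_u^\varepsilon(x,t)=-\frac{e^{-rx/\varepsilon}-e^{-rL/\varepsilon}}{1-e^{-rL/\varepsilon}}\,u^0(0,t),\qquad \theta_\psi^\varepsilon(x,t)=-\frac{1}{\overline U_0\lambda^2}\,\theta_u^\varepsilon(x,t).$$ Then there is a constant $C$, independent of $\varepsilon$, such that for every $\varepsilon\in(0,1]$ and every solution $(u^\varepsilon,\psi^\varepsilon)\in\mathcal K$ of the viscous problem, the functions $U^\varepsilon=u^\varepsilon-u^0-\theta_u^\varepsilon$ and $\Psi^\varepsilon=\psi^\varepsilon-\psi^0-\theta_\psi^\varepsilon$ satisfy $$\|(U^\varepsilon,\Psi^\varepsilon)\|_{L^\infty(0,T;L^2(0,L))}+\varepsilon^{1/2}\|(U^\varepsilon_x,\Psi^\varepsilon_x)\|_{L^2((0,L)\times(0,T))}\le C\varepsilon,$$ $$\|(U^\varepsilon,\Psi^\varepsilon)\|_{L^\infty(0,T;L^\infty(0,L))}\le C\varepsilon^{1/2}.$$ -/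

import Mathlib

open MeasureTheory Set
open scoped ENNReal ContDiff

noncomputable section

namespace BoundaryLayer

/-- Lebesgue measure on the interval `(0, a)`. -/
abbrev intervalMeasure (a : ℝ) : Measure ℝ := volume.restrict (Ioo 0 a)

/-- The Hilbert space `L²(0, L)`. A function of `(x, t)` is represented by a curve
`t ↦ u t` in this space. -/
abbrev L2 (L : ℝ) := Lp ℝ 2 (intervalMeasure L)

/-- `φ` belongs to `C_c^∞(0, a)`. -/
def IsTestFunction (a : ℝ) (φ : ℝ → ℝ) : Prop :=
  ContDiff ℝ ∞ φ ∧ HasCompactSupport φ ∧ tsupport φ ⊆ Ioo 0 a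

/-- `w ∈ L²(0, L)` is the weak derivative of `v ∈ L²(0, L)`. -/
def HasWeakDeriv {L : ℝ} (v w : L2 L) : Prop :=
  ∀ φ : ℝ → ℝ, IsTestFunction L φ →
    ∫ x in Ioo 0 L, v x * deriv φ x = -∫ x in Ioo 0 L, w x * φ x

/-- `w = v_x` : for almost every `t ∈ (0, T)`, `w t` is the weak derivative of `v t`. -/
def HasWeakSpaceDeriv {L : ℝ} (T : ℝ) (v w : ℝ → L2 L) : Prop :=
  ∀ᵐ t ∂(intervalMeasure T), HasWeakDeriv (v t) (w t)

/-- `w = v_t` in the sense of `L²(0, L)`-valued distributions on `(0, T)`, both curves being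
Bochner integrable on `(0, T)`. -/
def HasWeakTimeDeriv {L : ℝ} (T : ℝ) (v w : ℝ → L2 L) : Prop :=
  IntegrableOn v (Ioo 0 T) ∧ IntegrableOn w (Ioo 0 T) ∧
  ∀ φ : ℝ → ℝ, IsTestFunction T φ →
    ∫ t in Ioo 0 T, deriv φ t • v t = -∫ t in Ioo 0 T, φ t • w t

/-- `v ∈ L^∞(0, T; L²(0, L))`. -/
def MemLinfL2 {L : ℝ} (T : ℝ) (v : ℝ → L2 L) : Prop :=
  MemLp v ∞ (intervalMeasure T)

open Classical in
/-- The value at `y ∈ [0, L]` of (the continuous representative on `[0, L]` of) `v`. This is the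
trace of `v` when `v ∈ H¹(0, L)`, and only such `v` are used below. -/
def pointValue {L : ℝ} (v : L2 L) (y : ℝ) : ℝ :=
  if h : ∃ c : ℝ → ℝ, ContinuousOn c (Icc 0 L) ∧ v =ᵐ[intervalMeasure L] c
  then h.choose y else 0

/-- `v ∈ H¹(0, L)`. -/
def MemH1 {L : ℝ} (v : L2 L) : Prop := ∃ w : L2 L, HasWeakDeriv v w

/-- `v ∈ H²(0, L)`. -/
def MemH2 {L : ℝ} (v : L2 L) : Prop := ∃ w : L2 L, HasWeakDeriv v w ∧ MemH1 w

/-- `D(A)`, the domain of the viscous operator. -/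
def domA (L : ℝ) : Set (L2 L × L2 L) :=
  {p | MemH2 p.1 ∧ MemH1 p.2 ∧
    pointValue p.1 0 = 0 ∧ pointValue p.2 0 = 0 ∧ pointValue p.1 L = 0}

/-- `D(A⁰)`, the domain of the inviscid operator. -/
def domA0 (U₀ lam L : ℝ) : Set (L2 L × L2 L) :=
  {p | MemH1 p.1 ∧ MemH1 p.2 ∧
    pointValue p.1 0 + U₀ * lam ^ 2 * pointValue p.2 0 = 0 ∧ pointValue p.1 L = 0}

/-- `(u, ψ) ∈ C([0, T]; L²(0, L) × L²(0, L))`. -/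
def MemCH {L : ℝ} (T : ℝ) (u ψ : ℝ → L2 L) : Prop :=
  ContinuousOn u (Icc 0 T) ∧ ContinuousOn ψ (Icc 0 T)

/-- `𝓕 = C([0, T]; H) ∩ L^∞(0, T; D(A))`. -/
def ClassF {L : ℝ} (T : ℝ) (u ψ : ℝ → L2 L) : Prop :=
  MemCH T u ψ ∧
  (∀ᵐ t ∂(intervalMeasure T), (u t, ψ t) ∈ domA L) ∧
  ∃ ux uxx ψx : ℝ → L2 L,
    HasWeakSpaceDeriv T u ux ∧ HasWeakSpaceDeriv T ux uxx ∧ HasWeakSpaceDeriv T ψ ψx ∧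
    MemLinfL2 T ux ∧ MemLinfL2 T uxx ∧ MemLinfL2 T ψx

/-- `𝓕⁰ = C([0, T]; H) ∩ L^∞(0, T; D(A⁰))`. -/
def ClassF0 (U₀ lam : ℝ) {L : ℝ} (T : ℝ) (u ψ : ℝ → L2 L) : Prop :=
  MemCH T u ψ ∧
  (∀ᵐ t ∂(intervalMeasure T), (u t, ψ t) ∈ domA0 U₀ lam L) ∧
  ∃ ux ψx : ℝ → L2 L,
    HasWeakSpaceDeriv T u ux ∧ HasWeakSpaceDeriv T ψ ψx ∧
    MemLinfL2 T ux ∧ MemLinfL2 T ψx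

/-- `(u_t, ψ_t) ∈ C([0, T]; H)`. -/
def TimeDerivMemCH {L : ℝ} (T : ℝ) (u ψ : ℝ → L2 L) : Prop :=
  ∃ ut ψt : ℝ → L2 L, HasWeakTimeDeriv T u ut ∧ HasWeakTimeDeriv T ψ ψt ∧ MemCH T ut ψt

/-- `v_{xx} ∈ L^∞(0, T; L²(0, L))`. -/
def XXMemLinfL2 {L : ℝ} (T : ℝ) (v : ℝ → L2 L) : Prop :=
  ∃ vx vxx : ℝ → L2 L,
    HasWeakSpaceDeriv T v vx ∧ HasWeakSpaceDeriv T vx vxx ∧ MemLinfL2 T vxx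

/-- `v_{xt} ∈ L^∞(0, T; L²(0, L))`. -/
def XTMemLinfL2 {L : ℝ} (T : ℝ) (v : ℝ → L2 L) : Prop :=
  ∃ vx vxt : ℝ → L2 L,
    HasWeakSpaceDeriv T v vx ∧ HasWeakTimeDeriv T vx vxt ∧ MemLinfL2 T vxt

/-- The class `𝓚`. -/
def ClassK {L : ℝ} (T : ℝ) (u ψ : ℝ → L2 L) : Prop :=
  ClassF T u ψ ∧ XTMemLinfL2 T ψ ∧ XXMemLinfL2 T ψ ∧ TimeDerivMemCH T u ψ

/-- The class `𝓚⁰`. -/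
def ClassK0 (U₀ lam : ℝ) {L : ℝ} (T : ℝ) (u ψ : ℝ → L2 L) : Prop :=
  ClassF0 U₀ lam T u ψ ∧ XTMemLinfL2 T ψ ∧ XXMemLinfL2 T u ∧ XXMemLinfL2 T ψ ∧
    TimeDerivMemCH T u ψ

/-- `(u, ψ)` solves the viscous problem with parameter `ε`: the equations hold in `L²(0, L)` for
almost every `t ∈ (0, T)`, with the boundary conditions and the initial conditions. -/
def IsViscousSolution (U₀ lam : ℝ) {L : ℝ} (T ε : ℝ) (f g : ℝ → L2 L) (uInit ψInit : L2 L)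
    (u ψ : ℝ → L2 L) : Prop :=
  (∃ ut ux uxx ψt ψx : ℝ → L2 L,
    HasWeakTimeDeriv T u ut ∧ HasWeakSpaceDeriv T u ux ∧ HasWeakSpaceDeriv T ux uxx ∧
    HasWeakTimeDeriv T ψ ψt ∧ HasWeakSpaceDeriv T ψ ψx ∧
    ∀ᵐ t ∂(intervalMeasure T),
      ut t + U₀ • ux t + ψx t - (2 * ε) • uxx t = f t ∧
      ψt t + U₀ • ψx t + (lam ^ 2)⁻¹ • ux t = g t) ∧
  (∀ᵐ t ∂(intervalMeasure T),
    pointValue (u t) 0 = 0 ∧ pointValue (u t) L = 0 ∧ pointValue (ψ t) 0 = 0) ∧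
  u 0 = uInit ∧ ψ 0 = ψInit

/-- `(u, ψ)` solves the inviscid problem. -/
def IsInviscidSolution (U₀ lam : ℝ) {L : ℝ} (T : ℝ) (f g : ℝ → L2 L) (uInit ψInit : L2 L)
    (u ψ : ℝ → L2 L) : Prop :=
  (∃ ut ux ψt ψx : ℝ → L2 L,
    HasWeakTimeDeriv T u ut ∧ HasWeakSpaceDeriv T u ux ∧
    HasWeakTimeDeriv T ψ ψt ∧ HasWeakSpaceDeriv T ψ ψx ∧
    ∀ᵐ t ∂(intervalMeasure T),
      ut t + U₀ • ux t + ψx t = f t ∧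
      ψt t + U₀ • ψx t + (lam ^ 2)⁻¹ • ux t = g t) ∧
  (∀ᵐ t ∂(intervalMeasure T),
    pointValue (u t) 0 + U₀ * lam ^ 2 * pointValue (ψ t) 0 = 0 ∧ pointValue (u t) L = 0) ∧
  u 0 = uInit ∧ ψ 0 = ψInit

/-- The decay rate `r = 1 / (2 U₀ λ²) - U₀ / 2` of the boundary layer. -/
def rate (U₀ lam : ℝ) : ℝ := 1 / (2 * U₀ * lam ^ 2) - U₀ / 2

/-- An exponential profile `x ↦ e^{-r x / ε} a + c` on `(0, L)`. -/
def profile (r ε a c : ℝ) (x : ℝ) : ℝ := Real.exp (-(r * x / ε)) * a + c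

theorem memLp_profile (L r ε a c : ℝ) : MemLp (profile r ε a c) 2 (intervalMeasure L) := by
  have hc : Continuous (profile r ε a c) := by unfold profile; fun_prop
  obtain ⟨M, hM⟩ := isCompact_Icc.exists_bound_of_continuousOn (s := Icc 0 L) hc.continuousOn
  refine MemLp.of_bound hc.aestronglyMeasurable M ?_
  filter_upwards [ae_restrict_mem measurableSet_Ioo] with x hx
  exact hM x (Ioo_subset_Icc_self hx)

/-- The corrector `θ_u^ε(·, t) = e^{-r x / ε} A^ε(t) + C^ε(t)`. -/
def thetaU (U₀ lam : ℝ) {L : ℝ} (ε : ℝ) (u0 : ℝ → L2 L) (t : ℝ) : L2 L :=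
  let r := rate U₀ lam
  let e := Real.exp (-(r * L / ε))
  (memLp_profile L r ε
    (-((1 - e)⁻¹ * pointValue (u0 t) 0))
    (e * (1 - e)⁻¹ * pointValue (u0 t) 0)).toLp

/-- The corrector `θ_ψ^ε(·, t) = e^{-r x / ε} B^ε(t) + D^ε(t)`. -/
def thetaPsi (U₀ lam : ℝ) {L : ℝ} (ε : ℝ) (u0 : ℝ → L2 L) (t : ℝ) : L2 L :=
  let r := rate U₀ lam
  let e := Real.exp (-(r * L / ε))
  (memLp_profile L r ε
    (U₀⁻¹ * (lam ^ 2)⁻¹ * (1 - e)⁻¹ * pointValue (u0 t) 0)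
    (-(U₀⁻¹ * (lam ^ 2)⁻¹ * e * (1 - e)⁻¹ * pointValue (u0 t) 0))).toLp

/-- `U^ε = u^ε - u⁰ - θ_u^ε`. -/
def remainderU (U₀ lam : ℝ) {L : ℝ} (ε : ℝ) (u u0 : ℝ → L2 L) (t : ℝ) : L2 L :=
  u t - u0 t - thetaU U₀ lam ε u0 t

/-- `Ψ^ε = ψ^ε - ψ⁰ - θ_ψ^ε`. -/
def remainderPsi (U₀ lam : ℝ) {L : ℝ} (ε : ℝ) (ψ ψ0 u0 : ℝ → L2 L) (t : ℝ) : L2 L :=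
  ψ t - ψ0 t - thetaPsi U₀ lam ε u0 t

/-- The pair `(v, w)` as a curve in the Hilbert space `H = L²(0, L) × L²(0, L)`. -/
def pairH {L : ℝ} (v w : ℝ → L2 L) (t : ℝ) : WithLp 2 (L2 L × L2 L) :=
  WithLp.toLp 2 (v t, w t)

/-- `‖(v, w)‖_{L^∞(0, T; L^∞(0, L))}`. -/
def normLinfLinf {L : ℝ} (T : ℝ) (v w : ℝ → L2 L) : ℝ≥0∞ :=
  essSup (fun t => eLpNorm (fun x => !₂[v t x, w t x]) ∞ (intervalMeasure L)) (intervalMeasure T)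

end BoundaryLayer

end

/-!
Write `a = U₀`, `b = λ⁻²`, `ε = σ²`, and let `ρ` be the exponential layer normalized by `ρ(0) = 1`
and `ρ(L) = 0`. The rate `r` is chosen such that a layer with components in the proportion
`1 : -b / a` solves the stationary leading-order equations. With the correctors, the error `(U, P)`
therefore vanishes at the boundary wherever the viscous solution does, starts from zero, and solves
the viscous system with the forcing `2 ε u⁰_xx` and a layer `η ρ`, `-(b / a) η ρ`, where `η` is the
time derivative of the trace of `u⁰` at `0` (`exists_errorSystem`). This trace is Lipschitz in time,
since `ψ⁰_xt` is bounded, and it vanishes initially, since a viscous solution exists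
(`initial_trace_eq_zero`).

The forcing `η ρ` has only the size `σ` in `L²`. Against functions that vanish at `0`, however, it
can be integrated by parts, and it costs `σ³` times the norm of a gradient (`LayerProfile`,
`exists_layerProfile`). For `U` this gradient is absorbed by the viscous dissipation. The second
equation has no dissipation, so that the energy inequality (`ErrorSystem.energy_closed`) gives the
size `σ²` of `U` and `P` and the size `σ` of `U_x` only up to a small multiple of
`σ² ∫ ‖P_x‖²`, which is estimated separately:

* Testing the first equation with `P_x`, and replacing `U_xx` through the space derivative of the
  second equation, makes `P_x` a damped, transported quantity. This bounds `∫ ‖P_x‖²` by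
  `σ² + ∫ ‖U_x‖²`, a small multiple of `∫ ‖U_t‖²`, and the inflow value of `P_x`, which the second
  equation relates to the trace of `U_x` (`ErrorSlice.inflow`, `ErrorSystem.gradient_integrated`).
* Testing the first equation with `U_t` bounds `∫ ‖U_t‖²` by `∫ ‖U_x‖² + ∫ ‖P_x‖² + σ²`
  (`ErrorSystem.time_derivative_integrated`). As `U_x` has no time derivative in `L²`, the identity
  `d/dt ‖U_x‖² = -2 ⟪U_xx, U_t⟫` is replaced by the inequality `ae_le_neg_two_integral_inner`, which
  rests on the convexity of the Dirichlet energy.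

These inequalities close when the small factors are chosen in the right order
(`combine_energies`, `ErrorSystem.exists_bound`). They also bound `U_x` and `P_x` uniformly in `L²`
at almost every time, and interpolation between `L²` and `H¹` gives the estimate in `L^∞`.
-/

namespace BoundaryLayer
open Filter Topology

/-! ### Primitives of integrable curves -/

section Primitives

variable {E : Type*} [NormedAddCommGroup E] {T : ℝ}

theorem intervalIntegrable_of_Ioo (hT : 0 ≤ T) {w : ℝ → E} (hw : IntegrableOn w (Ioo 0 T)) :
    IntervalIntegrable w volume 0 T :=
  (intervalIntegrable_iff_integrableOn_Ioo_of_le hT).2 hw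

theorem intervalIntegrable_of_Ioo_of_mem {w : ℝ → E} (hw : IntegrableOn w (Ioo 0 T))
    {s t : ℝ} (hs : s ∈ Icc 0 T) (ht : t ∈ Icc 0 T) : IntervalIntegrable w volume s t :=
  (intervalIntegrable_of_Ioo (hs.1.trans hs.2) hw).mono_set (by
    rw [uIcc_of_le (hs.1.trans hs.2)]
    exact uIcc_subset_Icc hs ht)

variable [NormedSpace ℝ E]

theorem setIntegral_Ioo_eq (hT : 0 ≤ T) (w : ℝ → E) :
    ∫ t in Ioo 0 T, w t = ∫ t in (0 : ℝ)..T, w t := by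
  rw [intervalIntegral.integral_of_le hT, integral_Ioc_eq_integral_Ioo]

theorem continuousOn_primitive_Icc (hT : 0 ≤ T) {w : ℝ → E} (hw : IntegrableOn w (Ioo 0 T)) :
    ContinuousOn (fun t => ∫ s in (0 : ℝ)..t, w s) (Icc 0 T) := by
  have h := intervalIntegral.continuousOn_primitive_interval'
    (intervalIntegrable_of_Ioo hT hw) (left_mem_uIcc)
  rwa [uIcc_of_le hT] at h

theorem ae_hasDerivAt_primitive [CompleteSpace E] (hT : 0 ≤ T) {w : ℝ → E}
    (hw : IntegrableOn w (Ioo 0 T)) :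
    ∀ᵐ t ∂(intervalMeasure T), HasDerivAt (fun t => ∫ s in (0 : ℝ)..t, w s) (w t) t := by
  have h := (intervalIntegrable_of_Ioo hT hw).ae_hasDerivAt_integral
  rw [ae_restrict_iff' measurableSet_Ioo]
  filter_upwards [h] with t ht htT
  rw [uIcc_of_le hT] at ht
  exact ht (Ioo_subset_Icc_self htT) 0 (left_mem_Icc.2 hT)

theorem IsTestFunction.eq_zero_of_notMem {φ : ℝ → ℝ} (hφ : IsTestFunction T φ) {t : ℝ}
    (ht : t ∉ Ioo 0 T) : φ t = 0 :=
  image_eq_zero_of_notMem_tsupport fun h => ht (hφ.2.2 h)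

theorem IsTestFunction.bounded {φ : ℝ → ℝ} (hφ : IsTestFunction T φ) :
    ∃ C, ∀ t, ‖φ t‖ ≤ C := hφ.2.1.exists_bound_of_continuous hφ.1.continuous

theorem IsTestFunction.of_deriv {φ : ℝ → ℝ} (hφ : IsTestFunction T φ) :
    IsTestFunction T (deriv φ) :=
  ⟨(contDiff_infty_iff_deriv.1 hφ.1).2, hφ.2.1.deriv,
    (tsupport_deriv_subset).trans hφ.2.2⟩

theorem IsTestFunction.integrableOn_smul {φ : ℝ → ℝ} (hφ : IsTestFunction T φ) {w : ℝ → E}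
    (hw : IntegrableOn w (Ioo 0 T)) : IntegrableOn (fun t => φ t • w t) (Ioo 0 T) := by
  obtain ⟨C, hC⟩ := hφ.bounded
  exact hw.bdd_smul C hφ.1.continuous.aestronglyMeasurable (ae_of_all _ hC)

/-- Integration by parts of a real primitive against a test function. -/
theorem integral_deriv_mul_primitive (hT : 0 ≤ T) {w : ℝ → ℝ} (hw : IntegrableOn w (Ioo 0 T))
    {φ : ℝ → ℝ} (hφ : IsTestFunction T φ) :
    ∫ t in Ioo 0 T, deriv φ t * (∫ s in (0 : ℝ)..t, w s) = -∫ t in Ioo 0 T, φ t * w t := by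
  have hwi := intervalIntegrable_of_Ioo hT hw
  have hac := hwi.absolutelyContinuousOnInterval_intervalIntegral (left_mem_uIcc)
  have hφac : AbsolutelyContinuousOnInterval φ 0 T :=
    (hφ.1.of_le (by simp)).contDiffOn.absolutelyContinuousOnInterval
  have h := hφac.integral_deriv_mul_eq_sub hac
  rw [hφ.eq_zero_of_notMem (t := T) (by simp), hφ.eq_zero_of_notMem (t := 0) (by simp),
    ← setIntegral_Ioo_eq hT] at h
  have hW : IntegrableOn (fun t => ∫ s in (0 : ℝ)..t, w s) (Ioo 0 T) :=
    ((continuousOn_primitive_Icc hT hw).integrableOn_Icc).mono_set Ioo_subset_Icc_self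
  have e : ∫ t in Ioo 0 T, (deriv φ t * (∫ s in (0 : ℝ)..t, w s) + φ t * w t) = 0 := by
    refine Eq.trans (integral_congr_ae ?_) (h.trans (by simp))
    filter_upwards [ae_hasDerivAt_primitive hT hw] with t ht
    rw [ht.deriv]
  have e1 := integral_add (hφ.of_deriv.integrableOn_smul hW) (hφ.integrableOn_smul hw)
  simp only [smul_eq_mul] at e1
  linarith

/-- A primitive of an integrable curve has that curve as its weak derivative. -/
theorem integral_deriv_smul_primitive [CompleteSpace E] (hT : 0 ≤ T) {w : ℝ → E}
    (hw : IntegrableOn w (Ioo 0 T)) {φ : ℝ → ℝ} (hφ : IsTestFunction T φ) :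
    ∫ t in Ioo 0 T, deriv φ t • (∫ s in (0 : ℝ)..t, w s) = -∫ t in Ioo 0 T, φ t • w t := by
  have hW : IntegrableOn (fun t => ∫ s in (0 : ℝ)..t, w s) (Ioo 0 T) :=
    ((continuousOn_primitive_Icc hT hw).integrableOn_Icc).mono_set Ioo_subset_Icc_self
  by_contra hne
  obtain ⟨l, hl⟩ := SeparatingDual.exists_separating_of_ne (R := ℝ) hne
  refine hl ?_
  rw [map_neg, ← l.integral_comp_comm (hφ.of_deriv.integrableOn_smul hW),
    ← l.integral_comp_comm (hφ.integrableOn_smul hw)]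
  simp only [map_smul, smul_eq_mul]
  rw [← integral_deriv_mul_primitive hT (l.integrable_comp hw) hφ]
  refine setIntegral_congr_fun measurableSet_Ioo fun t ht => ?_
  rw [l.intervalIntegral_comp_comm (intervalIntegrable_of_Ioo_of_mem hw
    (left_mem_Icc.2 hT) (Ioo_subset_Icc_self ht))]

theorem exists_isTestFunction_integral_eq_one (hT : 0 < T) :
    ∃ η : ℝ → ℝ, IsTestFunction T η ∧ ∫ t in Ioo 0 T, η t = 1 := by
  obtain ⟨f, hf1, hf2, hf3, hf4, hf5⟩ := exists_contDiff_tsupport_subset (n := ⊤)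
    (Ioo_mem_nhds (half_pos hT) (half_lt_self hT))
  have hpos : 0 < ∫ t, f t := by
    refine hf3.continuous.integral_pos_of_hasCompactSupport_nonneg_nonzero hf2
      (fun t => (hf4 (mem_range_self t)).1) (x := T / 2) ?_
    rw [hf5]; norm_num
  have hset : ∫ t in Ioo 0 T, f t = ∫ t, f t :=
    setIntegral_eq_integral_of_forall_compl_eq_zero fun t ht =>
      image_eq_zero_of_notMem_tsupport fun h => ht (hf1 h)
  refine ⟨fun t => (∫ s, f s)⁻¹ * f t, ⟨contDiff_const.mul hf3, hf2.mul_left,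
    (tsupport_mul_subset_right).trans hf1⟩, ?_⟩
  rw [integral_const_mul, hset, inv_mul_cancel₀ hpos.ne']

/-- A test function of mean zero is the derivative of a test function. -/
theorem IsTestFunction.exists_deriv_eq (hT : 0 ≤ T) {φ : ℝ → ℝ} (hφ : IsTestFunction T φ)
    (h0 : ∫ t in Ioo 0 T, φ t = 0) : ∃ Φ : ℝ → ℝ, IsTestFunction T Φ ∧ deriv Φ = φ := by
  have hd : ∀ t, HasDerivAt (fun t => ∫ s in (0 : ℝ)..t, φ s) (φ t) t := fun t =>
    intervalIntegral.integral_hasDerivAt_right (hφ.1.continuous.intervalIntegrable _ _)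
      (hφ.1.continuous.stronglyMeasurableAtFilter _ _) hφ.1.continuous.continuousAt
  have hderiv : deriv (fun t => ∫ s in (0 : ℝ)..t, φ s) = φ := funext fun t => (hd t).deriv
  rw [setIntegral_Ioo_eq hT] at h0
  rcases (tsupport φ).eq_empty_or_nonempty with he | hne
  · have : φ = 0 := by
      funext t
      exact image_eq_zero_of_notMem_tsupport (by simp [he])
    subst this
    exact ⟨0, hφ, by ext; simp⟩
  set α := sInf (tsupport φ)
  set β := sSup (tsupport φ)
  have hα : α ∈ tsupport φ := hφ.2.1.sInf_mem hne
  have hβ : β ∈ tsupport φ := hφ.2.1.sSup_mem hne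
  have hout : ∀ s, s ∉ Icc α β → φ s = 0 := fun s hs =>
    image_eq_zero_of_notMem_tsupport fun h =>
      hs ⟨csInf_le hφ.2.1.bddBelow h, le_csSup hφ.2.1.bddAbove h⟩
  have hsupp : Function.support (fun t => ∫ s in (0 : ℝ)..t, φ s) ⊆ Icc α β := by
    intro t ht
    by_contra hn
    apply ht
    simp only
    rcases lt_or_ge t α with h | h
    · have : EqOn φ 0 (uIcc 0 t) := fun s hs => by
        refine hout s fun h' => ?_
        have h1 : s ≤ max 0 t := hs.2
        have h2 : max 0 t < α := max_lt (hφ.2.2 hα).1 h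
        exact absurd h'.1 (not_le.2 (h1.trans_lt h2))
      rw [intervalIntegral.integral_congr this]; simp
    · have hb : β < t := by
        by_contra hc
        exact hn ⟨h, not_lt.1 hc⟩
      have : EqOn φ 0 (uIcc T t) := fun s hs => by
        refine hout s fun h' => ?_
        have h1 : min T t ≤ s := hs.1
        have h2 : β < min T t := lt_min (hφ.2.2 hβ).2 hb
        exact absurd h'.2 (not_le.2 (h2.trans_le h1))
      rw [← intervalIntegral.integral_add_adjacent_intervals
        (hφ.1.continuous.intervalIntegrable 0 T) (hφ.1.continuous.intervalIntegrable T t), h0,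
        intervalIntegral.integral_congr this]
      simp
  have hts : tsupport (fun t => ∫ s in (0 : ℝ)..t, φ s) ⊆ Icc α β :=
    closure_minimal hsupp isClosed_Icc
  refine ⟨_, ⟨?_, isCompact_Icc.of_isClosed_subset (isClosed_tsupport _) hts, hts.trans ?_⟩, hderiv⟩
  · rw [contDiff_infty_iff_deriv]
    exact ⟨fun t => (hd t).differentiableAt, by rw [hderiv]; exact hφ.1⟩
  · exact Icc_subset_Ioo (hφ.2.2 hα).1 (hφ.2.2 hβ).2

theorem ae_eq_zero_of_integral_test [CompleteSpace E] {w : ℝ → E}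
    (hw : IntegrableOn w (Ioo 0 T))
    (h : ∀ φ, IsTestFunction T φ → ∫ t in Ioo 0 T, φ t • w t = 0) :
    ∀ᵐ t ∂(intervalMeasure T), w t = 0 := by
  rw [ae_restrict_iff' measurableSet_Ioo]
  refine isOpen_Ioo.ae_eq_zero_of_integral_contDiff_smul_eq_zero hw.locallyIntegrableOn
    fun g hg1 hg2 hg3 => ?_
  have hg : IsTestFunction T g := ⟨hg1, hg2, hg3⟩
  rw [← h g hg]
  exact (setIntegral_eq_integral_of_forall_compl_eq_zero fun t ht => by
    rw [hg.eq_zero_of_notMem ht, zero_smul]).symm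

/-- **Du Bois-Reymond lemma**: a curve with integrable weak derivative `w` is, up to a null set, a
constant plus a primitive of `w`. -/
theorem exists_ae_eq_const_add_primitive [CompleteSpace E] (hT : 0 < T) {v w : ℝ → E}
    (hv : IntegrableOn v (Ioo 0 T)) (hw : IntegrableOn w (Ioo 0 T))
    (h : ∀ φ, IsTestFunction T φ →
      ∫ t in Ioo 0 T, deriv φ t • v t = -∫ t in Ioo 0 T, φ t • w t) :
    ∃ c : E, ∀ᵐ t ∂(intervalMeasure T), v t = c + ∫ s in (0 : ℝ)..t, w s := by
  have hW : IntegrableOn (fun t => ∫ s in (0 : ℝ)..t, w s) (Ioo 0 T) :=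
    ((continuousOn_primitive_Icc hT.le hw).integrableOn_Icc).mono_set Ioo_subset_Icc_self
  set d : ℝ → E := fun t => v t - ∫ s in (0 : ℝ)..t, w s with hd
  have hdi : IntegrableOn d (Ioo 0 T) := hv.sub hW
  have hd0 : ∀ φ, IsTestFunction T φ → ∫ t in Ioo 0 T, deriv φ t • d t = 0 := fun φ hφ => by
    simp only [hd, smul_sub]
    rw [integral_sub (hφ.of_deriv.integrableOn_smul hv) (hφ.of_deriv.integrableOn_smul hW), h φ hφ,
      integral_deriv_smul_primitive hT.le hw hφ, sub_self]
  obtain ⟨η, hη, hη1⟩ := exists_isTestFunction_integral_eq_one hT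
  set c : E := ∫ t in Ioo 0 T, η t • d t with hc
  refine ⟨c, ?_⟩
  have hci : IntegrableOn (fun _ : ℝ => c) (Ioo 0 T) := by simp
  have hone : IntegrableOn (fun _ : ℝ => (1 : ℝ)) (Ioo 0 T) := by simp
  have key : ∀ᵐ t ∂(intervalMeasure T), d t - c = 0 := by
    refine ae_eq_zero_of_integral_test (hdi.sub hci) fun ζ hζ => ?_
    set m := ∫ t in Ioo 0 T, ζ t with hm
    have hζi : IntegrableOn ζ (Ioo 0 T) := by simpa using hζ.integrableOn_smul hone
    have hηi : IntegrableOn η (Ioo 0 T) := by simpa using hη.integrableOn_smul hone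
    have hψ : IsTestFunction T (fun t => ζ t - m * η t) := by
      refine ⟨hζ.1.sub (contDiff_const.mul hη.1), hζ.2.1.sub hη.2.1.mul_left, ?_⟩
      exact (tsupport_sub ζ _).trans
        (union_subset hζ.2.2 ((tsupport_mul_subset_right).trans hη.2.2))
    obtain ⟨Φ, hΦ, hΦd⟩ := hψ.exists_deriv_eq hT.le (by
      rw [integral_sub hζi (hηi.const_mul m), integral_const_mul, hη1, ← hm]; ring)
    have h1 := hd0 Φ hΦ
    rw [hΦd] at h1
    simp only [sub_smul, mul_smul] at h1
    rw [integral_sub (hζ.integrableOn_smul hdi) ((hη.integrableOn_smul hdi).fun_smul m),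
      integral_smul, ← hc] at h1
    simp only [smul_sub]
    rw [integral_sub (hζ.integrableOn_smul hdi) (hζ.integrableOn_smul hci), integral_smul_const,
      ← hm, h1]
  filter_upwards [key] with t ht
  rw [← sub_eq_zero.1 ht, hd]
  simp

end Primitives

/-! ### Curves with bounded derivative in a Hilbert space -/

section TimeCalculus

variable {H : Type*} [NormedAddCommGroup H] {T : ℝ}

theorem exists_bound_of_memLp_top {v : ℝ → H} (hv : MemLp v ∞ (intervalMeasure T)) :
    ∃ M : ℝ, 0 ≤ M ∧ ∀ᵐ t ∂(intervalMeasure T), ‖v t‖ ≤ M := by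
  refine ⟨(eLpNormEssSup v (intervalMeasure T)).toReal, ENNReal.toReal_nonneg, ?_⟩
  have hfin : eLpNormEssSup v (intervalMeasure T) ≠ ⊤ := by
    have := hv.2.ne
    rwa [eLpNorm_exponent_top] at this
  filter_upwards [ae_le_eLpNormEssSup (f := v) (μ := intervalMeasure T)] with t ht
  rw [← toReal_enorm]
  exact ENNReal.toReal_mono hfin ht

variable [InnerProductSpace ℝ H]

theorem integral_le_integral_of_ae_le {f g : ℝ → ℝ} (hf : IntegrableOn f (Ioo 0 T))
    (hg : IntegrableOn g (Ioo 0 T)) (h : ∀ᵐ t ∂(intervalMeasure T), f t ≤ g t) {t : ℝ}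
    (ht : t ∈ Icc 0 T) : ∫ s in (0 : ℝ)..t, f s ≤ ∫ s in (0 : ℝ)..t, g s := by
  rw [← setIntegral_Ioo_eq ht.1, ← setIntegral_Ioo_eq ht.1]
  have hsub : Ioo 0 t ⊆ Ioo 0 T := Ioo_subset_Ioo_right ht.2
  exact integral_mono_ae (hf.mono_set hsub) (hg.mono_set hsub)
    (ae_mono (Measure.restrict_mono_set _ hsub) h)

theorem norm_primitive_sub_le (hT : 0 ≤ T) {w : ℝ → H} {M : ℝ}
    (hw : IntegrableOn w (Ioo 0 T)) (hM : ∀ᵐ t ∂(intervalMeasure T), ‖w t‖ ≤ M) {s t : ℝ}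
    (hs : s ∈ Icc 0 T) (ht : t ∈ Icc 0 T) :
    ‖(∫ r in (0 : ℝ)..t, w r) - ∫ r in (0 : ℝ)..s, w r‖ ≤ M * |t - s| := by
  rw [intervalIntegral.integral_interval_sub_left
    (intervalIntegrable_of_Ioo_of_mem hw (left_mem_Icc.2 hT) ht)
    (intervalIntegrable_of_Ioo_of_mem hw (left_mem_Icc.2 hT) hs)]
  refine intervalIntegral.norm_integral_le_of_norm_le_const_ae ?_
  rw [ae_restrict_iff' measurableSet_Ioo] at hM
  have hne : ∀ᵐ r : ℝ, r ≠ T := by simp [ae_iff, measure_singleton]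
  filter_upwards [hM, hne] with r hr hrT hmem
  refine hr ⟨?_, ?_⟩
  · exact (le_min hs.1 ht.1).trans_lt hmem.1
  · exact lt_of_le_of_ne (hmem.2.trans (max_le hs.2 ht.2)) hrT

theorem norm_primitive_le (hT : 0 ≤ T) {w : ℝ → H} {M : ℝ}
    (hw : IntegrableOn w (Ioo 0 T)) (hM : ∀ᵐ t ∂(intervalMeasure T), ‖w t‖ ≤ M) {t : ℝ}
    (ht : t ∈ Icc 0 T) : ‖∫ r in (0 : ℝ)..t, w r‖ ≤ M * t := by
  simpa [abs_of_nonneg ht.1] using norm_primitive_sub_le hT hw hM (left_mem_Icc.2 hT) ht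

/-- The product rule, in integrated form, for primitives of bounded curves in a Hilbert space. -/
theorem inner_primitive_eq [CompleteSpace H] (hT : 0 ≤ T) {p q : ℝ → H}
    (hp : MemLp p ∞ (intervalMeasure T)) (hq : MemLp q ∞ (intervalMeasure T)) {t : ℝ}
    (ht : t ∈ Icc 0 T) :
    inner ℝ (∫ s in (0 : ℝ)..t, p s) (∫ s in (0 : ℝ)..t, q s) =
      ∫ s in (0 : ℝ)..t, (inner ℝ (p s) (∫ r in (0 : ℝ)..s, q r) +
        inner ℝ (∫ r in (0 : ℝ)..s, p r) (q s)) := by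
  have hpi : IntegrableOn p (Ioo 0 T) := hp.integrable (by simp)
  have hqi : IntegrableOn q (Ioo 0 T) := hq.integrable (by simp)
  obtain ⟨M, hM0, hM⟩ := exists_bound_of_memLp_top hp
  obtain ⟨M', hM0', hM'⟩ := exists_bound_of_memLp_top hq
  set P : ℝ → H := fun t => ∫ s in (0 : ℝ)..t, p s with hP
  set Q : ℝ → H := fun t => ∫ s in (0 : ℝ)..t, q s with hQ
  have hlip : LipschitzOnWith (Real.toNNReal (2 * M * M' * T)) (fun s => (inner ℝ (P s) (Q s) : ℝ))
      (uIcc 0 t) := by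
    refine LipschitzOnWith.of_dist_le_mul fun x hx y hy => ?_
    rw [uIcc_of_le ht.1] at hx hy
    have hx' : x ∈ Icc 0 T := ⟨hx.1, hx.2.trans ht.2⟩
    have hy' : y ∈ Icc 0 T := ⟨hy.1, hy.2.trans ht.2⟩
    rw [Real.coe_toNNReal _ (by positivity), Real.dist_eq, Real.dist_eq]
    have e : (inner ℝ (P x) (Q x) : ℝ) - inner ℝ (P y) (Q y) =
        inner ℝ (P x - P y) (Q x) + inner ℝ (P y) (Q x - Q y) := by
      rw [inner_sub_left, inner_sub_right]; ring
    have h1 := norm_primitive_sub_le hT hpi hM hy' hx'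
    have h2 := norm_primitive_sub_le hT hqi hM' hy' hx'
    have h3 := norm_primitive_le hT hpi hM hy'
    have h4 := norm_primitive_le hT hqi hM' hx'
    have h3' : ‖P y‖ ≤ M * T := h3.trans (by gcongr; exact hy'.2)
    have h4' : ‖Q x‖ ≤ M' * T := h4.trans (by gcongr; exact hx'.2)
    rw [e]
    calc |(inner ℝ (P x - P y) (Q x) : ℝ) + inner ℝ (P y) (Q x - Q y)|
        ≤ ‖P x - P y‖ * ‖Q x‖ + ‖P y‖ * ‖Q x - Q y‖ :=
          (abs_add_le _ _).trans (add_le_add (abs_real_inner_le_norm _ _)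
            (abs_real_inner_le_norm _ _))
      _ ≤ (M * |x - y|) * (M' * T) + (M * T) * (M' * |x - y|) := by gcongr
      _ = 2 * M * M' * T * |x - y| := by ring
  have hFTC := hlip.absolutelyContinuousOnInterval.integral_deriv_eq_sub
  have h0 : (inner ℝ (P 0) (Q 0) : ℝ) = 0 := by simp [hP]
  rw [h0, sub_zero] at hFTC
  rw [← hFTC]
  refine intervalIntegral.integral_congr_ae ?_
  have hdp := ae_hasDerivAt_primitive hT hpi
  have hdq := ae_hasDerivAt_primitive hT hqi
  rw [ae_restrict_iff' measurableSet_Ioo] at hdp hdq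
  have hne : ∀ᵐ r : ℝ, r ≠ T := by simp [ae_iff, measure_singleton]
  filter_upwards [hdp, hdq, hne] with s h1 h2 h3 hs
  rw [uIoc_of_le ht.1] at hs
  have hs' : s ∈ Ioo 0 T := ⟨hs.1, lt_of_le_of_ne (hs.2.trans ht.2) h3⟩
  have := (h1 hs').inner ℝ (h2 hs')
  rw [this.deriv, add_comm]

/-- If the primitive of an integrable curve vanishes almost everywhere, so does the curve. -/
theorem ae_eq_zero_of_primitive_ae_eq_zero [CompleteSpace H] (hT : 0 ≤ T) {w : ℝ → H}
    (hw : IntegrableOn w (Ioo 0 T))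
    (h : ∀ᵐ t ∂(intervalMeasure T), ∫ s in (0 : ℝ)..t, w s = 0) :
    ∀ᵐ t ∂(intervalMeasure T), w t = 0 := by
  have hz : EqOn (fun t => ∫ s in (0 : ℝ)..t, w s) (fun _ => 0) (Ioo 0 T) :=
    Measure.eqOn_open_of_ae_eq h isOpen_Ioo
      ((continuousOn_primitive_Icc hT hw).mono Ioo_subset_Icc_self) continuousOn_const
  filter_upwards [ae_hasDerivAt_primitive hT hw, ae_restrict_mem measurableSet_Ioo] with t ht htT
  have h0 : HasDerivAt (fun t => ∫ s in (0 : ℝ)..t, w s) 0 t :=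
    (hasDerivAt_const t (0 : H)).congr_of_eventuallyEq
      (hz.eventuallyEq_of_mem (isOpen_Ioo.mem_nhds htT))
  exact ht.unique h0

theorem _root_.HasDerivAt.tendsto_backward_slope {F : Type*} [NormedAddCommGroup F]
    [NormedSpace ℝ F] {f : ℝ → F} {f' : F} {t : ℝ} (hf : HasDerivAt f f' t) :
    Tendsto (fun τ : ℝ => τ⁻¹ • (f t - f (t - τ))) (𝓝[>] 0) (𝓝 f') := by
  have h1 := hf.tendsto_slope_zero
  have h2 : Tendsto (fun τ : ℝ => -τ) (𝓝[>] 0) (𝓝[≠] 0) := by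
    refine tendsto_nhdsWithin_iff.2 ⟨?_, ?_⟩
    · have : Tendsto (fun τ : ℝ => -τ) (𝓝 0) (𝓝 0) := by
        simpa using (continuous_neg (G := ℝ)).tendsto 0
      exact this.mono_left nhdsWithin_le_nhds
    · filter_upwards [self_mem_nhdsWithin] with τ hτ
      exact neg_ne_zero.2 (ne_of_gt hτ)
  refine (h1.comp h2).congr fun τ => ?_
  simp only [Function.comp]
  rw [inv_neg, neg_smul, ← smul_neg, neg_sub, ← sub_eq_add_neg]

/-- The following lemma for curves on the whole line that vanish at negative times. The hypothesis
for backward increments of length `τ` is integrated in time, divided by `τ`, and passes to the limit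
`τ → 0⁺` at the Lebesgue points of `N`. -/
theorem ae_le_neg_two_integral_inner_aux [CompleteSpace H] {w z : ℝ → H} {N : ℝ → ℝ} {M M' : ℝ}
    (hw : LocallyIntegrable w volume) (hM : ∀ᵐ s, ‖w s‖ ≤ M) (hM0 : 0 ≤ M)
    (hz : AEStronglyMeasurable z volume) (hM' : ∀ᵐ s, ‖z s‖ ≤ M') (hM0' : 0 ≤ M')
    (hN : LocallyIntegrable N volume) (hN0 : ∀ s, s ≤ 0 → N s = 0)
    (h : ∀ τ : ℝ, 0 < τ → ∀ᵐ s, s ∈ Ioo 0 T → N s - N (s - τ) ≤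
      -2 * inner ℝ (z s) ((∫ r in (0 : ℝ)..s, w r) - ∫ r in (0 : ℝ)..(s - τ), w r)) :
    ∀ᵐ t ∂(intervalMeasure T), N t ≤ -2 * ∫ s in (0 : ℝ)..t, inner ℝ (z s) (w s) := by
  have hNi : ∀ x y, IntervalIntegrable N volume x y := fun x y =>
    intervalIntegrable_iff.2 <|
      (hN.integrableOn_isCompact isCompact_uIcc).mono_set uIoc_subset_uIcc
  have hwi : ∀ x y, IntervalIntegrable w volume x y := fun x y =>
    intervalIntegrable_iff.2 <|
      (hw.integrableOn_isCompact isCompact_uIcc).mono_set uIoc_subset_uIcc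
  set V : ℝ → H := fun t => ∫ s in (0 : ℝ)..t, w s with hV
  have hVc : Continuous V := intervalIntegral.continuous_primitive hwi 0
  have hVL : ∀ s τ, ‖V s - V (s - τ)‖ ≤ M * |τ| := fun s τ => by
    rw [hV]
    simp only
    rw [intervalIntegral.integral_interval_sub_left (hwi _ _) (hwi _ _)]
    refine (intervalIntegral.norm_integral_le_of_norm_le_const_ae
      (hM.mono fun x hx _ => hx)).trans ?_
    simp
  rw [ae_restrict_iff' measurableSet_Ioo]
  filter_upwards [_root_.LocallyIntegrable.ae_hasDerivAt_integral hN] with t ht htT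
  have hL := (ht 0).tendsto_backward_slope
  have hR : Tendsto (fun τ : ℝ => -2 * ∫ s in (0 : ℝ)..t, inner ℝ (z s) (τ⁻¹ • (V s - V (s - τ))))
      (𝓝[>] 0) (𝓝 (-2 * ∫ s in (0 : ℝ)..t, inner ℝ (z s) (w s))) := by
    refine Tendsto.const_mul _ ?_
    refine intervalIntegral.tendsto_integral_filter_of_dominated_convergence (fun _ => M' * M)
      ?_ ?_ (by simp) ?_
    · refine Eventually.of_forall fun τ => ?_
      refine (hz.inner ?_).restrict
      exact ((hVc.sub (hVc.comp (continuous_id.sub continuous_const))).const_smul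
        τ⁻¹).aestronglyMeasurable
    · filter_upwards [self_mem_nhdsWithin] with τ hτ
      filter_upwards [hM'] with s hs _
      have hτ' : (0 : ℝ) < τ := hτ
      refine (norm_inner_le_norm _ _).trans ?_
      refine mul_le_mul hs ?_ (norm_nonneg _) hM0'
      rw [norm_smul, norm_inv, Real.norm_eq_abs]
      calc |τ|⁻¹ * ‖V s - V (s - τ)‖ ≤ |τ|⁻¹ * (M * |τ|) := by gcongr; exact hVL s τ
        _ = M := by field_simp
    · filter_upwards [_root_.LocallyIntegrable.ae_hasDerivAt_integral hw] with s hs _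
      exact tendsto_const_nhds.inner (hs 0).tendsto_backward_slope
  refine le_of_tendsto_of_tendsto hL hR ?_
  filter_upwards [self_mem_nhdsWithin] with τ hτ
  have hτ' : (0 : ℝ) < τ := hτ
  have hint : IntervalIntegrable (fun s => (inner ℝ (z s) (τ⁻¹ • (V s - V (s - τ))) : ℝ))
      volume 0 t := by
    refine (intervalIntegrable_const (c := M' * M)).mono_fun ?_
      (ae_restrict_of_ae (hM'.mono fun s hs => ?_))
    · refine (hz.inner ?_).restrict
      exact ((hVc.sub (hVc.comp (continuous_id.sub continuous_const))).const_smul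
        τ⁻¹).aestronglyMeasurable
    · refine (norm_inner_le_norm _ _).trans ?_
      rw [Real.norm_of_nonneg (by positivity : 0 ≤ M' * M)]
      refine mul_le_mul hs ?_ (norm_nonneg _) hM0'
      rw [norm_smul, norm_inv, Real.norm_eq_abs]
      calc |τ|⁻¹ * ‖V s - V (s - τ)‖ ≤ |τ|⁻¹ * (M * |τ|) := by gcongr; exact hVL s τ
        _ = M := by field_simp
  have hshift : IntervalIntegrable (fun s => N (s - τ)) volume 0 t := by
    simpa using (hNi (0 - τ) (t - τ)).comp_sub_right τ
  -- The part of the shifted integral over negative times vanishes.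
  have hsplit : (∫ s in (0 : ℝ)..t, N s) - ∫ s in (0 : ℝ)..(t - τ), N s =
      ∫ s in (0 : ℝ)..t, (N s - N (s - τ)) := by
    rw [intervalIntegral.integral_sub (hNi _ _) hshift,
      intervalIntegral.integral_comp_sub_right (fun s => N s) τ,
      ← intervalIntegral.integral_add_adjacent_intervals (hNi (0 - τ) 0) (hNi 0 (t - τ))]
    have hz0 : ∫ s in (0 - τ)..0, N s = 0 := by
      rw [intervalIntegral.integral_congr (g := fun _ => (0 : ℝ))]
      · simp
      · intro s hs
        rw [uIcc_of_le (by linarith)] at hs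
        exact hN0 s hs.2
    rw [hz0, zero_add]
  have hmono : ∫ s in (0 : ℝ)..t, (N s - N (s - τ)) ≤
      ∫ s in (0 : ℝ)..t, (-2 * τ) * inner ℝ (z s) (τ⁻¹ • (V s - V (s - τ))) := by
    refine intervalIntegral.integral_mono_ae_restrict htT.1.le ((hNi _ _).sub hshift)
      (hint.const_mul _) ?_
    have hne : ∀ᵐ r : ℝ, r ≠ 0 := by simp [ae_iff, measure_singleton]
    rw [EventuallyLE, ae_restrict_iff' measurableSet_Icc]
    filter_upwards [h τ hτ', hne] with s hs hs0 hst
    refine (hs ⟨lt_of_le_of_ne hst.1 (Ne.symm hs0), hst.2.trans_lt htT.2⟩).trans (le_of_eq ?_)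
    rw [inner_smul_right]
    field_simp
    rfl
  rw [intervalIntegral.integral_const_mul] at hmono
  rw [smul_eq_mul, hsplit]
  calc τ⁻¹ * ∫ s in (0 : ℝ)..t, (N s - N (s - τ))
      ≤ τ⁻¹ * ((-2 * τ) * ∫ s in (0 : ℝ)..t, inner ℝ (z s) (τ⁻¹ • (V s - V (s - τ)))) := by
        gcongr
    _ = _ := by field_simp

/-- Let `V` be the primitive of a bounded curve `w`, and let `N ≥ 0` be given at almost every time
by `N = -⟪z, V⟫`, where `z` is bounded and `-2 z(t)` is a subgradient-type bound of `N` along `V`.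
Then `N(t) ≤ -2 ∫₀ᵗ ⟪z, w⟫`. This is used with `N = ‖v_x‖²` and `z = v_xx`, in which case `v_x` has
no time derivative in the Hilbert space. -/
theorem ae_le_neg_two_integral_inner [CompleteSpace H] (hT : 0 ≤ T) {w z : ℝ → H} {N : ℝ → ℝ}
    (hw : MemLp w ∞ (intervalMeasure T)) (hz : MemLp z ∞ (intervalMeasure T)) {G : Set ℝ}
    (hG : ∀ᵐ t ∂(intervalMeasure T), t ∈ G) (hN0 : ∀ t ∈ G, 0 ≤ N t)
    (hN : ∀ t ∈ G, N t = -inner ℝ (z t) (∫ r in (0 : ℝ)..t, w r))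
    (h : ∀ s ∈ G, ∀ t ∈ G, N t - N s ≤
      -2 * inner ℝ (z t) ((∫ r in (0 : ℝ)..t, w r) - ∫ r in (0 : ℝ)..s, w r)) :
    ∀ᵐ t ∂(intervalMeasure T), N t ≤ -2 * ∫ s in (0 : ℝ)..t, inner ℝ (z s) (w s) := by
  obtain ⟨M, hM0, hM⟩ := exists_bound_of_memLp_top hw
  obtain ⟨M', hM0', hM'⟩ := exists_bound_of_memLp_top hz
  have hwi : IntegrableOn w (Ioo 0 T) := hw.integrable (by simp)
  have hzi : IntegrableOn z (Ioo 0 T) := hz.integrable (by simp)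
  have hVc := continuousOn_primitive_Icc hT hwi
  have hNi : IntegrableOn N (Ioo 0 T) := by
    have hVm : AEStronglyMeasurable (fun t => ∫ r in (0 : ℝ)..t, w r) (intervalMeasure T) :=
      (hVc.mono Ioo_subset_Icc_self).aestronglyMeasurable measurableSet_Ioo
    have h1 : IntegrableOn (fun t => -(inner ℝ (z t) (∫ r in (0 : ℝ)..t, w r) : ℝ)) (Ioo 0 T) := by
      refine Integrable.mono' (g := fun _ => M' * (M * T)) (integrable_const _)
        (hz.1.inner hVm).neg ?_
      filter_upwards [hM', ae_restrict_mem measurableSet_Ioo] with t ht htT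
      rw [norm_neg]
      refine (norm_inner_le_norm _ _).trans (mul_le_mul ht ?_ (norm_nonneg _) hM0')
      refine (norm_primitive_le hT hwi hM (Ioo_subset_Icc_self htT)).trans ?_
      gcongr
      exact htT.2.le
    refine h1.congr ?_
    filter_upwards [hG] with t ht
    rw [hN t ht]
  have hind : ∀ t ∈ Icc (0 : ℝ) T,
      ∫ r in (0 : ℝ)..t, (Ioo 0 T).indicator w r = ∫ r in (0 : ℝ)..t, w r := by
    intro t ht
    rw [← setIntegral_Ioo_eq ht.1, ← setIntegral_Ioo_eq ht.1]
    refine setIntegral_congr_fun measurableSet_Ioo fun r hr => ?_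
    exact indicator_of_mem (Ioo_subset_Ioo_right ht.2 hr) w
  have hind0 : ∀ t ≤ (0 : ℝ), ∫ r in (0 : ℝ)..t, (Ioo 0 T).indicator w r = 0 := by
    intro t ht
    rw [intervalIntegral.integral_congr (g := fun _ => (0 : H))]
    · simp
    · intro r hr
      rw [uIcc_of_ge ht] at hr
      exact indicator_of_notMem (fun h' => absurd h'.1 (not_lt.2 hr.2)) w
  rw [ae_restrict_iff' measurableSet_Ioo] at hM hM' hG
  have key := ae_le_neg_two_integral_inner_aux (T := T) (w := (Ioo 0 T).indicator w)
    (z := (Ioo 0 T).indicator z) (N := (Ioo 0 T).indicator N) (M := M) (M' := M')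
    ((integrable_indicator_iff measurableSet_Ioo).2 hwi).locallyIntegrable ?_ hM0
    ((integrable_indicator_iff measurableSet_Ioo).2 hzi).aestronglyMeasurable ?_ hM0'
    ((integrable_indicator_iff measurableSet_Ioo).2 hNi).locallyIntegrable ?_ ?_
  · filter_upwards [key, ae_restrict_mem measurableSet_Ioo] with t ht htT
    rw [indicator_of_mem htT] at ht
    refine ht.trans (le_of_eq ?_)
    rw [← setIntegral_Ioo_eq htT.1.le, ← setIntegral_Ioo_eq htT.1.le]
    congr 1
    refine setIntegral_congr_fun measurableSet_Ioo fun r hr => ?_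
    have hr' : r ∈ Ioo 0 T := Ioo_subset_Ioo_right htT.2.le hr
    change inner ℝ ((Ioo 0 T).indicator z r) ((Ioo 0 T).indicator w r) = inner ℝ (z r) (w r)
    rw [indicator_of_mem hr', indicator_of_mem hr']
  · filter_upwards [hM] with s hs
    by_cases h' : s ∈ Ioo 0 T
    · rw [indicator_of_mem h']; exact hs h'
    · rw [indicator_of_notMem h', norm_zero]; exact hM0
  · filter_upwards [hM'] with s hs
    by_cases h' : s ∈ Ioo 0 T
    · rw [indicator_of_mem h']; exact hs h'
    · rw [indicator_of_notMem h', norm_zero]; exact hM0'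
  · intro s hs
    exact indicator_of_notMem (fun h' => absurd h'.1 (not_lt.2 hs)) N
  · intro τ hτ
    have hG' := (measurePreserving_sub_right volume τ).quasiMeasurePreserving.ae hG
    filter_upwards [hG, hG'] with s hs hs' hsT
    rw [indicator_of_mem hsT, indicator_of_mem hsT, hind s (Ioo_subset_Icc_self hsT)]
    rcases lt_or_ge 0 (s - τ) with hpos | hneg
    · have hm : s - τ ∈ Ioo 0 T := ⟨hpos, (sub_lt_self s hτ).trans hsT.2⟩
      rw [indicator_of_mem hm, hind _ (Ioo_subset_Icc_self hm)]
      exact h _ (hs' hm) _ (hs hsT)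
    · rw [indicator_of_notMem (fun h' => absurd h'.1 (not_lt.2 hneg)), hind0 _ hneg, sub_zero,
        sub_zero]
      have h1 := hN s (hs hsT)
      have h2 := hN0 s (hs hsT)
      linarith

end TimeCalculus

/-! ### Weak derivatives and traces on an interval -/

section SpaceCalculus

variable {L : ℝ}

theorem integrableOn_L2 (v : L2 L) : IntegrableOn v (Ioo 0 L) :=
  (Lp.memLp v).integrable (by norm_num)

theorem inner_eq_integral (v w : L2 L) : inner ℝ v w = ∫ x in Ioo 0 L, v x * w x := by
  rw [L2.inner_def]
  refine integral_congr_ae (ae_of_all _ fun x => ?_)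
  simp [mul_comm]

theorem memLp_of_continuous {c : ℝ → ℝ} (hc : Continuous c) :
    MemLp c 2 (intervalMeasure L) := by
  obtain ⟨M, hM⟩ := isCompact_Icc.exists_bound_of_continuousOn (s := Icc 0 L) hc.continuousOn
  refine MemLp.of_bound hc.aestronglyMeasurable M ?_
  filter_upwards [ae_restrict_mem measurableSet_Ioo] with x hx
  exact hM x (Ioo_subset_Icc_self hx)

/-- The class in `L²(0, L)` of a continuous function on `ℝ`. -/
noncomputable def ofContinuous (L : ℝ) (c : ℝ → ℝ) (hc : Continuous c) : L2 L :=
  (memLp_of_continuous hc).toLp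

theorem coeFn_ofContinuous {c : ℝ → ℝ} (hc : Continuous c) :
    ofContinuous L c hc =ᵐ[intervalMeasure L] c := MemLp.coeFn_toLp _

theorem inner_ofContinuous (v : L2 L) {c : ℝ → ℝ} (hc : Continuous c) :
    inner ℝ v (ofContinuous L c hc) = ∫ x in Ioo 0 L, v x * c x := by
  rw [inner_eq_integral]
  refine integral_congr_ae ?_
  filter_upwards [coeFn_ofContinuous (L := L) hc] with x hx
  rw [hx]

theorem IsTestFunction.continuous {φ : ℝ → ℝ} (hφ : IsTestFunction L φ) : Continuous φ :=
  hφ.1.continuous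

/-- The definition of the weak derivative, expressed by inner products. -/
theorem hasWeakDeriv_iff_inner {v w : L2 L} : HasWeakDeriv v w ↔
    ∀ φ : ℝ → ℝ, ∀ hφ : IsTestFunction L φ,
      inner ℝ v (ofContinuous L (deriv φ) hφ.of_deriv.continuous) =
        -inner ℝ w (ofContinuous L φ hφ.continuous) := by
  simp only [HasWeakDeriv, inner_ofContinuous]

theorem HasWeakDeriv.add {v w v' w' : L2 L} (h : HasWeakDeriv v w) (h' : HasWeakDeriv v' w') :
    HasWeakDeriv (v + v') (w + w') := by
  rw [hasWeakDeriv_iff_inner] at *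
  intro φ hφ
  rw [inner_add_left, inner_add_left, h φ hφ, h' φ hφ]; ring

theorem HasWeakDeriv.smul {v w : L2 L} (h : HasWeakDeriv v w) (k : ℝ) :
    HasWeakDeriv (k • v) (k • w) := by
  rw [hasWeakDeriv_iff_inner] at *
  intro φ hφ
  rw [real_inner_smul_left, real_inner_smul_left, h φ hφ]; ring

theorem HasWeakDeriv.neg {v w : L2 L} (h : HasWeakDeriv v w) : HasWeakDeriv (-v) (-w) := by
  simpa using h.smul (-1)

theorem HasWeakDeriv.sub {v w v' w' : L2 L} (h : HasWeakDeriv v w) (h' : HasWeakDeriv v' w') :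
    HasWeakDeriv (v - v') (w - w') := by
  simpa [sub_eq_add_neg] using h.add h'.neg

theorem HasWeakDeriv.unique {v w w' : L2 L} (h : HasWeakDeriv v w) (h' : HasWeakDeriv v w') :
    w = w' := by
  have h0 := h.sub h'
  rw [sub_self] at h0
  have hz : ∀ᵐ x ∂(intervalMeasure L), (w - w' : L2 L) x = 0 := by
    refine ae_eq_zero_of_integral_test (integrableOn_L2 _) fun φ hφ => ?_
    have := hasWeakDeriv_iff_inner.1 h0 φ hφ
    rw [inner_zero_left, inner_ofContinuous] at this
    simp only [smul_eq_mul, mul_comm (φ _)]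
    linarith
  rw [← sub_eq_zero]
  refine Lp.ext ?_
  filter_upwards [hz, Lp.coeFn_zero ℝ 2 (intervalMeasure L)] with x h1 h2
  rw [h1, h2, Pi.zero_apply]

/-- Weak differentiation commutes with Bochner integration in a parameter. -/
theorem HasWeakDeriv.intervalIntegral {T : ℝ} {v w : ℝ → L2 L}
    (hv : IntegrableOn v (Ioo 0 T)) (hw : IntegrableOn w (Ioo 0 T))
    (h : HasWeakSpaceDeriv T v w) {t : ℝ} (ht : t ∈ Icc 0 T) :
    HasWeakDeriv (∫ s in (0 : ℝ)..t, v s) (∫ s in (0 : ℝ)..t, w s) := by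
  rw [hasWeakDeriv_iff_inner]
  intro φ hφ
  have hsub : Ioo 0 t ⊆ Ioo 0 T := Ioo_subset_Ioo_right ht.2
  have e : ∀ (f : ℝ → L2 L) (c : L2 L), IntegrableOn f (Ioo 0 t) →
      inner ℝ (∫ s in Ioo 0 t, f s) c = ∫ s in Ioo 0 t, inner ℝ (f s) c := fun f c hf => by
    rw [real_inner_comm, ← integral_inner hf]
    simp_rw [real_inner_comm]
  rw [← setIntegral_Ioo_eq ht.1, ← setIntegral_Ioo_eq ht.1, e v _ (hv.mono_set hsub),
    e w _ (hw.mono_set hsub), ← integral_neg]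
  refine integral_congr_ae ?_
  filter_upwards [ae_mono (Measure.restrict_mono_set _ hsub) h] with s hs
  exact hasWeakDeriv_iff_inner.1 hs φ hφ

/-- A continuously differentiable function has its classical derivative as weak derivative. -/
theorem hasWeakDeriv_ofContinuous (hL : 0 < L) {c c' : ℝ → ℝ} (hc : Continuous c)
    (hc' : Continuous c') (hd : ∀ x, HasDerivAt c (c' x) x) :
    HasWeakDeriv (ofContinuous L c hc) (ofContinuous L c' hc') := by
  rw [hasWeakDeriv_iff_inner]
  intro φ hφ
  have hderiv : deriv c = c' := funext fun x => (hd x).deriv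
  have hcac : AbsolutelyContinuousOnInterval c 0 L :=
    (contDiff_one_iff_deriv.2 ⟨fun x => (hd x).differentiableAt, by rwa [hderiv]⟩
      ).contDiffOn.absolutelyContinuousOnInterval
  have hφac : AbsolutelyContinuousOnInterval φ 0 L :=
    (hφ.1.of_le (by simp)).contDiffOn.absolutelyContinuousOnInterval
  have h := hcac.integral_deriv_mul_eq_sub hφac
  rw [hφ.eq_zero_of_notMem (t := L) (by simp), hφ.eq_zero_of_notMem (t := 0) (by simp),
    hderiv, intervalIntegral.integral_add (f := fun x => c' x * φ x)
      (g := fun x => c x * deriv φ x) ((hc'.mul hφ.continuous).intervalIntegrable _ _)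
      ((hc.mul hφ.of_deriv.continuous).intervalIntegrable _ _), ← setIntegral_Ioo_eq hL.le,
    ← setIntegral_Ioo_eq hL.le] at h
  rw [inner_ofContinuous, inner_ofContinuous]
  have e1 : ∫ x in Ioo 0 L, (ofContinuous L c hc) x * deriv φ x =
      ∫ x in Ioo 0 L, c x * deriv φ x := by
    refine integral_congr_ae ?_
    filter_upwards [coeFn_ofContinuous (L := L) hc] with x hx
    rw [hx]
  have e2 : ∫ x in Ioo 0 L, (ofContinuous L c' hc') x * φ x =
      ∫ x in Ioo 0 L, c' x * φ x := by
    refine integral_congr_ae ?_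
    filter_upwards [coeFn_ofContinuous (L := L) hc'] with x hx
    rw [hx]
  rw [e1, e2]
  linarith

theorem pointValue_eq (hL : 0 < L) {v : L2 L} {c : ℝ → ℝ} (hc : ContinuousOn c (Icc 0 L))
    (hv : v =ᵐ[intervalMeasure L] c) {y : ℝ} (hy : y ∈ Icc 0 L) : pointValue v y = c y := by
  have h : ∃ c : ℝ → ℝ, ContinuousOn c (Icc 0 L) ∧ v =ᵐ[intervalMeasure L] c := ⟨c, hc, hv⟩
  rw [pointValue, dif_pos h]
  have h1 : EqOn h.choose c (Ioo 0 L) :=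
    Measure.eqOn_open_of_ae_eq (h.choose_spec.2.symm.trans hv) isOpen_Ioo
      (h.choose_spec.1.mono Ioo_subset_Icc_self) (hc.mono Ioo_subset_Icc_self)
  refine h1.of_subset_closure h.choose_spec.1 hc Ioo_subset_Icc_self ?_ hy
  rw [closure_Ioo hL.ne]

theorem pointValue_ofContinuous (hL : 0 < L) {c : ℝ → ℝ} (hc : Continuous c) {y : ℝ}
    (hy : y ∈ Icc 0 L) : pointValue (ofContinuous L c hc) y = c y :=
  pointValue_eq hL hc.continuousOn (coeFn_ofContinuous hc) hy

/-- The absolutely continuous representative of an `H¹` function. -/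
theorem HasWeakDeriv.exists_rep (hL : 0 < L) {v w : L2 L} (h : HasWeakDeriv v w) :
    ∃ c : ℝ → ℝ, AbsolutelyContinuousOnInterval c 0 L ∧ v =ᵐ[intervalMeasure L] c ∧
      (∀ y ∈ Icc 0 L, pointValue v y = c y) ∧
      ∀ᵐ x ∂(intervalMeasure L), deriv c x = w x := by
  obtain ⟨k, hk⟩ := exists_ae_eq_const_add_primitive hL (integrableOn_L2 v) (integrableOn_L2 w)
    (fun φ hφ => by
      have := h φ hφ
      simp only [smul_eq_mul, mul_comm (φ _), mul_comm (deriv φ _)]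
      exact this)
  have hwi := intervalIntegrable_of_Ioo hL.le (integrableOn_L2 w)
  have hac : AbsolutelyContinuousOnInterval (fun x => k + ∫ s in (0 : ℝ)..x, w s) 0 L :=
    (LipschitzOnWith.absolutelyContinuousOnInterval (K := 0)
      ((LipschitzWith.const k).lipschitzOnWith)).add
      (hwi.absolutelyContinuousOnInterval_intervalIntegral left_mem_uIcc)
  have hcont : ContinuousOn (fun x => k + ∫ s in (0 : ℝ)..x, w s) (Icc 0 L) := by
    have := hac.continuousOn
    rwa [uIcc_of_le hL.le] at this
  refine ⟨_, hac, hk, fun y hy => pointValue_eq hL hcont hk hy, ?_⟩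
  filter_upwards [ae_hasDerivAt_primitive hL.le (integrableOn_L2 w)] with x hx
  exact (hx.const_add k).deriv

/-- Integration by parts in `H¹(0, L)`. -/
theorem inner_add_inner_eq (hL : 0 < L) {v w v' w' : L2 L} (h : HasWeakDeriv v w)
    (h' : HasWeakDeriv v' w') :
    inner ℝ w v' + inner ℝ v w' =
      pointValue v L * pointValue v' L - pointValue v 0 * pointValue v' 0 := by
  obtain ⟨c, hc, hvc, hpc, hdc⟩ := h.exists_rep hL
  obtain ⟨c', hc', hvc', hpc', hdc'⟩ := h'.exists_rep hL
  have hLm : L ∈ Icc 0 L := right_mem_Icc.2 hL.le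
  have h0m : (0 : ℝ) ∈ Icc 0 L := left_mem_Icc.2 hL.le
  rw [hpc L hLm, hpc 0 h0m, hpc' L hLm, hpc' 0 h0m, ← hc.integral_deriv_mul_eq_sub hc',
    ← setIntegral_Ioo_eq hL.le, inner_eq_integral, inner_eq_integral, ← integral_add]
  · refine integral_congr_ae ?_
    filter_upwards [hvc, hdc, hvc', hdc'] with x h1 h2 h3 h4
    rw [h1, h2, h3, h4]
  · simpa [mul_comm] using L2.integrable_inner (𝕜 := ℝ) w v'
  · simpa [mul_comm] using L2.integrable_inner (𝕜 := ℝ) v w'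

theorem inner_self_deriv_eq (hL : 0 < L) {v w : L2 L} (h : HasWeakDeriv v w) :
    2 * inner ℝ v w = pointValue v L ^ 2 - pointValue v 0 ^ 2 := by
  have := inner_add_inner_eq hL h h
  rw [real_inner_comm] at this
  linarith

theorem integral_abs_mul_le (v w : L2 L) : ∫ x in Ioo 0 L, |v x * w x| ≤ ‖v‖ * ‖w‖ := by
  have h1 : ∫ x in Ioo 0 L, |v x * w x| = inner ℝ |v| |w| := by
    rw [inner_eq_integral]
    refine integral_congr_ae ?_
    filter_upwards [Lp.coeFn_abs v, Lp.coeFn_abs w] with x h1 h2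
    rw [h1, h2, abs_mul]
  rw [h1]
  exact (real_inner_le_norm _ _).trans_eq (by rw [norm_abs_eq_norm, norm_abs_eq_norm])

/-- The trace inequality `v(y)² ≤ ‖v‖² / L + 2 ‖v‖ ‖v_x‖` on `[0, L]`. -/
theorem pointValue_sq_le (hL : 0 < L) {v w : L2 L} (h : HasWeakDeriv v w) {y : ℝ}
    (hy : y ∈ Icc 0 L) : pointValue v y ^ 2 ≤ ‖v‖ ^ 2 / L + 2 * ‖v‖ * ‖w‖ := by
  obtain ⟨c, hc, hvc, hpc, hdc⟩ := h.exists_rep hL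
  rw [hpc y hy]
  have hint : IntegrableOn (fun x => |v x * w x|) (Ioo 0 L) := by
    refine (L2.integrable_inner (𝕜 := ℝ) v w).abs.congr (ae_of_all _ fun x => ?_)
    simp [mul_comm]
  have hdiff : ∀ x ∈ Icc 0 L, c y ^ 2 - c x ^ 2 ≤ 2 * ‖v‖ * ‖w‖ := by
    intro x hx
    have hsub : uIcc x y ⊆ uIcc 0 L := by
      rw [uIcc_of_le hL.le]; exact uIcc_subset_Icc hx hy
    have hacxy := hc.mono hsub
    have e := hacxy.integral_deriv_mul_eq_sub hacxy
    have hIoc : uIoc x y ⊆ Ioc 0 L := by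
      rw [← uIoc_of_le hL.le]; exact uIoc_subset_uIoc_of_uIcc_subset_uIcc hsub
    have hb : ‖∫ s in x..y, (deriv c s * c s + c s * deriv c s)‖ ≤
        ∫ s in Ioo 0 L, 2 * |v s * w s| := by
      refine (intervalIntegral.norm_integral_le_integral_norm_uIoc).trans ?_
      have e3 : ∫ s in Ioo 0 L, 2 * |v s * w s| =
          ∫ s in Ioc 0 L, ‖deriv c s * c s + c s * deriv c s‖ := by
        rw [integral_Ioc_eq_integral_Ioo]
        refine integral_congr_ae ?_
        filter_upwards [hvc, hdc] with s h1 h2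
        rw [h1, h2, Real.norm_eq_abs, mul_comm (w s), ← two_mul, abs_mul 2, abs_two]
      rw [e3]
      refine setIntegral_mono_set ?_ (ae_of_all _ fun s => norm_nonneg _) hIoc.eventuallyLE
      rw [integrableOn_Ioc_iff_integrableOn_Ioo]
      refine (hint.const_mul 2).congr ?_
      filter_upwards [hvc, hdc] with s h1 h2
      rw [h1, h2, Real.norm_eq_abs, mul_comm (w s), ← two_mul, abs_mul 2, abs_two]
    rw [e, integral_const_mul] at hb
    have h5 := integral_abs_mul_le v w
    have h6 := (le_abs_self _).trans hb
    nlinarith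
  have hsq : IntegrableOn (fun x => c x ^ 2) (Ioo 0 L) := by
    have := L2.integrable_inner (𝕜 := ℝ) v v
    refine this.congr ?_
    filter_upwards [hvc] with s h1
    simp [h1, sq]
  have hnorm : ∫ x in Ioo 0 L, c x ^ 2 = ‖v‖ ^ 2 := by
    rw [← real_inner_self_eq_norm_sq, inner_eq_integral]
    refine integral_congr_ae ?_
    filter_upwards [hvc] with s h1
    rw [h1, sq]
  -- Averaging over `x` the bound of `v(y)² - v(x)²`.
  have hav : ∫ x in Ioo 0 L, c y ^ 2 ≤ ∫ x in Ioo 0 L, (c x ^ 2 + 2 * ‖v‖ * ‖w‖) := by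
    refine setIntegral_mono_on (integrable_const _) (hsq.add (integrable_const _))
      measurableSet_Ioo fun x hx => ?_
    linarith [hdiff x (Ioo_subset_Icc_self hx)]
  rw [integral_add hsq (integrable_const _), hnorm] at hav
  simp only [setIntegral_const, smul_eq_mul, measureReal_def, Real.volume_Ioo, sub_zero,
    ENNReal.toReal_ofReal hL.le] at hav
  rw [div_add' _ _ _ hL.ne', le_div_iff₀ hL]
  linarith

theorem ae_sq_le (hL : 0 < L) {v w : L2 L} (h : HasWeakDeriv v w) :
    ∀ᵐ x ∂(intervalMeasure L), v x ^ 2 ≤ ‖v‖ ^ 2 / L + 2 * ‖v‖ * ‖w‖ := by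
  obtain ⟨c, hc, hvc, hpc, hdc⟩ := h.exists_rep hL
  filter_upwards [hvc, ae_restrict_mem measurableSet_Ioo] with x h1 h2
  rw [h1, ← hpc x (Ioo_subset_Icc_self h2)]
  exact pointValue_sq_le hL h (Ioo_subset_Icc_self h2)

theorem pointValue_add (hL : 0 < L) {v w v' w' : L2 L} (h : HasWeakDeriv v w)
    (h' : HasWeakDeriv v' w') {y : ℝ} (hy : y ∈ Icc 0 L) :
    pointValue (v + v') y = pointValue v y + pointValue v' y := by
  obtain ⟨c, hc, hvc, hpc, -⟩ := h.exists_rep hL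
  obtain ⟨c', hc', hvc', hpc', -⟩ := h'.exists_rep hL
  have h1 := hc.continuousOn
  have h2 := hc'.continuousOn
  rw [uIcc_of_le hL.le] at h1 h2
  rw [hpc y hy, hpc' y hy]
  refine pointValue_eq hL (c := fun x => c x + c' x) (h1.add h2) ?_ hy
  filter_upwards [Lp.coeFn_add v v', hvc, hvc'] with x h1 h2 h3
  rw [h1, Pi.add_apply, h2, h3]

theorem pointValue_smul (hL : 0 < L) {v w : L2 L} (h : HasWeakDeriv v w) (k : ℝ) {y : ℝ}
    (hy : y ∈ Icc 0 L) : pointValue (k • v) y = k * pointValue v y := by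
  obtain ⟨c, hc, hvc, hpc, -⟩ := h.exists_rep hL
  have h1 := hc.continuousOn
  rw [uIcc_of_le hL.le] at h1
  rw [hpc y hy]
  refine pointValue_eq hL (c := fun x => k * c x) (continuousOn_const.mul h1) ?_ hy
  filter_upwards [Lp.coeFn_smul k v, hvc] with x h1 h2
  rw [h1, Pi.smul_apply, h2, smul_eq_mul]

theorem pointValue_sub (hL : 0 < L) {v w v' w' : L2 L} (h : HasWeakDeriv v w)
    (h' : HasWeakDeriv v' w') {y : ℝ} (hy : y ∈ Icc 0 L) :
    pointValue (v - v') y = pointValue v y - pointValue v' y := by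
  have h1 := pointValue_add hL h (h'.smul (-1)) hy
  rw [pointValue_smul hL h' (-1) hy] at h1
  rw [sub_eq_add_neg, ← neg_one_smul ℝ v', h1]
  ring

/-- The trace at `0` is a bounded linear functional of the pair `(v, v_x)`. -/
theorem exists_trace_functional (hL : 0 < L) : ∃ e₀ e₁ : L2 L, ∀ v w : L2 L, HasWeakDeriv v w →
    pointValue v 0 = inner ℝ e₀ v + inner ℝ e₁ w := by
  have hc : Continuous fun x : ℝ => (L - x) / L := by fun_prop
  have hc' : Continuous fun _ : ℝ => (-1) / L := by fun_prop
  refine ⟨-ofContinuous L _ hc', -ofContinuous L _ hc, fun v w h => ?_⟩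
  have hd := hasWeakDeriv_ofContinuous hL hc hc' fun x =>
    ((hasDerivAt_id x).const_sub L).div_const L
  have e := inner_add_inner_eq hL hd h
  rw [pointValue_ofContinuous hL hc (right_mem_Icc.2 hL.le),
    pointValue_ofContinuous hL hc (left_mem_Icc.2 hL.le)] at e
  rw [inner_neg_left, inner_neg_left]
  have h1 : (L - 0) / L = 1 := by field_simp; ring
  rw [h1, sub_self, zero_div, zero_mul, one_mul] at e
  linarith

end SpaceCalculus

/-! ### Energy inequalities at a fixed time -/

section Slices

variable {L : ℝ}

theorem mul_le_young {μ : ℝ} (hμ : 0 < μ) (c x y : ℝ) :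
    c * (x * y) ≤ μ / 2 * y ^ 2 + c ^ 2 / (2 * μ) * x ^ 2 := by
  have : 0 ≤ 1 / (2 * μ) * (c * x - μ * y) ^ 2 := by positivity
  have e : 1 / (2 * μ) * (c * x - μ * y) ^ 2 =
      μ / 2 * y ^ 2 + c ^ 2 / (2 * μ) * x ^ 2 - c * (x * y) := by
    field_simp; ring
  linarith

/-- A boundary-layer profile `ρ` of width `σ²`, with weak derivative `ρx`: the only properties of
the explicit exponential that the energy estimates use. -/
structure LayerProfile (σ N : ℝ) (ρ ρx : L2 L) : Prop where
  weakDeriv : HasWeakDeriv ρ ρx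
  norm_le : ‖ρ‖ ≤ N * σ
  norm_deriv_le : σ * ‖ρx‖ ≤ N
  trace_le : |pointValue ρ 0| ≤ N
  inner_le : ∀ v w : L2 L, HasWeakDeriv v w → pointValue v 0 = 0 →
    |inner ℝ ρ v| ≤ N * σ ^ 3 * ‖w‖

/-- The equations satisfied at one instant by the error `(U, P)` of the corrected approximation,
with time derivatives `(Ut, S)` and viscosity `ε = σ²`. The forcing consists of a smooth part
`2 σ² k` and of a layer, of amplitude `η` in the first equation and `-(b / a) η` in the second one.
The constants of the physical problem are `a = U₀` and `b = λ⁻²`. -/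
structure ErrorSlice (a b σ N : ℝ) (ρ k : L2 L) (η : ℝ) (U Ut Ux Uxx P S Px Pxx : L2 L) :
    Prop where
  dU : HasWeakDeriv U Ux
  dUx : HasWeakDeriv Ux Uxx
  dP : HasWeakDeriv P Px
  dPx : HasWeakDeriv Px Pxx
  traceU_zero : pointValue U 0 = 0
  traceU_L : pointValue U L = 0
  traceP_zero : pointValue P 0 = 0
  eq_U : Ut + a • Ux + Px - (2 * σ ^ 2) • Uxx = (2 * σ ^ 2) • k + η • ρ
  eq_P : S + a • Px + b • Ux = (-(b / a) * η) • ρ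
  norm_k : ‖k‖ ≤ N
  abs_η : |η| ≤ N

variable {a b σ N : ℝ} {ρ ρx k : L2 L} {η : ℝ} {U Ut Ux Uxx P S Px Pxx : L2 L}

theorem ErrorSlice.Ut_eq (h : ErrorSlice a b σ N ρ k η U Ut Ux Uxx P S Px Pxx) :
    Ut = (2 * σ ^ 2) • k + η • ρ - a • Ux - Px + (2 * σ ^ 2) • Uxx := by
  rw [← h.eq_U]; abel

theorem ErrorSlice.S_eq (h : ErrorSlice a b σ N ρ k η U Ut Ux Uxx P S Px Pxx) :
    S = (-(b / a) * η) • ρ - a • Px - b • Ux := by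
  rw [← h.eq_P]; abel

theorem ErrorSlice.dS (h : ErrorSlice a b σ N ρ k η U Ut Ux Uxx P S Px Pxx)
    (hρ : LayerProfile σ N ρ ρx) :
    HasWeakDeriv S ((-(b / a) * η) • ρx - a • Pxx - b • Uxx) := by
  rw [h.S_eq]
  exact ((hρ.weakDeriv.smul _).sub (h.dPx.smul _)).sub (h.dUx.smul _)

theorem ErrorSlice.norm_forcing_le (h : ErrorSlice a b σ N ρ k η U Ut Ux Uxx P S Px Pxx)
    (hρ : LayerProfile σ N ρ ρx) (hσ : 0 < σ) (hσ1 : σ ≤ 1) :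
    ‖(2 * σ ^ 2) • k + η • ρ‖ ≤ (2 * N + N ^ 2) * σ := by
  have hN : 0 ≤ N := (abs_nonneg _).trans h.abs_η
  calc ‖(2 * σ ^ 2) • k + η • ρ‖ ≤ (2 * σ ^ 2) * ‖k‖ + |η| * ‖ρ‖ := by
        refine (norm_add_le _ _).trans (le_of_eq ?_)
        rw [norm_smul, norm_smul, Real.norm_of_nonneg (by positivity), Real.norm_eq_abs]
    _ ≤ (2 * σ ^ 2) * N + N * (N * σ) := by
        gcongr
        · exact h.norm_k
        · exact h.abs_η
        · exact hρ.norm_le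
    _ ≤ (2 * N + N ^ 2) * σ := by
        have : σ ^ 2 * N ≤ σ * N := by
          gcongr
          nlinarith
        linarith

/-- The basic energy inequality. The layer forcing costs `σ³` times a gradient, because the traces
at `0` vanish; for `P` that gradient is not controlled by the dissipation. -/
theorem ErrorSlice.energy (hL : 0 < L) (ha : 0 < a) (hb : 0 < b) (hσ : 0 < σ) {τ δ : ℝ}
    (hτ : 0 < τ) (hδ : 0 < δ) (hρ : LayerProfile σ N ρ ρx)
    (h : ErrorSlice a b σ N ρ k η U Ut Ux Uxx P S Px Pxx) :
    2 * (b * inner ℝ Ut U + inner ℝ S P) + 2 * σ ^ 2 * b * ‖Ux‖ ^ 2 ≤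
      (4 * b * N ^ 2 / τ + b * N ^ 4 / 2 + (b / a) ^ 2 * N ^ 4 / δ) * σ ^ 4 +
        τ * (b * ‖U‖ ^ 2) + δ * σ ^ 2 * ‖Px‖ ^ 2 := by
  have hN : 0 ≤ N := (abs_nonneg _).trans h.abs_η
  have i1 : 2 * inner ℝ U Ux = 0 := by
    rw [inner_self_deriv_eq hL h.dU, h.traceU_zero, h.traceU_L]; ring
  have i2 : inner ℝ Ux P + inner ℝ U Px = 0 := by
    rw [inner_add_inner_eq hL h.dU h.dP, h.traceU_zero, h.traceU_L]; ring
  have i3 : inner ℝ Ux Ux + inner ℝ U Uxx = 0 := by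
    rw [inner_add_inner_eq hL h.dU h.dUx, h.traceU_zero, h.traceU_L]; ring
  have i4 : 0 ≤ 2 * inner ℝ P Px := by
    rw [inner_self_deriv_eq hL h.dP, h.traceP_zero]; nlinarith [sq_nonneg (pointValue P L)]
  rw [real_inner_self_eq_norm_sq] at i3
  have e1 : inner ℝ Ut U = 2 * σ ^ 2 * inner ℝ k U + η * inner ℝ ρ U - a * inner ℝ U Ux
      - inner ℝ U Px + 2 * σ ^ 2 * inner ℝ U Uxx := by
    rw [h.Ut_eq]
    simp only [inner_add_left, inner_sub_left, real_inner_smul_left]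
    rw [real_inner_comm Ux U, real_inner_comm Px U, real_inner_comm Uxx U]
  have e2 : inner ℝ S P = -(b / a) * η * inner ℝ ρ P - a * inner ℝ P Px - b * inner ℝ Ux P := by
    rw [h.S_eq]
    simp only [inner_sub_left, real_inner_smul_left]
    rw [real_inner_comm Px P]
  have j1 : inner ℝ k U ≤ N * ‖U‖ := (real_inner_le_norm _ _).trans (by gcongr; exact h.norm_k)
  have j2 : η * inner ℝ ρ U ≤ N * (N * σ ^ 3 * ‖Ux‖) := by
    refine (le_abs_self _).trans ?_
    rw [abs_mul]
    exact mul_le_mul h.abs_η (hρ.inner_le _ _ h.dU h.traceU_zero) (abs_nonneg _) hN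
  have j3 : -(b / a) * η * inner ℝ ρ P ≤ (b / a) * (N * (N * σ ^ 3 * ‖Px‖)) := by
    have : |η * inner ℝ ρ P| ≤ N * (N * σ ^ 3 * ‖Px‖) := by
      rw [abs_mul]
      exact mul_le_mul h.abs_η (hρ.inner_le _ _ h.dP h.traceP_zero) (abs_nonneg _) hN
    have h1 := (neg_abs_le _).trans' (neg_le_neg this)
    have hba : 0 < b / a := by positivity
    nlinarith
  have y1 : 4 * b * σ ^ 2 * (N * ‖U‖) ≤ τ * (b * ‖U‖ ^ 2) + 4 * b * N ^ 2 / τ * σ ^ 4 := by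
    have : 0 ≤ b / τ * (τ * ‖U‖ - 2 * N * σ ^ 2) ^ 2 := by positivity
    have e : b / τ * (τ * ‖U‖ - 2 * N * σ ^ 2) ^ 2 =
      τ * (b * ‖U‖ ^ 2) + 4 * b * N ^ 2 / τ * σ ^ 4 - 4 * b * σ ^ 2 * (N * ‖U‖) := by
      field_simp; ring
    linarith
  have y2 : 2 * b * (N * (N * σ ^ 3 * ‖Ux‖)) ≤
      2 * σ ^ 2 * b * ‖Ux‖ ^ 2 + b * N ^ 4 / 2 * σ ^ 4 := by
    have : 0 ≤ b / 2 * (2 * σ * ‖Ux‖ - N ^ 2 * σ ^ 2) ^ 2 := by positivity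
    linarith
  have y3 : 2 * ((b / a) * (N * (N * σ ^ 3 * ‖Px‖))) ≤
      δ * σ ^ 2 * ‖Px‖ ^ 2 + (b / a) ^ 2 * N ^ 4 / δ * σ ^ 4 := by
    have : 0 ≤ 1 / δ * (δ * σ * ‖Px‖ - (b / a) * N ^ 2 * σ ^ 2) ^ 2 := by positivity
    have e : 1 / δ * (δ * σ * ‖Px‖ - (b / a) * N ^ 2 * σ ^ 2) ^ 2 =
      δ * σ ^ 2 * ‖Px‖ ^ 2 + (b / a) ^ 2 * N ^ 4 / δ * σ ^ 4 -
        2 * ((b / a) * (N * (N * σ ^ 3 * ‖Px‖))) := by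
      field_simp; ring
    linarith
  have z1 : b * σ ^ 2 * inner ℝ k U ≤ b * σ ^ 2 * (N * ‖U‖) := by gcongr
  have z2 : b * (η * inner ℝ ρ U) ≤ b * (N * (N * σ ^ 3 * ‖Ux‖)) := by gcongr
  have z4 : 0 ≤ a * (2 * inner ℝ P Px) := by positivity
  have i1' : inner ℝ U Ux = 0 := by linarith
  have i2' : inner ℝ U Px = -inner ℝ Ux P := by linarith
  have i3' : inner ℝ U Uxx = -‖Ux‖ ^ 2 := by linarith
  rw [e1, e2, i1', i2', i3']
  linarith

/-- Testing the first equation with `U_t`. -/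
theorem ErrorSlice.time_derivative (hσ : 0 < σ) (hσ1 : σ ≤ 1) (hρ : LayerProfile σ N ρ ρx)
    (h : ErrorSlice a b σ N ρ k η U Ut Ux Uxx P S Px Pxx) :
    ‖Ut‖ ^ 2 - 4 * σ ^ 2 * inner ℝ Uxx Ut ≤
      3 * a ^ 2 * ‖Ux‖ ^ 2 + 3 * ‖Px‖ ^ 2 + 3 * (2 * N + N ^ 2) ^ 2 * σ ^ 2 := by
  set F := (2 * σ ^ 2) • k + η • ρ with hF
  have hFn := h.norm_forcing_le hρ hσ hσ1
  set R := F - a • Ux - Px with hR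
  have e : Ut - (2 * σ ^ 2) • Uxx = R := by rw [h.Ut_eq]; simp only [hR, hF]; abel
  have e1 : ‖Ut‖ ^ 2 - 2 * σ ^ 2 * inner ℝ Uxx Ut = inner ℝ R Ut := by
    rw [← e, inner_sub_left, real_inner_smul_left, real_inner_self_eq_norm_sq]
  have e2 : inner ℝ R Ut ≤ ‖R‖ * ‖Ut‖ := real_inner_le_norm _ _
  have e3 : ‖R‖ ≤ ‖F‖ + |a| * ‖Ux‖ + ‖Px‖ := by
    refine (norm_sub_le _ _).trans (add_le_add_left ((norm_sub_le _ _).trans ?_) _)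
    rw [norm_smul, Real.norm_eq_abs]
  have e4 : ‖R‖ ^ 2 ≤ 3 * (‖F‖ ^ 2 + a ^ 2 * ‖Ux‖ ^ 2 + ‖Px‖ ^ 2) := by
    have := pow_le_pow_left₀ (norm_nonneg _) e3 2
    rw [← sq_abs a]
    nlinarith [sq_nonneg (‖F‖ - |a| * ‖Ux‖), sq_nonneg (‖F‖ - ‖Px‖),
      sq_nonneg (|a| * ‖Ux‖ - ‖Px‖)]
  have e5 : ‖F‖ ^ 2 ≤ (2 * N + N ^ 2) ^ 2 * σ ^ 2 := by
    rw [← mul_pow]; exact pow_le_pow_left₀ (norm_nonneg _) hFn 2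
  nlinarith [sq_nonneg (‖R‖ - ‖Ut‖)]

/-- The inflow value of `P_x`: by the second equation it is bounded by the trace of `U_x`, hence
by `‖U_x‖ ‖ε U_xx‖`, and the first equation expresses `ε U_xx` by first-order terms. -/
theorem ErrorSlice.inflow (hL : 0 < L) (ha : 0 < a) (hb : 0 < b) (hσ : 0 < σ) (hσ1 : σ ≤ 1)
    (hρ : LayerProfile σ N ρ ρx)
    (h : ErrorSlice a b σ N ρ k η U Ut Ux Uxx P S Px Pxx) (hS : pointValue S 0 = 0) :
    (2 * σ ^ 2 / b) * (-(a * inner ℝ Px Pxx)) ≤ 2 * b / a ^ 3 * N ^ 4 * σ ^ 2 +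
      2 * b / a * (‖Ux‖ ^ 2 / L + ‖Ux‖ * (‖Ut‖ + a * ‖Ux‖ + ‖Px‖ + (2 * N + N ^ 2) * σ)) := by
  have hN : 0 ≤ N := (abs_nonneg _).trans h.abs_η
  have hFn := h.norm_forcing_le hρ hσ hσ1
  set F := (2 * σ ^ 2) • k + η • ρ with hF
  set f := 2 * N + N ^ 2 with hf
  have hba : 0 < b / a := by positivity
  have i2 : 2 * inner ℝ Px Pxx = pointValue Px L ^ 2 - pointValue Px 0 ^ 2 :=
    inner_self_deriv_eq hL h.dPx
  have htr : a * pointValue Px 0 = -(b / a) * η * pointValue ρ 0 - b * pointValue Ux 0 := by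
    have h0 : (0 : ℝ) ∈ Icc 0 L := left_mem_Icc.2 hL.le
    have e := hS
    rw [h.S_eq, pointValue_sub hL ((hρ.weakDeriv.smul _).sub (h.dPx.smul _)) (h.dUx.smul _) h0,
      pointValue_sub hL (hρ.weakDeriv.smul _) (h.dPx.smul _) h0,
      pointValue_smul hL hρ.weakDeriv _ h0, pointValue_smul hL h.dPx _ h0,
      pointValue_smul hL h.dUx _ h0] at e
    linarith
  have hηρ : (η * pointValue ρ 0) ^ 2 ≤ N ^ 4 := by
    have : |η * pointValue ρ 0| ≤ N * N := by
      rw [abs_mul]; exact mul_le_mul h.abs_η hρ.trace_le (abs_nonneg _) hN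
    calc (η * pointValue ρ 0) ^ 2 = |η * pointValue ρ 0| ^ 2 := (sq_abs _).symm
      _ ≤ (N * N) ^ 2 := by gcongr
      _ = N ^ 4 := by ring
  have t1 : a ^ 2 * pointValue Px 0 ^ 2 ≤
      2 * ((b / a) ^ 2 * N ^ 4) + 2 * (b ^ 2 * pointValue Ux 0 ^ 2) := by
    have : (b / a) ^ 2 * (η * pointValue ρ 0) ^ 2 ≤ (b / a) ^ 2 * N ^ 4 := by gcongr
    have e : a ^ 2 * pointValue Px 0 ^ 2 =
        (-(b / a) * η * pointValue ρ 0 - b * pointValue Ux 0) ^ 2 := by rw [← htr]; ring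
    rw [e]
    nlinarith [sq_nonneg ((b / a) * η * pointValue ρ 0 - b * pointValue Ux 0)]
  have t2 : σ ^ 2 * pointValue Ux 0 ^ 2 ≤
      ‖Ux‖ ^ 2 / L + ‖Ux‖ * (‖Ut‖ + a * ‖Ux‖ + ‖Px‖ + f * σ) := by
    have h1 := pointValue_sq_le hL h.dUx (left_mem_Icc.2 hL.le)
    have h2 : (2 * σ ^ 2) * ‖Uxx‖ ≤ ‖Ut‖ + a * ‖Ux‖ + ‖Px‖ + f * σ := by
      have e : (2 * σ ^ 2) • Uxx = Ut + a • Ux + Px - F := by rw [h.Ut_eq]; simp only [hF]; abel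
      have : (2 * σ ^ 2) * ‖Uxx‖ = ‖(2 * σ ^ 2) • Uxx‖ := by
        rw [norm_smul, Real.norm_of_nonneg (by positivity)]
      rw [this, e]
      refine (norm_sub_le _ _).trans (add_le_add ((norm_add_le _ _).trans (add_le_add_left
        ((norm_add_le _ _).trans_eq ?_) _)) hFn)
      rw [norm_smul, Real.norm_of_nonneg ha.le]
    have h3 : σ ^ 2 * (‖Ux‖ ^ 2 / L) ≤ 1 * (‖Ux‖ ^ 2 / L) := by
      gcongr; exact pow_le_one₀ hσ.le hσ1
    calc σ ^ 2 * pointValue Ux 0 ^ 2 ≤ σ ^ 2 * (‖Ux‖ ^ 2 / L + 2 * ‖Ux‖ * ‖Uxx‖) := by gcongr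
      _ = σ ^ 2 * (‖Ux‖ ^ 2 / L) + ‖Ux‖ * ((2 * σ ^ 2) * ‖Uxx‖) := by ring
      _ ≤ _ := by
        refine add_le_add (by linarith) ?_
        gcongr
  have h1 : -(2 * inner ℝ Px Pxx) ≤ pointValue Px 0 ^ 2 := by
    rw [i2]; linarith [sq_nonneg (pointValue Px L)]
  calc (2 * σ ^ 2 / b) * (-(a * inner ℝ Px Pxx))
        = (σ ^ 2 * a / b) * (-(2 * inner ℝ Px Pxx)) := by ring
      _ ≤ (σ ^ 2 * a / b) * pointValue Px 0 ^ 2 := by gcongr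
      _ = σ ^ 2 / (a * b) * (a ^ 2 * pointValue Px 0 ^ 2) := by field_simp
      _ ≤ σ ^ 2 / (a * b) * (2 * ((b / a) ^ 2 * N ^ 4) + 2 * (b ^ 2 * pointValue Ux 0 ^ 2)) := by
        gcongr
      _ = 2 * b / a ^ 3 * N ^ 4 * σ ^ 2 + 2 * b / a * (σ ^ 2 * pointValue Ux 0 ^ 2) := by
        field_simp
      _ ≤ _ := by gcongr

/-- Testing the first equation with `P_x`, before estimating: the term `2 ε u_xx` turns, by the
second equation, into a damping of `P_x` transported with speed `a`. -/
theorem ErrorSlice.gradient_identity (hL : 0 < L) (hb : 0 < b)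
    (hρ : LayerProfile σ N ρ ρx)
    (h : ErrorSlice a b σ N ρ k η U Ut Ux Uxx P S Px Pxx) :
    ‖Px‖ ^ 2 + (inner ℝ Ut Px + inner ℝ U ((-(b / a) * η) • ρx - a • Pxx - b • Uxx) +
        (2 * σ ^ 2 / b) * inner ℝ Px ((-(b / a) * η) • ρx - a • Pxx - b • Uxx)) =
      inner ℝ ((2 * σ ^ 2) • k + η • ρ) Px + (b / a) * (η * inner ℝ Ux ρ) + b * ‖Ux‖ ^ 2 +
        (2 * σ ^ 2 / b) * (-(b / a) * η * inner ℝ Px ρx) +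
        (2 * σ ^ 2 / b) * (-(a * inner ℝ Px Pxx)) := by
  have hdS := h.dS hρ
  set Sx := (-(b / a) * η) • ρx - a • Pxx - b • Uxx with hSx
  set F := (2 * σ ^ 2) • k + η • ρ with hF
  have i1 : inner ℝ Ux S + inner ℝ U Sx = 0 := by
    rw [inner_add_inner_eq hL h.dU hdS, h.traceU_zero, h.traceU_L]; ring
  have e1 : inner ℝ Ut Px = inner ℝ F Px - a * inner ℝ Ux Px - ‖Px‖ ^ 2 +
      2 * σ ^ 2 * inner ℝ Uxx Px := by
    rw [h.Ut_eq]
    simp only [inner_add_left, inner_sub_left, real_inner_smul_left, real_inner_self_eq_norm_sq, hF]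
  have e2 : inner ℝ Ux S = -(b / a) * η * inner ℝ Ux ρ - a * inner ℝ Ux Px - b * ‖Ux‖ ^ 2 := by
    rw [h.S_eq]
    simp only [inner_sub_right, real_inner_smul_right, real_inner_self_eq_norm_sq]
  have e3 : inner ℝ Px Sx = -(b / a) * η * inner ℝ Px ρx - a * inner ℝ Px Pxx -
      b * inner ℝ Uxx Px := by
    simp only [hSx, inner_sub_right, real_inner_smul_right]
    rw [real_inner_comm Px Uxx]
  have e6 : 2 * σ ^ 2 / b * (b * inner ℝ Uxx Px) = 2 * σ ^ 2 * inner ℝ Uxx Px := by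
    field_simp
  have e7 : inner ℝ U Sx = (b / a) * (η * inner ℝ Ux ρ) + a * inner ℝ Ux Px + b * ‖Ux‖ ^ 2 := by
    linarith only [i1, e2]
  rw [e1, e3, e7]
  linear_combination (-1 : ℝ) * e6

/-- The gradient estimate for `P` at a fixed time. -/
theorem ErrorSlice.gradient (hL : 0 < L) (ha : 0 < a) (hb : 0 < b) (hσ : 0 < σ) (hσ1 : σ ≤ 1)
    {μ : ℝ} (hμ : 0 < μ) (hρ : LayerProfile σ N ρ ρx)
    (h : ErrorSlice a b σ N ρ k η U Ut Ux Uxx P S Px Pxx) (hS : pointValue S 0 = 0) :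
    ‖Px‖ ^ 2 + (inner ℝ Ut Px + inner ℝ U ((-(b / a) * η) • ρx - a • Pxx - b • Uxx) +
        (2 * σ ^ 2 / b) * inner ℝ Px ((-(b / a) * η) • ρx - a • Pxx - b • Uxx)) ≤
      ((2 * N + N ^ 2 + 2 * N ^ 2 / a) ^ 2 / (2 * μ) + 1 + 2 * b / a ^ 3 * N ^ 4) * σ ^ 2 +
      (b + (b / a * N ^ 2) ^ 2 + 2 * b / a / L + 2 * b + (2 * b / a) ^ 2 / μ +
        (2 * b / a * (2 * N + N ^ 2)) ^ 2) * ‖Ux‖ ^ 2 + μ * (‖Ut‖ ^ 2 + ‖Px‖ ^ 2) := by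
  have hN : 0 ≤ N := (abs_nonneg _).trans h.abs_η
  have hFn := h.norm_forcing_le hρ hσ hσ1
  have hba : 0 < b / a := by positivity
  have t3 := h.inflow hL ha hb hσ hσ1 hρ hS
  rw [h.gradient_identity hL hb hρ]
  set F := (2 * σ ^ 2) • k + η • ρ with hF
  set f := 2 * N + N ^ 2 with hf
  have s1 : inner ℝ F Px ≤ f * σ * ‖Px‖ := (real_inner_le_norm _ _).trans (by gcongr)
  have s2 : (b / a) * (η * inner ℝ Ux ρ) ≤ (b / a) * N ^ 2 * (σ * ‖Ux‖) := by
    have : η * inner ℝ Ux ρ ≤ N * (‖Ux‖ * (N * σ)) := by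
      refine (le_abs_self _).trans ?_
      rw [abs_mul]
      refine mul_le_mul h.abs_η ((abs_real_inner_le_norm _ _).trans ?_) (abs_nonneg _) hN
      gcongr
      exact hρ.norm_le
    calc (b / a) * (η * inner ℝ Ux ρ) ≤ (b / a) * (N * (‖Ux‖ * (N * σ))) := by gcongr
      _ = _ := by ring
  have s3 : (2 * σ ^ 2 / b) * (-(b / a) * η * inner ℝ Px ρx) ≤ 2 * N ^ 2 / a * (σ * ‖Px‖) := by
    have : -(η * inner ℝ Px ρx) ≤ N * (‖Px‖ * ‖ρx‖) := by
      refine (neg_le_abs _).trans ?_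
      rw [abs_mul]
      exact mul_le_mul h.abs_η (abs_real_inner_le_norm _ _) (abs_nonneg _) hN
    calc (2 * σ ^ 2 / b) * (-(b / a) * η * inner ℝ Px ρx)
        = (2 * σ ^ 2 / a) * (-(η * inner ℝ Px ρx)) := by field_simp
      _ ≤ (2 * σ ^ 2 / a) * (N * (‖Px‖ * ‖ρx‖)) := by gcongr
      _ = 2 * N / a * (σ * ‖Px‖) * (σ * ‖ρx‖) := by ring
      _ ≤ 2 * N / a * (σ * ‖Px‖) * N := by gcongr; exact hρ.norm_deriv_le
      _ = _ := by ring
  have y1 := mul_le_young hμ (f + 2 * N ^ 2 / a) σ ‖Px‖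
  have y2 := mul_le_young one_pos (b / a * N ^ 2) ‖Ux‖ σ
  have y3 := mul_le_young hμ (2 * b / a) ‖Ux‖ ‖Ut‖
  have y4 := mul_le_young hμ (2 * b / a) ‖Ux‖ ‖Px‖
  have y5 := mul_le_young one_pos (2 * b / a * f) ‖Ux‖ σ
  have e5 : 2 * b / a * (‖Ux‖ ^ 2 / L + ‖Ux‖ * (‖Ut‖ + a * ‖Ux‖ + ‖Px‖ + f * σ)) =
      2 * b / a / L * ‖Ux‖ ^ 2 + 2 * b / a * (‖Ux‖ * ‖Ut‖) + 2 * b * ‖Ux‖ ^ 2 +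
        2 * b / a * (‖Ux‖ * ‖Px‖) + 2 * b / a * f * (‖Ux‖ * σ) := by
    field_simp
    ring
  rw [e5] at t3
  have e6 : (2 * b / a) ^ 2 / (2 * μ) * ‖Ux‖ ^ 2 = (2 * b / a) ^ 2 / μ * ‖Ux‖ ^ 2 / 2 := by
    field_simp
  rw [e6] at y3 y4
  have p1 := sq_nonneg (b / a * N ^ 2 * ‖Ux‖)
  have p2 := sq_nonneg (2 * b / a * f * ‖Ux‖)
  have p3 : 0 ≤ μ * ‖Ut‖ ^ 2 := by positivity
  generalize (2 * b / a) ^ 2 / μ = c1 at *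
  generalize 2 * b / a / L = c2 at *
  generalize 2 * b / a ^ 3 * N ^ 4 = c3 at *
  generalize 2 * N ^ 2 / a = c4 at *
  generalize b / a * N ^ 2 = c5 at *
  generalize 2 * b / a * f = c6 at *
  generalize (f + c4) ^ 2 / (2 * μ) = c7 at *
  linarith only [t3, s1, s2, s3, y1, y2, y3, y4, y5, p1, p2, p3]

end Slices

/-! ### Energy estimates in time -/

section Evolution

variable {L T : ℝ}

theorem integrableOn_inner_of_top {p q : ℝ → L2 L} (hp : MemLinfL2 T p) (hq : MemLinfL2 T q) :
    IntegrableOn (fun t => (inner ℝ (p t) (q t) : ℝ)) (Ioo 0 T) := by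
  obtain ⟨M, hM0, hM⟩ := exists_bound_of_memLp_top hp
  obtain ⟨M', hM0', hM'⟩ := exists_bound_of_memLp_top hq
  refine Integrable.mono' (integrable_const (M * M')) (hp.1.inner hq.1) ?_
  filter_upwards [hM, hM'] with t h1 h2
  exact (norm_inner_le_norm _ _).trans (mul_le_mul h1 h2 (norm_nonneg _) hM0)

theorem integrableOn_norm_sq_of_top {p : ℝ → L2 L} (hp : MemLinfL2 T p) :
    IntegrableOn (fun t => ‖p t‖ ^ 2) (Ioo 0 T) := by
  simpa only [real_inner_self_eq_norm_sq] using integrableOn_inner_of_top hp hp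

theorem memLinfL2_of_continuousOn {p : ℝ → L2 L} (hp : ContinuousOn p (Icc 0 T)) :
    MemLinfL2 T p := by
  obtain ⟨M, hM⟩ := isCompact_Icc.exists_bound_of_continuousOn hp
  refine MemLp.of_bound ((hp.mono Ioo_subset_Icc_self).aestronglyMeasurable measurableSet_Ioo) M ?_
  filter_upwards [ae_restrict_mem measurableSet_Ioo] with t ht
  exact hM t (Ioo_subset_Icc_self ht)

theorem norm_sq_primitive_eq (hT : 0 ≤ T) {p : ℝ → L2 L} (hp : MemLinfL2 T p) {t : ℝ}
    (ht : t ∈ Icc 0 T) : ‖∫ s in (0 : ℝ)..t, p s‖ ^ 2 =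
      ∫ s in (0 : ℝ)..t, 2 * inner ℝ (p s) (∫ r in (0 : ℝ)..s, p r) := by
  rw [← real_inner_self_eq_norm_sq, inner_primitive_eq hT hp hp ht]
  refine intervalIntegral.integral_congr fun s _ => ?_
  rw [real_inner_comm (p s)]
  ring

/-- The evolution of the error of the corrected approximation: `(U, P)` starts from zero, solves
the equations of `ErrorSlice` at almost every time, and all derivatives that occur are bounded
(with bounds that may depend on `σ`). -/
structure ErrorSystem (T a b σ N : ℝ) (ρ ρx : L2 L) (k : ℝ → L2 L) (η : ℝ → ℝ)
    (U Ut Ux Uxx P S Px Pxx : ℝ → L2 L) : Prop where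
  layer : LayerProfile σ N ρ ρx
  slice : ∀ᵐ t ∂(intervalMeasure T), ErrorSlice a b σ N ρ (k t) (η t) (U t) (Ut t) (Ux t) (Uxx t)
    (P t) (S t) (Px t) (Pxx t)
  memUt : MemLinfL2 T Ut
  memUx : MemLinfL2 T Ux
  memUxx : MemLinfL2 T Uxx
  memS : MemLinfL2 T S
  memPx : MemLinfL2 T Px
  memPxx : MemLinfL2 T Pxx
  memη : MemLp η ∞ (intervalMeasure T)
  U_eq : ∀ t ∈ Icc 0 T, U t = ∫ s in (0 : ℝ)..t, Ut s
  P_eq : ∀ t ∈ Icc 0 T, P t = ∫ s in (0 : ℝ)..t, S s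

namespace ErrorSystem

variable {a b σ N : ℝ} {ρ ρx : L2 L} {k : ℝ → L2 L} {η : ℝ → ℝ}
  {U Ut Ux Uxx P S Px Pxx : ℝ → L2 L}

theorem continuousOn_U (hT : 0 ≤ T)
    (h : ErrorSystem T a b σ N ρ ρx k η U Ut Ux Uxx P S Px Pxx) : ContinuousOn U (Icc 0 T) :=
  (continuousOn_primitive_Icc hT (h.memUt.integrable (by simp))).congr h.U_eq

theorem continuousOn_P (hT : 0 ≤ T)
    (h : ErrorSystem T a b σ N ρ ρx k η U Ut Ux Uxx P S Px Pxx) : ContinuousOn P (Icc 0 T) :=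
  (continuousOn_primitive_Icc hT (h.memS.integrable (by simp))).congr h.P_eq

theorem memSx (h : ErrorSystem T a b σ N ρ ρx k η U Ut Ux Uxx P S Px Pxx) :
    MemLinfL2 T (fun t => (-(b / a) * η t) • ρx - a • Pxx t - b • Uxx t) := by
  have h1 : MemLp (fun t => (-(b / a) * η t) • ρx) ∞ (intervalMeasure T) := by
    obtain ⟨M, hM⟩ : ∃ M, ∀ᵐ t ∂(intervalMeasure T), ‖η t‖ ≤ M :=
      (exists_bound_of_memLp_top h.memη).imp fun M hM => hM.2
    refine MemLp.of_bound ((h.memη.1.const_mul _).smul_const ρx) (|-(b / a)| * M * ‖ρx‖) ?_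
    filter_upwards [hM] with t ht
    rw [norm_smul, norm_mul, Real.norm_eq_abs (-(b / a))]
    gcongr
  exact (h1.sub (h.memPxx.const_smul a)).sub (h.memUxx.const_smul b)

theorem dS (h : ErrorSystem T a b σ N ρ ρx k η U Ut Ux Uxx P S Px Pxx) :
    HasWeakSpaceDeriv T S (fun t => (-(b / a) * η t) • ρx - a • Pxx t - b • Uxx t) := by
  filter_upwards [h.slice] with t ht
  exact ht.dS h.layer

/-- `P_x` is absolutely continuous in time: its time derivative is the space derivative of `S`. -/
theorem Px_eq (h : ErrorSystem T a b σ N ρ ρx k η U Ut Ux Uxx P S Px Pxx) :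
    ∀ᵐ t ∂(intervalMeasure T),
      Px t = ∫ s in (0 : ℝ)..t, ((-(b / a) * η s) • ρx - a • Pxx s - b • Uxx s) := by
  filter_upwards [h.slice, ae_restrict_mem measurableSet_Ioo] with t ht htT
  have h1 := HasWeakDeriv.intervalIntegral (h.memS.integrable (by simp))
    (h.memSx.integrable (by simp)) h.dS (Ioo_subset_Icc_self htT)
  rw [← h.P_eq t (Ioo_subset_Icc_self htT)] at h1
  exact ht.dP.unique h1

/-- The time derivative of `P` vanishes at the inflow boundary, because `P` does at all times. -/
theorem traceS_zero (hL : 0 < L) (hT : 0 ≤ T)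
    (h : ErrorSystem T a b σ N ρ ρx k η U Ut Ux Uxx P S Px Pxx) :
    ∀ᵐ t ∂(intervalMeasure T), pointValue (S t) 0 = 0 := by
  obtain ⟨e₀, e₁, he⟩ := exists_trace_functional hL
  set Sx : ℝ → L2 L := fun t => (-(b / a) * η t) • ρx - a • Pxx t - b • Uxx t with hSx
  have hSi : IntegrableOn S (Ioo 0 T) := h.memS.integrable (by simp)
  have hSxi : IntegrableOn Sx (Ioo 0 T) := h.memSx.integrable (by simp)
  have i0 : IntegrableOn (fun t => (inner ℝ e₀ (S t) : ℝ)) (Ioo 0 T) :=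
    (innerSL ℝ e₀).integrable_comp hSi
  have i1 : IntegrableOn (fun t => (inner ℝ e₁ (Sx t) : ℝ)) (Ioo 0 T) :=
    (innerSL ℝ e₁).integrable_comp hSxi
  have key : ∀ᵐ t ∂(intervalMeasure T), inner ℝ e₀ (S t) + inner ℝ e₁ (Sx t) = (0 : ℝ) := by
    refine ae_eq_zero_of_primitive_ae_eq_zero hT (i0.add i1) ?_
    filter_upwards [h.slice, h.Px_eq, ae_restrict_mem measurableSet_Ioo] with t ht hPx htT
    have hm := Ioo_subset_Icc_self htT
    have h0 : (0 : ℝ) ∈ Icc 0 T := left_mem_Icc.2 hT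
    have e := he _ _ ht.dP
    rw [ht.traceP_zero, hPx, h.P_eq t hm] at e
    rw [intervalIntegral.integral_add (intervalIntegrable_of_Ioo_of_mem i0 h0 hm)
      (intervalIntegrable_of_Ioo_of_mem i1 h0 hm)]
    have e2 := (innerSL ℝ e₀).intervalIntegral_comp_comm
      (intervalIntegrable_of_Ioo_of_mem hSi h0 hm)
    have e3 := (innerSL ℝ e₁).intervalIntegral_comp_comm
      (intervalIntegrable_of_Ioo_of_mem hSxi h0 hm)
    simp only [innerSL_apply_apply] at e2 e3
    rw [e2, e3, ← e]
  filter_upwards [key, h.dS] with t h1 h2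
  rw [he _ _ h2, h1]

theorem energy_integrated (hL : 0 < L) (hT : 0 ≤ T) (ha : 0 < a) (hb : 0 < b) (hσ : 0 < σ)
    {τ δ : ℝ} (hτ : 0 < τ) (hδ : 0 < δ)
    (h : ErrorSystem T a b σ N ρ ρx k η U Ut Ux Uxx P S Px Pxx) {t : ℝ} (ht : t ∈ Icc 0 T) :
    b * ‖U t‖ ^ 2 + ‖P t‖ ^ 2 + 2 * σ ^ 2 * b * ∫ s in (0 : ℝ)..t, ‖Ux s‖ ^ 2 ≤
      (4 * b * N ^ 2 / τ + b * N ^ 4 / 2 + (b / a) ^ 2 * N ^ 4 / δ) * σ ^ 4 * t +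
        τ * (b * ∫ s in (0 : ℝ)..t, ‖U s‖ ^ 2) + δ * σ ^ 2 * ∫ s in (0 : ℝ)..t, ‖Px s‖ ^ 2 := by
  have h0 : (0 : ℝ) ∈ Icc 0 T := left_mem_Icc.2 hT
  have mU := memLinfL2_of_continuousOn (h.continuousOn_U hT)
  have mP := memLinfL2_of_continuousOn (h.continuousOn_P hT)
  have iU := integrableOn_inner_of_top h.memUt mU
  have iP := integrableOn_inner_of_top h.memS mP
  have nUx := integrableOn_norm_sq_of_top h.memUx
  have nU := integrableOn_norm_sq_of_top mU
  have nPx := integrableOn_norm_sq_of_top h.memPx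
  set K := 4 * b * N ^ 2 / τ + b * N ^ 4 / 2 + (b / a) ^ 2 * N ^ 4 / δ with hK
  have II : ∀ {f : ℝ → ℝ}, IntegrableOn f (Ioo 0 T) → IntervalIntegrable f volume 0 t :=
    fun hf => intervalIntegrable_of_Ioo_of_mem hf h0 ht
  have eU : ‖U t‖ ^ 2 = ∫ s in (0 : ℝ)..t, 2 * inner ℝ (Ut s) (U s) := by
    rw [h.U_eq t ht, norm_sq_primitive_eq hT h.memUt ht]
    refine intervalIntegral.integral_congr fun s hs => ?_
    rw [uIcc_of_le ht.1] at hs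
    rw [h.U_eq s ⟨hs.1, hs.2.trans ht.2⟩]
  have eP : ‖P t‖ ^ 2 = ∫ s in (0 : ℝ)..t, 2 * inner ℝ (S s) (P s) := by
    rw [h.P_eq t ht, norm_sq_primitive_eq hT h.memS ht]
    refine intervalIntegral.integral_congr fun s hs => ?_
    rw [uIcc_of_le ht.1] at hs
    rw [h.P_eq s ⟨hs.1, hs.2.trans ht.2⟩]
  have key := integral_le_integral_of_ae_le
    (f := fun s => b * (2 * inner ℝ (Ut s) (U s)) + 2 * inner ℝ (S s) (P s) +
      2 * σ ^ 2 * b * ‖Ux s‖ ^ 2)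
    (g := fun s => K * σ ^ 4 + τ * b * ‖U s‖ ^ 2 + δ * σ ^ 2 * ‖Px s‖ ^ 2)
    ((((iU.const_mul 2).const_mul b).fun_add (iP.const_mul 2)).fun_add (nUx.const_mul _))
    (((integrable_const _).fun_add (nU.const_mul _)).fun_add (nPx.const_mul _)) (by
      filter_upwards [h.slice] with s hs
      have := hs.energy hL ha hb hσ hτ hδ h.layer
      rw [← hK] at this
      linarith) ht
  rw [intervalIntegral.integral_add (((II (iU.const_mul 2)).const_mul b).add (II (iP.const_mul 2)))
      (II (nUx.const_mul _)),
    intervalIntegral.integral_add ((II (iU.const_mul 2)).const_mul b) (II (iP.const_mul 2)),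
    intervalIntegral.integral_add (intervalIntegrable_const.add (II (nU.const_mul _)))
      (II (nPx.const_mul _)),
    intervalIntegral.integral_add intervalIntegrable_const (II (nU.const_mul _)),
    intervalIntegral.integral_const_mul b, ← eU, ← eP,
    intervalIntegral.integral_const_mul (2 * σ ^ 2 * b),
    intervalIntegral.integral_const_mul (τ * b),
    intervalIntegral.integral_const_mul (δ * σ ^ 2), intervalIntegral.integral_const,
    smul_eq_mul] at key
  linarith

/-- The energy inequality closed in `U`: the term `∫ ‖U‖²` is absorbed by the supremum in time. -/
theorem energy_closed (hL : 0 < L) (hT : 0 < T) (ha : 0 < a) (hb : 0 < b) (hσ : 0 < σ)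
    {δ : ℝ} (hδ : 0 < δ)
    (h : ErrorSystem T a b σ N ρ ρx k η U Ut Ux Uxx P S Px Pxx) {t : ℝ} (ht : t ∈ Icc 0 T) :
    b * ‖U t‖ ^ 2 + ‖P t‖ ^ 2 + 2 * σ ^ 2 * b * ∫ s in (0 : ℝ)..t, ‖Ux s‖ ^ 2 ≤
      2 * ((8 * b * N ^ 2 * T + b * N ^ 4 / 2 + (b / a) ^ 2 * N ^ 4 / δ) * T * σ ^ 4 +
        δ * σ ^ 2 * ∫ s in (0 : ℝ)..t, ‖Px s‖ ^ 2) := by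
  have h0 : (0 : ℝ) ∈ Icc 0 T := left_mem_Icc.2 hT.le
  have mU := memLinfL2_of_continuousOn (h.continuousOn_U hT.le)
  have nU := integrableOn_norm_sq_of_top mU
  have nUx := integrableOn_norm_sq_of_top h.memUx
  have nPx := integrableOn_norm_sq_of_top h.memPx
  have hc : ContinuousOn (fun s => b * ‖U s‖ ^ 2 + ‖P s‖ ^ 2) (Icc 0 t) :=
    ((continuousOn_const.mul ((h.continuousOn_U hT.le).norm.pow 2)).add
      ((h.continuousOn_P hT.le).norm.pow 2)).mono (Icc_subset_Icc_right ht.2)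
  obtain ⟨r, hr, hmax⟩ := isCompact_Icc.exists_isMaxOn (nonempty_Icc.2 ht.1) hc
  set m := b * ‖U r‖ ^ 2 + ‖P r‖ ^ 2 with hm
  have hle : ∀ s ∈ Icc 0 t, b * ‖U s‖ ^ 2 + ‖P s‖ ^ 2 ≤ m := fun s hs => hmax hs
  have hm0 : 0 ≤ m := by positivity
  set K := 8 * b * N ^ 2 * T + b * N ^ 4 / 2 + (b / a) ^ 2 * N ^ 4 / δ with hK
  have hK0 : 0 ≤ K := by positivity
  have step : ∀ s ∈ Icc 0 t, b * ‖U s‖ ^ 2 + ‖P s‖ ^ 2 +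
      2 * σ ^ 2 * b * ∫ s in (0 : ℝ)..s, ‖Ux s‖ ^ 2 ≤
      K * T * σ ^ 4 + δ * σ ^ 2 * (∫ s in (0 : ℝ)..t, ‖Px s‖ ^ 2) + m / 2 := by
    intro s hs
    have hsT : s ∈ Icc 0 T := ⟨hs.1, hs.2.trans ht.2⟩
    have e := h.energy_integrated hL hT.le ha hb hσ (τ := 1 / (2 * T)) (by positivity) hδ hsT
    have e1 : b * (∫ r in (0 : ℝ)..s, ‖U r‖ ^ 2) ≤ m * T := by
      rw [← intervalIntegral.integral_const_mul]
      calc ∫ r in (0 : ℝ)..s, b * ‖U r‖ ^ 2 ≤ ∫ r in (0 : ℝ)..s, m := by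
            refine intervalIntegral.integral_mono_on hs.1
              ((intervalIntegrable_of_Ioo_of_mem nU h0 hsT).const_mul b)
              intervalIntegrable_const fun x hx => ?_
            have := hle x ⟨hx.1, hx.2.trans hs.2⟩
            nlinarith [sq_nonneg ‖P x‖]
        _ = m * s := by simp [mul_comm]
        _ ≤ m * T := by gcongr; exact hsT.2
    have e2 : ∫ r in (0 : ℝ)..s, ‖Px r‖ ^ 2 ≤ ∫ r in (0 : ℝ)..t, ‖Px r‖ ^ 2 :=
      intervalIntegral.integral_mono_interval le_rfl hs.1 hs.2 (ae_of_all _ fun _ => sq_nonneg _)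
        (intervalIntegrable_of_Ioo_of_mem nPx h0 ht)
    have e3 : 4 * b * N ^ 2 / (1 / (2 * T)) = 8 * b * N ^ 2 * T := by field_simp; ring
    rw [e3, ← hK] at e
    have e4 : 1 / (2 * T) * (b * ∫ r in (0 : ℝ)..s, ‖U r‖ ^ 2) ≤ m / 2 := by
      calc 1 / (2 * T) * (b * ∫ r in (0 : ℝ)..s, ‖U r‖ ^ 2) ≤ 1 / (2 * T) * (m * T) := by gcongr
        _ = m / 2 := by field_simp
    have e5 : K * σ ^ 4 * s ≤ K * σ ^ 4 * T := by gcongr; exact hsT.2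
    have e6 : δ * σ ^ 2 * (∫ r in (0 : ℝ)..s, ‖Px r‖ ^ 2) ≤
        δ * σ ^ 2 * (∫ r in (0 : ℝ)..t, ‖Px r‖ ^ 2) := by gcongr
    linarith
  have s1 := step r hr
  have s2 := step t (right_mem_Icc.2 ht.1)
  have p : 0 ≤ 2 * σ ^ 2 * b * ∫ s in (0 : ℝ)..r, ‖Ux s‖ ^ 2 :=
    mul_nonneg (by positivity) (intervalIntegral.integral_nonneg hr.1 fun _ _ => sq_nonneg _)
  rw [← hm] at s1
  linarith

/-- The integrated estimate of the time derivative. -/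
theorem time_derivative_integrated (hL : 0 < L) (hT : 0 ≤ T) (hσ : 0 < σ) (hσ1 : σ ≤ 1)
    (h : ErrorSystem T a b σ N ρ ρx k η U Ut Ux Uxx P S Px Pxx) :
    ∀ᵐ t ∂(intervalMeasure T), 2 * σ ^ 2 * ‖Ux t‖ ^ 2 + ∫ s in (0 : ℝ)..t, ‖Ut s‖ ^ 2 ≤
      3 * a ^ 2 * (∫ s in (0 : ℝ)..t, ‖Ux s‖ ^ 2) + 3 * (∫ s in (0 : ℝ)..t, ‖Px s‖ ^ 2) +
        3 * (2 * N + N ^ 2) ^ 2 * σ ^ 2 * T := by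
  have hB := ae_le_neg_two_integral_inner (N := fun t => ‖Ux t‖ ^ 2) hT h.memUt h.memUxx
    (G := {t | t ∈ Icc 0 T ∧ ErrorSlice a b σ N ρ (k t) (η t) (U t) (Ut t) (Ux t) (Uxx t)
      (P t) (S t) (Px t) (Pxx t)})
    (by
      filter_upwards [h.slice, ae_restrict_mem measurableSet_Ioo] with t h1 h2
      exact ⟨Ioo_subset_Icc_self h2, h1⟩)
    (fun t _ => sq_nonneg _)
    (fun t ht => by
      have e := inner_add_inner_eq hL ht.2.dU ht.2.dUx
      rw [ht.2.traceU_zero, ht.2.traceU_L, real_inner_self_eq_norm_sq,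
        real_inner_comm] at e
      rw [← h.U_eq t ht.1]
      linarith)
    (fun s hs t ht => by
      rw [← h.U_eq t ht.1, ← h.U_eq s hs.1]
      have e1 := inner_add_inner_eq hL (ht.2.dU.sub hs.2.dU) ht.2.dUx
      have hL' : L ∈ Icc 0 L := right_mem_Icc.2 hL.le
      have h0' : (0 : ℝ) ∈ Icc 0 L := left_mem_Icc.2 hL.le
      rw [pointValue_sub hL ht.2.dU hs.2.dU h0', pointValue_sub hL ht.2.dU hs.2.dU hL',
        ht.2.traceU_zero, ht.2.traceU_L, hs.2.traceU_zero, hs.2.traceU_L,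
        real_inner_comm (Uxx t)] at e1
      have e2 : inner ℝ (Ux t - Ux s) (Ux t) = ‖Ux t‖ ^ 2 - inner ℝ (Ux s) (Ux t) := by
        rw [inner_sub_left, real_inner_self_eq_norm_sq]
      have e3 : ‖Ux t - Ux s‖ ^ 2 = ‖Ux t‖ ^ 2 - 2 * inner ℝ (Ux t) (Ux s) + ‖Ux s‖ ^ 2 :=
        norm_sub_sq_real _ _
      rw [real_inner_comm] at e3
      have e4 := sq_nonneg ‖Ux t - Ux s‖
      linarith)
  have h0 : (0 : ℝ) ∈ Icc 0 T := left_mem_Icc.2 hT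
  have nUt := integrableOn_norm_sq_of_top h.memUt
  have nUx := integrableOn_norm_sq_of_top h.memUx
  have nPx := integrableOn_norm_sq_of_top h.memPx
  have iUxx := integrableOn_inner_of_top h.memUxx h.memUt
  filter_upwards [hB, ae_restrict_mem measurableSet_Ioo] with t hBt htT
  have ht := Ioo_subset_Icc_self htT
  have II : ∀ {f : ℝ → ℝ}, IntegrableOn f (Ioo 0 T) → IntervalIntegrable f volume 0 t :=
    fun hf => intervalIntegrable_of_Ioo_of_mem hf h0 ht
  have key := integral_le_integral_of_ae_le
    (f := fun s => ‖Ut s‖ ^ 2 - 4 * σ ^ 2 * inner ℝ (Uxx s) (Ut s))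
    (g := fun s => 3 * a ^ 2 * ‖Ux s‖ ^ 2 + 3 * ‖Px s‖ ^ 2 + 3 * (2 * N + N ^ 2) ^ 2 * σ ^ 2)
    (nUt.sub (iUxx.const_mul _))
    (((nUx.const_mul _).fun_add (nPx.const_mul _)).fun_add (integrable_const _)) (by
      filter_upwards [h.slice] with s hs
      exact hs.time_derivative hσ hσ1 h.layer) ht
  rw [intervalIntegral.integral_sub (II nUt) (II (iUxx.const_mul _)),
    intervalIntegral.integral_add ((II (nUx.const_mul _)).add (II (nPx.const_mul _)))
      intervalIntegrable_const,
    intervalIntegral.integral_add (II (nUx.const_mul _)) (II (nPx.const_mul _)),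
    intervalIntegral.integral_const_mul, intervalIntegral.integral_const_mul,
    intervalIntegral.integral_const_mul, intervalIntegral.integral_const, smul_eq_mul,
    sub_zero] at key
  have c1 : t * (3 * (2 * N + N ^ 2) ^ 2 * σ ^ 2) ≤ T * (3 * (2 * N + N ^ 2) ^ 2 * σ ^ 2) := by
    gcongr; exact ht.2
  have c2 : 2 * σ ^ 2 * ‖Ux t‖ ^ 2 ≤
      2 * σ ^ 2 * (-2 * ∫ s in (0 : ℝ)..t, inner ℝ (Uxx s) (Ut s)) := by gcongr
  linarith

/-- The integrated estimate of `P_x`. -/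
theorem gradient_integrated (hL : 0 < L) (hT : 0 ≤ T) (ha : 0 < a) (hb : 0 < b) (hσ : 0 < σ)
    (hσ1 : σ ≤ 1) {μ : ℝ} (hμ : 0 < μ)
    (h : ErrorSystem T a b σ N ρ ρx k η U Ut Ux Uxx P S Px Pxx) :
    ∀ᵐ t ∂(intervalMeasure T),
      (∫ s in (0 : ℝ)..t, ‖Px s‖ ^ 2) + inner ℝ (U t) (Px t) + σ ^ 2 / b * ‖Px t‖ ^ 2 ≤
      ((2 * N + N ^ 2 + 2 * N ^ 2 / a) ^ 2 / (2 * μ) + 1 + 2 * b / a ^ 3 * N ^ 4) * T * σ ^ 2 +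
      (b + (b / a * N ^ 2) ^ 2 + 2 * b / a / L + 2 * b + (2 * b / a) ^ 2 / μ +
        (2 * b / a * (2 * N + N ^ 2)) ^ 2) * (∫ s in (0 : ℝ)..t, ‖Ux s‖ ^ 2) +
      μ * ((∫ s in (0 : ℝ)..t, ‖Ut s‖ ^ 2) + ∫ s in (0 : ℝ)..t, ‖Px s‖ ^ 2) := by
  set K₀ := (2 * N + N ^ 2 + 2 * N ^ 2 / a) ^ 2 / (2 * μ) + 1 + 2 * b / a ^ 3 * N ^ 4 with hK₀
  set K₁ := b + (b / a * N ^ 2) ^ 2 + 2 * b / a / L + 2 * b + (2 * b / a) ^ 2 / μ +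
    (2 * b / a * (2 * N + N ^ 2)) ^ 2 with hK₁
  have hK₀0 : 0 ≤ K₀ := by positivity
  have h0 : (0 : ℝ) ∈ Icc 0 T := left_mem_Icc.2 hT
  set Sx : ℝ → L2 L := fun t => (-(b / a) * η t) • ρx - a • Pxx t - b • Uxx t with hSx
  have mSx : MemLinfL2 T Sx := h.memSx
  have mU := memLinfL2_of_continuousOn (h.continuousOn_U hT)
  have nUt := integrableOn_norm_sq_of_top h.memUt
  have nUx := integrableOn_norm_sq_of_top h.memUx
  have nPx := integrableOn_norm_sq_of_top h.memPx
  have i1 := integrableOn_inner_of_top h.memUt h.memPx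
  have i2 := integrableOn_inner_of_top mU mSx
  have i3 := integrableOn_inner_of_top h.memPx mSx
  have hPx : ∀ᵐ t ∂(intervalMeasure T), Px t = ∫ s in (0 : ℝ)..t, Sx s := h.Px_eq
  filter_upwards [hPx, ae_restrict_mem measurableSet_Ioo] with t hPxt htT
  have ht := Ioo_subset_Icc_self htT
  have II : ∀ {f : ℝ → ℝ}, IntegrableOn f (Ioo 0 T) → IntervalIntegrable f volume 0 t :=
    fun hf => intervalIntegrable_of_Ioo_of_mem hf h0 ht
  have hae : ∀ᵐ s : ℝ, s ∈ uIoc 0 t → Px s = ∫ r in (0 : ℝ)..s, Sx r := by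
    rw [ae_restrict_iff' measurableSet_Ioo] at hPx
    filter_upwards [hPx] with s hs hst
    rw [uIoc_of_le ht.1] at hst
    exact hs ⟨hst.1, hst.2.trans_lt htT.2⟩
  have e1 : inner ℝ (U t) (Px t) =
      ∫ s in (0 : ℝ)..t, (inner ℝ (Ut s) (Px s) + inner ℝ (U s) (Sx s)) := by
    rw [hPxt, h.U_eq t ht, inner_primitive_eq hT h.memUt mSx ht]
    refine intervalIntegral.integral_congr_ae ?_
    filter_upwards [hae] with s hs hst
    rw [hs hst]
    rw [uIoc_of_le ht.1] at hst
    rw [h.U_eq s ⟨hst.1.le, hst.2.trans ht.2⟩]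
  have e2 : ‖Px t‖ ^ 2 = ∫ s in (0 : ℝ)..t, 2 * inner ℝ (Px s) (Sx s) := by
    rw [hPxt, norm_sq_primitive_eq hT mSx ht]
    refine intervalIntegral.integral_congr_ae ?_
    filter_upwards [hae] with s hs hst
    rw [hs hst, real_inner_comm]
  have key := integral_le_integral_of_ae_le
    (f := fun s => ‖Px s‖ ^ 2 + (inner ℝ (Ut s) (Px s) + inner ℝ (U s) (Sx s)) +
      σ ^ 2 / b * (2 * inner ℝ (Px s) (Sx s)))
    (g := fun s => K₀ * σ ^ 2 + K₁ * ‖Ux s‖ ^ 2 + (μ * ‖Ut s‖ ^ 2 + μ * ‖Px s‖ ^ 2))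
    (Integrable.fun_add (Integrable.fun_add nPx (Integrable.fun_add i1 i2))
      ((i3.const_mul 2).const_mul _))
    (((integrable_const _).fun_add (nUx.const_mul _)).fun_add
      ((nUt.const_mul μ).fun_add (nPx.const_mul μ))) (by
      filter_upwards [h.slice, h.traceS_zero hL hT] with s hs hs0
      refine le_trans (le_of_eq ?_) ((hs.gradient hL ha hb hσ hσ1 hμ h.layer hs0).trans_eq ?_)
      · simp only [hSx]
        ring
      · ring) ht
  rw [intervalIntegral.integral_add ((II nPx).add ((II i1).add (II i2)))
      (((II i3).const_mul 2).const_mul _),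
    intervalIntegral.integral_add (II nPx) ((II i1).add (II i2)), ← e1,
    intervalIntegral.integral_const_mul (σ ^ 2 / b), ← e2,
    intervalIntegral.integral_add (intervalIntegrable_const.add (II (nUx.const_mul _)))
      ((II (nUt.const_mul μ)).add (II (nPx.const_mul μ))),
    intervalIntegral.integral_add intervalIntegrable_const (II (nUx.const_mul _)),
    intervalIntegral.integral_add (II (nUt.const_mul μ)) (II (nPx.const_mul μ)),
    intervalIntegral.integral_const_mul K₁, intervalIntegral.integral_const_mul μ,
    intervalIntegral.integral_const_mul μ, intervalIntegral.integral_const, smul_eq_mul,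
    sub_zero] at key
  have c1 : t * (K₀ * σ ^ 2) ≤ T * (K₀ * σ ^ 2) := by
    gcongr; exact ht.2
  linarith

end ErrorSystem

end Evolution

/-! ### Closing the estimates -/

/-- The algebra that combines the three energy inequalities. Here `u, v, q, p` stand for the norms
of `U, P, U_x, P_x` at a time and `X, Y, Z` for the integrals of `‖P_x‖²`, `‖U_x‖²`, `‖U_t‖²`. -/
theorem combine_energies {a b σ δ κ K K₀ K₁ F u v p q X Y Z : ℝ} (hb : 0 < b)
    (hσ : 0 < σ) (hκ : κ = (K₁ + 3 * a ^ 2 / 8) / b + 1) (hK₁ : 0 ≤ K₁)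
    (hδ : δ = 1 / (4 * κ)) (hX : 0 ≤ X)
    (h1 : b * u ^ 2 + v ^ 2 + 2 * σ ^ 2 * b * Y ≤ 2 * (K * σ ^ 4 + δ * σ ^ 2 * X))
    (h2 : X - u * p + σ ^ 2 / b * p ^ 2 ≤ K₀ * σ ^ 2 + K₁ * Y + 1 / 8 * (Z + X))
    (h3 : 2 * σ ^ 2 * q ^ 2 + Z ≤ 3 * a ^ 2 * Y + 3 * X + F * σ ^ 2) (hY : 0 ≤ Y) (hZ : 0 ≤ Z) :
    X ≤ 4 * (K₀ + F / 8 + κ * K) * σ ^ 2 ∧ p ^ 2 ≤ 2 * b * (K₀ + F / 8 + κ * K) ∧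
    b * Y ≤ (K + (K₀ + F / 8 + κ * K) / κ) * σ ^ 2 ∧
    b * u ^ 2 + v ^ 2 ≤ 2 * (K + (K₀ + F / 8 + κ * K) / κ) * σ ^ 4 ∧
    2 * q ^ 2 ≤ 3 * a ^ 2 * ((K + (K₀ + F / 8 + κ * K) / κ) / b) +
      12 * (K₀ + F / 8 + κ * K) + F := by
  have hκ1 : 1 ≤ κ := by
    rw [hκ]; have : 0 ≤ (K₁ + 3 * a ^ 2 / 8) / b := by positivity
    linarith
  have hκ0 : 0 < κ := by linarith
  have hσ2 : 0 < σ ^ 2 := by positivity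
  have hδ0 : 0 < δ := by rw [hδ]; positivity
  set W := K * σ ^ 2 + δ * X with hW
  set K₄ := K₀ + F / 8 + κ * K with hK₄
  have w1 : b * Y ≤ W := by
    have : 0 ≤ b * u ^ 2 + v ^ 2 := by positivity
    have : 2 * σ ^ 2 * (b * Y) ≤ 2 * σ ^ 2 * W := by rw [hW]; linarith
    exact le_of_mul_le_mul_left this (by positivity)
  have w2 : b * u ^ 2 ≤ 2 * σ ^ 2 * W := by
    have : 0 ≤ 2 * σ ^ 2 * b * Y := by positivity
    rw [hW]; nlinarith [sq_nonneg v]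
  have hup : u * p ≤ σ ^ 2 / (2 * b) * p ^ 2 + W := by
    have e1 : 0 ≤ 1 / (2 * b * σ ^ 2) * (σ ^ 2 * p - b * u) ^ 2 := by positivity
    have e2 : 1 / (2 * b * σ ^ 2) * (σ ^ 2 * p - b * u) ^ 2 =
        σ ^ 2 / (2 * b) * p ^ 2 + 1 / (2 * σ ^ 2) * (b * u ^ 2) - u * p := by field_simp; ring
    have e3 : 1 / (2 * σ ^ 2) * (b * u ^ 2) ≤ 1 / (2 * σ ^ 2) * (2 * σ ^ 2 * W) := by gcongr
    have e4 : 1 / (2 * σ ^ 2) * (2 * σ ^ 2 * W) = W := by field_simp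
    linarith
  have hYW : (K₁ + 3 * a ^ 2 / 8) * Y ≤ (κ - 1) * W := by
    have e1 : (K₁ + 3 * a ^ 2 / 8) * Y = (κ - 1) * (b * Y) := by rw [hκ]; field_simp; ring
    rw [e1]
    exact mul_le_mul_of_nonneg_left w1 (by linarith)
  have hδκ : κ * δ = 1 / 4 := by rw [hδ]; field_simp
  have hp2 : σ ^ 2 / b * p ^ 2 = 2 * (σ ^ 2 / (2 * b) * p ^ 2) := by field_simp
  have hκW : κ * W = κ * K * σ ^ 2 + X / 4 := by
    rw [hW, mul_add, ← mul_assoc κ δ X, hδκ]; ring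
  have hZq : 0 ≤ 2 * σ ^ 2 * q ^ 2 := by positivity
  have main : X / 4 + σ ^ 2 / (2 * b) * p ^ 2 ≤ K₄ * σ ^ 2 := by
    rw [hK₄]; linarith
  have hpp : 0 ≤ σ ^ 2 / (2 * b) * p ^ 2 := by positivity
  have hX4 : X ≤ 4 * K₄ * σ ^ 2 := by linarith
  have hW5 : W ≤ (K + K₄ / κ) * σ ^ 2 := by
    have e1 : δ * X ≤ δ * (4 * K₄ * σ ^ 2) := by gcongr
    have e2 : δ * (4 * K₄ * σ ^ 2) = K₄ / κ * σ ^ 2 := by rw [hδ]; field_simp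
    rw [hW]; linarith
  refine ⟨hX4, ?_, w1.trans hW5, ?_, ?_⟩
  · have e1 : σ ^ 2 * p ^ 2 ≤ σ ^ 2 * (2 * b * K₄) := by
      have : σ ^ 2 * p ^ 2 = 2 * b * (σ ^ 2 / (2 * b) * p ^ 2) := by field_simp
      rw [this]
      have : σ ^ 2 / (2 * b) * p ^ 2 ≤ K₄ * σ ^ 2 := by linarith
      calc 2 * b * (σ ^ 2 / (2 * b) * p ^ 2) ≤ 2 * b * (K₄ * σ ^ 2) := by gcongr
        _ = _ := by ring
    exact le_of_mul_le_mul_left e1 hσ2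
  · have e1 : 0 ≤ 2 * σ ^ 2 * b * Y := by positivity
    have e2 : 2 * σ ^ 2 * W ≤ 2 * σ ^ 2 * ((K + K₄ / κ) * σ ^ 2) := by gcongr
    rw [hW] at e2
    linarith
  · have e1 : Y ≤ (K + K₄ / κ) / b * σ ^ 2 := by
      rw [div_mul_eq_mul_div, le_div_iff₀ hb]
      linarith
    have e2 : 3 * a ^ 2 * Y ≤ 3 * a ^ 2 * ((K + K₄ / κ) / b * σ ^ 2) := by gcongr
    have e3 : σ ^ 2 * (2 * q ^ 2) ≤ σ ^ 2 *
        (3 * a ^ 2 * ((K + K₄ / κ) / b) + 12 * K₄ + F) := by linarith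
    exact le_of_mul_le_mul_left e3 hσ2

theorem le_of_ae_le_of_continuousOn {T : ℝ} (hT : 0 < T) {f : ℝ → ℝ} {c : ℝ}
    (hf : ContinuousOn f (Icc 0 T)) (h : ∀ᵐ t ∂(intervalMeasure T), f t ≤ c)
    {t : ℝ} (ht : t ∈ Icc 0 T) : f t ≤ c := by
  have h1 : EqOn (fun t => max (f t) c) (fun _ => c) (Ioo 0 T) := by
    refine Measure.eqOn_open_of_ae_eq (μ := volume) ?_ isOpen_Ioo
      ((hf.mono Ioo_subset_Icc_self).sup continuousOn_const) continuousOn_const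
    filter_upwards [h] with t ht
    exact max_eq_right ht
  have h2 := h1.of_subset_closure (t := Icc 0 T) (hf.sup continuousOn_const) continuousOn_const
    Ioo_subset_Icc_self (by rw [closure_Ioo hT.ne])
  exact max_eq_right_iff.1 (h2 ht)

theorem le_mul_of_sq_le {x C s : ℝ} (hC : 0 ≤ C) (hs : 0 ≤ s) (h : x ^ 2 ≤ C * s ^ 2) :
    x ≤ (1 + C) * s := by
  refine le_of_abs_le (abs_le_of_sq_le_sq (h.trans ?_) (by positivity))
  nlinarith [sq_nonneg s, sq_nonneg C, mul_nonneg hC (sq_nonneg s),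
    mul_nonneg (sq_nonneg C) (sq_nonneg s)]

/-- Estimates of the error, uniform in the width of the layer. -/
theorem ErrorSystem.exists_bound {L T a b N : ℝ} (hL : 0 < L) (hT : 0 < T) (ha : 0 < a)
    (hb : 0 < b) : ∃ C : ℝ, 0 ≤ C ∧ ∀ (σ : ℝ) (ρ ρx : L2 L) (k : ℝ → L2 L) (η : ℝ → ℝ)
      (U Ut Ux Uxx P S Px Pxx : ℝ → L2 L), 0 < σ → σ ≤ 1 →
      ErrorSystem T a b σ N ρ ρx k η U Ut Ux Uxx P S Px Pxx →
      (∀ᵐ t ∂(intervalMeasure T), ‖U t‖ ≤ C * σ ^ 2 ∧ ‖P t‖ ≤ C * σ ^ 2 ∧ ‖Ux t‖ ≤ C ∧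
        ‖Px t‖ ≤ C) ∧
      ∫ t in Ioo 0 T, ‖Ux t‖ ^ 2 ≤ C * σ ^ 2 ∧ ∫ t in Ioo 0 T, ‖Px t‖ ^ 2 ≤ C * σ ^ 2 := by
  set K₀ := ((2 * N + N ^ 2 + 2 * N ^ 2 / a) ^ 2 / (2 * (1 / 8)) + 1 + 2 * b / a ^ 3 * N ^ 4) * T
    with hK₀
  set K₁ := b + (b / a * N ^ 2) ^ 2 + 2 * b / a / L + 2 * b + (2 * b / a) ^ 2 / (1 / 8) +
    (2 * b / a * (2 * N + N ^ 2)) ^ 2 with hK₁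
  set F := 3 * (2 * N + N ^ 2) ^ 2 * T with hF
  set κ := (K₁ + 3 * a ^ 2 / 8) / b + 1 with hκ
  set δ := 1 / (4 * κ) with hδ
  have hK₀0 : 0 ≤ K₀ := by positivity
  have hK₁0 : 0 ≤ K₁ := by positivity
  have hF0 : 0 ≤ F := by positivity
  have hκ0 : 0 < κ := by positivity
  have hδ0 : 0 < δ := by positivity
  set K := (8 * b * N ^ 2 * T + b * N ^ 4 / 2 + (b / a) ^ 2 * N ^ 4 / δ) * T with hK
  have hK0 : 0 ≤ K := by positivity
  clear_value K₀ K₁ F κ δ K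
  set K₄ := K₀ + F / 8 + κ * K with hK₄
  set K₅ := K + K₄ / κ with hK₅
  set K₆ := 3 * a ^ 2 * (K₅ / b) + 12 * K₄ + F with hK₆
  have hK₄0 : 0 ≤ K₄ := by positivity
  have hK₅0 : 0 ≤ K₅ := by positivity
  have hK₆0 : 0 ≤ K₆ := by positivity
  refine ⟨(1 + 2 * K₅ / b) + (1 + 2 * K₅) + (1 + 2 * b * K₄) + (1 + K₆) + 4 * K₄ + K₅ / b,
    by positivity, ?_⟩
  intro σ ρ ρx k η U Ut Ux Uxx P S Px Pxx hσ hσ1 h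
  set C := (1 + 2 * K₅ / b) + (1 + 2 * K₅) + (1 + 2 * b * K₄) + (1 + K₆) + 4 * K₄ + K₅ / b with hC
  have q1 : 0 ≤ 2 * K₅ / b := by positivity
  have q2 : 0 ≤ 2 * b * K₄ := by positivity
  have q3 : 0 ≤ K₅ / b := by positivity
  have key : ∀ᵐ t ∂(intervalMeasure T), (‖U t‖ ≤ C * σ ^ 2 ∧ ‖P t‖ ≤ C * σ ^ 2 ∧ ‖Ux t‖ ≤ C ∧
        ‖Px t‖ ≤ C) ∧ ∫ s in (0 : ℝ)..t, ‖Ux s‖ ^ 2 ≤ C * σ ^ 2 ∧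
        ∫ s in (0 : ℝ)..t, ‖Px s‖ ^ 2 ≤ C * σ ^ 2 := by
    filter_upwards [h.gradient_integrated hL hT.le ha hb hσ hσ1 (μ := 1 / 8) (by norm_num),
      h.time_derivative_integrated hL hT.le hσ hσ1, ae_restrict_mem measurableSet_Ioo]
      with t h2 h3 htT
    have h1 := h.energy_closed hL hT ha hb hσ hδ0 (Ioo_subset_Icc_self htT)
    rw [← hK] at h1
    rw [← hK₀, ← hK₁] at h2
    have hup : -(‖U t‖ * ‖Px t‖) ≤ inner ℝ (U t) (Px t) :=
      (abs_le.1 (abs_real_inner_le_norm _ _)).1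
    obtain ⟨r1, r2, r3, r4, r5⟩ := combine_energies (K₀ := K₀) (F := F)
      (p := ‖Px t‖) (q := ‖Ux t‖) (Z := ∫ s in (0 : ℝ)..t, ‖Ut s‖ ^ 2) hb hσ hκ hK₁0 hδ
      (intervalIntegral.integral_nonneg htT.1.le fun _ _ => sq_nonneg _)
      h1 (by linarith) (h3.trans_eq (by rw [hF]; ring))
      (intervalIntegral.integral_nonneg htT.1.le fun _ _ => sq_nonneg _)
      (intervalIntegral.integral_nonneg htT.1.le fun _ _ => sq_nonneg _)
    rw [← hK₄] at r1 r2 r3 r4 r5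
    rw [← hK₅] at r3 r4 r5
    rw [← hK₆] at r5
    have hs2 : 0 ≤ σ ^ 2 := by positivity
    refine ⟨⟨?_, ?_, ?_, ?_⟩, ?_, ?_⟩
    · have e : ‖U t‖ ^ 2 ≤ 2 * K₅ / b * (σ ^ 2) ^ 2 := by
        rw [div_mul_eq_mul_div, le_div_iff₀ hb]
        linarith [sq_nonneg ‖P t‖]
      refine (le_mul_of_sq_le q1 hs2 e).trans ?_
      gcongr; linarith
    · have e : ‖P t‖ ^ 2 ≤ 2 * K₅ * (σ ^ 2) ^ 2 := by
        have : 0 ≤ b * ‖U t‖ ^ 2 := by positivity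
        linarith
      refine (le_mul_of_sq_le (by positivity) hs2 e).trans ?_
      gcongr; linarith
    · have e : ‖Ux t‖ ^ 2 ≤ K₆ * 1 ^ 2 := by linarith [sq_nonneg ‖Ux t‖]
      have := le_mul_of_sq_le hK₆0 zero_le_one e
      linarith
    · have := le_mul_of_sq_le (s := 1) q2 zero_le_one (r2.trans_eq (by ring))
      linarith
    · calc ∫ s in (0 : ℝ)..t, ‖Ux s‖ ^ 2 ≤ K₅ / b * σ ^ 2 := by
            rw [div_mul_eq_mul_div, le_div_iff₀ hb]; linarith
        _ ≤ C * σ ^ 2 := by gcongr; linarith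
    · exact r1.trans (by gcongr; linarith)
  refine ⟨key.mono fun t ht => ht.1, ?_, ?_⟩
  · rw [setIntegral_Ioo_eq hT.le]
    exact le_of_ae_le_of_continuousOn hT
      (continuousOn_primitive_Icc hT.le (integrableOn_norm_sq_of_top h.memUx))
      (key.mono fun t ht => ht.2.1) (right_mem_Icc.2 hT.le)
  · rw [setIntegral_Ioo_eq hT.le]
    exact le_of_ae_le_of_continuousOn hT
      (continuousOn_primitive_Icc hT.le (integrableOn_norm_sq_of_top h.memPx))
      (key.mono fun t ht => ht.2.2) (right_mem_Icc.2 hT.le)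

/-! ### The exponential layer -/

section Layer

variable {L r ε : ℝ}

theorem continuous_layerExp (r ε : ℝ) : Continuous fun x : ℝ => Real.exp (-(r * x / ε)) := by
  fun_prop

/-- The function `x ↦ e^{-r x / ε}` as an element of `L²(0, L)`. -/
noncomputable def layerExp (L r ε : ℝ) : L2 L := ofContinuous L _ (continuous_layerExp r ε)

/-- The constant function `1` as an element of `L²(0, L)`. -/
noncomputable def oneL2 (L : ℝ) : L2 L := ofContinuous L (fun _ => 1) continuous_const

/-- The normalized layer `(e^{-r x / ε} - e^{-r L / ε}) / (1 - e^{-r L / ε})`, equal to `1` at `0`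
and to `0` at `L`. -/
noncomputable def layer (L r ε : ℝ) : L2 L :=
  (1 - Real.exp (-(r * L / ε)))⁻¹ • (layerExp L r ε - Real.exp (-(r * L / ε)) • oneL2 L)

/-- The derivative of `layer`. -/
noncomputable def layerDeriv (L r ε : ℝ) : L2 L :=
  (1 - Real.exp (-(r * L / ε)))⁻¹ • (-(r / ε)) • layerExp L r ε

theorem toLp_profile (L r ε a c : ℝ) :
    (memLp_profile L r ε a c).toLp = a • layerExp L r ε + c • oneL2 L := by
  refine Lp.ext ?_
  filter_upwards [(memLp_profile L r ε a c).coeFn_toLp,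
    Lp.coeFn_add (a • layerExp L r ε) (c • oneL2 L), Lp.coeFn_smul a (layerExp L r ε),
    Lp.coeFn_smul c (oneL2 L), coeFn_ofContinuous (L := L) (continuous_layerExp r ε),
    coeFn_ofContinuous (L := L) (c := fun _ => (1 : ℝ)) continuous_const] with x h1 h2 h3 h4 h5 h6
  rw [h1, h2, Pi.add_apply, h3, h4, Pi.smul_apply, Pi.smul_apply, layerExp, h5, oneL2, h6, profile]
  simp [mul_comm]

theorem ofContinuous_const_mul {c : ℝ → ℝ} (hc : Continuous c) (k : ℝ) :
    ofContinuous L (fun x => k * c x) (continuous_const.mul hc) = k • ofContinuous L c hc := rfl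

theorem hasWeakDeriv_layerExp (hL : 0 < L) (r ε : ℝ) :
    HasWeakDeriv (layerExp L r ε) ((-(r / ε)) • layerExp L r ε) := by
  rw [layerExp, ← ofContinuous_const_mul]
  refine hasWeakDeriv_ofContinuous hL _ _ fun x => ?_
  have h : HasDerivAt (fun x : ℝ => -(r * x / ε)) (-(r * 1 / ε)) x :=
    (((hasDerivAt_id x).const_mul r).div_const ε).neg
  simpa [mul_comm] using h.exp

theorem hasWeakDeriv_oneL2 (hL : 0 < L) : HasWeakDeriv (oneL2 L) 0 := by
  have h := hasWeakDeriv_ofContinuous hL (c := fun _ => (1 : ℝ)) (c' := fun _ => 0 * 1)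
    continuous_const continuous_const fun x => by simpa using hasDerivAt_const x (1 : ℝ)
  rwa [ofContinuous_const_mul continuous_const, zero_smul] at h

theorem hasWeakDeriv_layer (hL : 0 < L) (r ε : ℝ) :
    HasWeakDeriv (layer L r ε) (layerDeriv L r ε) := by
  have h := ((hasWeakDeriv_layerExp hL r ε).sub
    ((hasWeakDeriv_oneL2 hL).smul (Real.exp (-(r * L / ε))))).smul
    (1 - Real.exp (-(r * L / ε)))⁻¹
  rwa [smul_zero, sub_zero] at h

theorem hasWeakDeriv_layerDeriv (hL : 0 < L) (r ε : ℝ) :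
    HasWeakDeriv (layerDeriv L r ε) ((-(r / ε)) • layerDeriv L r ε) := by
  have h := ((hasWeakDeriv_layerExp hL r ε).smul (-(r / ε))).smul (1 - Real.exp (-(r * L / ε)))⁻¹
  have e : (-(r / ε)) • layerDeriv L r ε = (1 - Real.exp (-(r * L / ε)))⁻¹ • (-(r / ε)) •
      (-(r / ε)) • layerExp L r ε := by
    rw [layerDeriv, smul_comm]
  rw [e]
  exact h

theorem exp_layer_lt_one (hL : 0 < L) (hr : 0 < r) (hε : 0 < ε) :
    Real.exp (-(r * L / ε)) < 1 := by
  rw [Real.exp_lt_one_iff]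
  have : 0 < r * L / ε := by positivity
  linarith

theorem pointValue_layer (hL : 0 < L) {y : ℝ} (hy : y ∈ Icc 0 L) :
    pointValue (layer L r ε) y = (1 - Real.exp (-(r * L / ε)))⁻¹ *
      (Real.exp (-(r * y / ε)) - Real.exp (-(r * L / ε))) := by
  have h1 := hasWeakDeriv_layerExp hL r ε
  have h2 := (hasWeakDeriv_oneL2 hL).smul (Real.exp (-(r * L / ε)))
  rw [layer, pointValue_smul hL (h1.sub h2) _ hy, pointValue_sub hL h1 h2 hy,
    pointValue_smul hL (hasWeakDeriv_oneL2 hL) _ hy, layerExp, oneL2,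
    pointValue_ofContinuous hL _ hy, pointValue_ofContinuous hL _ hy, mul_one]

theorem pointValue_layer_zero (hL : 0 < L) (hr : 0 < r) (hε : 0 < ε) :
    pointValue (layer L r ε) 0 = 1 := by
  have h := exp_layer_lt_one hL hr hε
  rw [pointValue_layer hL (left_mem_Icc.2 hL.le), mul_zero, zero_div, neg_zero, Real.exp_zero,
    inv_mul_cancel₀ (by linarith)]

theorem pointValue_layer_right (hL : 0 < L) : pointValue (layer L r ε) L = 0 := by
  rw [pointValue_layer hL (right_mem_Icc.2 hL.le), sub_self, mul_zero]

theorem norm_layerExp_sq_le (hL : 0 < L) (hr : 0 < r) (hε : 0 < ε) :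
    ‖layerExp L r ε‖ ^ 2 ≤ 1 / (2 * r) * ε := by
  have h := inner_self_deriv_eq hL (hasWeakDeriv_layerExp hL r ε)
  rw [layerExp, pointValue_ofContinuous hL _ (right_mem_Icc.2 hL.le),
    pointValue_ofContinuous hL _ (left_mem_Icc.2 hL.le), ← layerExp, real_inner_smul_right,
    real_inner_self_eq_norm_sq] at h
  simp only [mul_zero, zero_div, neg_zero, Real.exp_zero, one_pow] at h
  have h2 : 2 * (r / ε) * ‖layerExp L r ε‖ ^ 2 ≤ 1 := by
    nlinarith [sq_nonneg (Real.exp (-(r * L / ε)))]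
  calc ‖layerExp L r ε‖ ^ 2 = 1 / (2 * r) * ε * (2 * (r / ε) * ‖layerExp L r ε‖ ^ 2) := by
        field_simp
    _ ≤ 1 / (2 * r) * ε * 1 := by gcongr
    _ = _ := by ring

/-- `layer L r σ²` is a boundary-layer profile of width `σ²`. Its primitive vanishing at `L` is
`-(ε / r) layer`, up to an exponentially small linear function, which gives the bound of the pairing
with functions that vanish at `0`. -/
theorem exists_layerProfile (hL : 0 < L) (hr : 0 < r) :
    ∃ N₀ : ℝ, ∀ N σ : ℝ, N₀ ≤ N → 0 < σ → σ ≤ 1 →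
      LayerProfile σ N (layer L r (σ ^ 2)) (layerDeriv L r (σ ^ 2)) := by
  have hcid : Continuous fun x : ℝ => L - x := by fun_prop
  set lin : L2 L := ofContinuous L (fun x => L - x) hcid with hlin
  set m₁ := (1 - Real.exp (-(r * L)))⁻¹ with hm₁
  have hexp : Real.exp (-(r * L)) < 1 := by
    rw [Real.exp_lt_one_iff]
    have : 0 < r * L := by positivity
    linarith
  have hm₁0 : 0 < m₁ := by rw [hm₁]; exact inv_pos.2 (by linarith)
  set c₁ := 1 + 1 / (2 * r) with hc₁
  set c₂ := 2 / (r * L) ^ 2 with hc₂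
  have hc₁0 : 0 < c₁ := by positivity
  have hc₂0 : 0 < c₂ := by positivity
  set B := m₁ * (c₁ + c₂ * ‖oneL2 L‖) with hB
  have hB0 : 0 ≤ B := by positivity
  refine ⟨1 + B + m₁ * r * c₁ + (B / r + c₂ * m₁ * ‖lin‖), fun N σ hN hσ hσ1 => ?_⟩
  have hε : 0 < σ ^ 2 := by positivity
  have hε1 : σ ^ 2 ≤ 1 := pow_le_one₀ hσ.le hσ1
  set E := layerExp L r (σ ^ 2) with hE
  set e := Real.exp (-(r * L / σ ^ 2)) with he
  have he0 : 0 < e := Real.exp_pos _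
  have he1 : e < 1 := exp_layer_lt_one hL hr hε
  set m := (1 - e)⁻¹ with hm
  have hm0 : 0 < m := inv_pos.2 (by linarith)
  have hmm : m ≤ m₁ := by
    refine inv_anti₀ (by linarith) (sub_le_sub_left (Real.exp_le_exp.2 (neg_le_neg ?_)) 1)
    rw [le_div_iff₀ hε]
    exact mul_le_of_le_one_right (by positivity) hε1
  have hE1 : ‖E‖ ≤ c₁ * σ :=
    le_mul_of_sq_le (by positivity) hσ.le (norm_layerExp_sq_le hL hr hε)
  -- `e^{-s} ≤ 2 / s²` makes the value of the exponential at `L` negligible.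
  have he2 : e ≤ c₂ * σ ^ 4 := by
    have h1 := Real.quadratic_le_exp_of_nonneg (x := r * L / σ ^ 2) (by positivity)
    have h2 : (r * L / σ ^ 2) ^ 2 / 2 ≤ Real.exp (r * L / σ ^ 2) := by
      have : 0 < r * L / σ ^ 2 := by positivity
      linarith
    have h3 : e = (Real.exp (r * L / σ ^ 2))⁻¹ := by rw [he, Real.exp_neg]
    rw [h3]
    calc (Real.exp (r * L / σ ^ 2))⁻¹ ≤ ((r * L / σ ^ 2) ^ 2 / 2)⁻¹ :=
          inv_anti₀ (by positivity) h2
      _ = c₂ * σ ^ 4 := by rw [hc₂]; field_simp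
  have hσ43 : σ ^ 4 ≤ σ ^ 3 := pow_le_pow_of_le_one hσ.le hσ1 (by norm_num)
  have hσ41 : σ ^ 4 ≤ σ := by simpa using pow_le_pow_of_le_one hσ.le hσ1 (show 1 ≤ 4 by norm_num)
  have hρ : ‖layer L r (σ ^ 2)‖ ≤ B * σ := by
    rw [layer, norm_smul, Real.norm_of_nonneg hm0.le]
    calc m * ‖E - e • oneL2 L‖ ≤ m₁ * (c₁ * σ + c₂ * σ * ‖oneL2 L‖) := by
          gcongr
          refine (norm_sub_le _ _).trans (add_le_add hE1 ?_)
          rw [norm_smul, Real.norm_of_nonneg he0.le]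
          gcongr
          exact he2.trans (by gcongr)
      _ = B * σ := by rw [hB]; ring
  have hρx : σ * ‖layerDeriv L r (σ ^ 2)‖ ≤ m₁ * r * c₁ := by
    rw [layerDeriv, norm_smul, norm_smul, norm_neg, Real.norm_of_nonneg hm0.le,
      Real.norm_of_nonneg (by positivity)]
    calc σ * (m * (r / σ ^ 2 * ‖E‖)) ≤ σ * (m₁ * (r / σ ^ 2 * (c₁ * σ))) := by gcongr
      _ = m₁ * r * c₁ := by field_simp
  have hpos1 : 0 ≤ m₁ * r * c₁ := by positivity
  have hpos2 : 0 ≤ B / r + c₂ * m₁ * ‖lin‖ := by positivity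
  refine ⟨hasWeakDeriv_layer hL _ _, hρ.trans (by gcongr; linarith), hρx.trans (by linarith),
    ?_, ?_⟩
  · rw [pointValue_layer_zero hL hr hε, abs_one]; linarith
  · intro v w hvw hv0
    have hlind : HasWeakDeriv lin ((-1 : ℝ) • oneL2 L) := by
      rw [oneL2, ← ofContinuous_const_mul]
      refine hasWeakDeriv_ofContinuous hL _ _ fun x => ?_
      simpa using (hasDerivAt_id x).const_sub L
    set Q := (-(σ ^ 2 / r)) • layer L r (σ ^ 2) + (e * m) • lin with hQ
    have hQd : HasWeakDeriv Q (layer L r (σ ^ 2)) := by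
      have h := ((hasWeakDeriv_layer hL r (σ ^ 2)).smul (-(σ ^ 2 / r))).add (hlind.smul (e * m))
      have e1 : (-(σ ^ 2 / r)) • layerDeriv L r (σ ^ 2) + (e * m) • ((-1 : ℝ) • oneL2 L) =
          layer L r (σ ^ 2) := by
        have e2 : -(σ ^ 2 / r) * (m * -(r / σ ^ 2)) = m := by field_simp
        have e3 : (-(σ ^ 2 / r)) • layerDeriv L r (σ ^ 2) =
            (-(σ ^ 2 / r) * (m * -(r / σ ^ 2))) • layerExp L r (σ ^ 2) := by
          rw [layerDeriv, smul_smul, smul_smul, mul_assoc]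
        rw [e3, e2, layer]
        module
      rwa [e1] at h
    have hQL : pointValue Q L = 0 := by
      have hLm : L ∈ Icc 0 L := right_mem_Icc.2 hL.le
      rw [hQ, pointValue_add hL ((hasWeakDeriv_layer hL r (σ ^ 2)).smul _) (hlind.smul _) hLm,
        pointValue_smul hL (hasWeakDeriv_layer hL r (σ ^ 2)) _ hLm, pointValue_smul hL hlind _ hLm,
        pointValue_layer_right hL, hlin, pointValue_ofContinuous hL hcid hLm]
      ring
    have key := inner_add_inner_eq hL hQd hvw
    rw [hQL, hv0, zero_mul, mul_zero, sub_zero] at key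
    have hQn : ‖Q‖ ≤ (B / r + c₂ * m₁ * ‖lin‖) * σ ^ 3 := by
      refine (norm_add_le _ _).trans ?_
      rw [norm_smul, norm_smul, norm_neg, Real.norm_of_nonneg (by positivity),
        Real.norm_of_nonneg (by positivity)]
      calc σ ^ 2 / r * ‖layer L r (σ ^ 2)‖ + e * m * ‖lin‖
          ≤ σ ^ 2 / r * (B * σ) + (c₂ * σ ^ 3) * m₁ * ‖lin‖ := by
            gcongr
            exact he2.trans (by gcongr)
        _ = _ := by ring
    have e2 : inner ℝ (layer L r (σ ^ 2)) v = -inner ℝ Q w := by linarith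
    rw [e2, abs_neg]
    calc |inner ℝ Q w| ≤ ‖Q‖ * ‖w‖ := abs_real_inner_le_norm _ _
      _ ≤ (B / r + c₂ * m₁ * ‖lin‖) * σ ^ 3 * ‖w‖ := by gcongr
      _ ≤ N * σ ^ 3 * ‖w‖ := by gcongr; linarith

theorem thetaU_eq (U₀ lam ε : ℝ) (u0 : ℝ → L2 L) (t : ℝ) :
    thetaU U₀ lam ε u0 t = -(pointValue (u0 t) 0 • layer L (rate U₀ lam) ε) := by
  rw [thetaU, toLp_profile, layer]
  module

theorem thetaPsi_eq (U₀ lam ε : ℝ) (u0 : ℝ → L2 L) (t : ℝ) :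
    thetaPsi U₀ lam ε u0 t =
      ((lam ^ 2)⁻¹ / U₀ * pointValue (u0 t) 0) • layer L (rate U₀ lam) ε := by
  rw [thetaPsi, toLp_profile, layer, div_eq_mul_inv]
  module

end Layer

/-! ### Regularity of solutions -/

section Solutions

variable {L T : ℝ}

theorem HasWeakTimeDeriv.eq_add_primitive (hT : 0 < T) {v w : ℝ → L2 L}
    (h : HasWeakTimeDeriv T v w) (hv : ContinuousOn v (Icc 0 T)) {t : ℝ} (ht : t ∈ Icc 0 T) :
    v t = v 0 + ∫ s in (0 : ℝ)..t, w s := by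
  obtain ⟨c, hc⟩ := exists_ae_eq_const_add_primitive hT h.1 h.2.1 h.2.2
  have hp : ContinuousOn (fun t => c + ∫ s in (0 : ℝ)..t, w s) (Icc 0 T) :=
    continuousOn_const.add (continuousOn_primitive_Icc hT.le h.2.1)
  have h1 : EqOn v (fun t => c + ∫ s in (0 : ℝ)..t, w s) (Ioo 0 T) :=
    Measure.eqOn_open_of_ae_eq hc isOpen_Ioo (hv.mono Ioo_subset_Icc_self)
      (hp.mono Ioo_subset_Icc_self)
  have h2 := h1.of_subset_closure (t := Icc 0 T) hv hp Ioo_subset_Icc_self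
    (by rw [closure_Ioo hT.ne])
  have h3 : v 0 = c := by simpa using h2 (left_mem_Icc.2 hT.le)
  rw [h3]
  exact h2 ht

theorem HasWeakTimeDeriv.ae_unique {v w w' : ℝ → L2 L} (h : HasWeakTimeDeriv T v w)
    (h' : HasWeakTimeDeriv T v w') : ∀ᵐ t ∂(intervalMeasure T), w t = w' t := by
  have key : ∀ᵐ t ∂(intervalMeasure T), w t - w' t = 0 := by
    refine ae_eq_zero_of_integral_test (h.2.1.sub h'.2.1) fun φ hφ => ?_
    simp only [smul_sub]
    rw [integral_sub (hφ.integrableOn_smul h.2.1) (hφ.integrableOn_smul h'.2.1), sub_eq_zero,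
      ← neg_inj, ← h.2.2 φ hφ, ← h'.2.2 φ hφ]
  filter_upwards [key] with t ht
  exact sub_eq_zero.1 ht

/-- The derivatives of a solution of the viscous problem in the class `𝓚`: all are bounded, and
they satisfy the equations. -/
theorem IsViscousSolution.exists_derivs (hT : 0 < T) {U₀ lam ε : ℝ} {f g : ℝ → L2 L}
    {uInit ψInit : L2 L} {u ψ : ℝ → L2 L} (hK : ClassK T u ψ)
    (hs : IsViscousSolution U₀ lam T ε f g uInit ψInit u ψ) :
    ∃ ut ux uxx ψt ψx ψxx : ℝ → L2 L,
      (MemLinfL2 T ut ∧ MemLinfL2 T ux ∧ MemLinfL2 T uxx ∧ MemLinfL2 T ψt ∧ MemLinfL2 T ψx ∧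
        MemLinfL2 T ψxx) ∧
      (∀ t ∈ Icc 0 T, u t = uInit + ∫ s in (0 : ℝ)..t, ut s) ∧
      (∀ t ∈ Icc 0 T, ψ t = ψInit + ∫ s in (0 : ℝ)..t, ψt s) ∧
      ∀ᵐ t ∂(intervalMeasure T), (HasWeakDeriv (u t) (ux t) ∧ HasWeakDeriv (ux t) (uxx t) ∧
        HasWeakDeriv (ψ t) (ψx t) ∧ HasWeakDeriv (ψx t) (ψxx t)) ∧
        (pointValue (u t) 0 = 0 ∧ pointValue (u t) L = 0 ∧ pointValue (ψ t) 0 = 0) ∧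
        ut t + U₀ • ux t + ψx t - (2 * ε) • uxx t = f t ∧
        ψt t + U₀ • ψx t + (lam ^ 2)⁻¹ • ux t = g t := by
  obtain ⟨⟨⟨huc, hψc⟩, -, ux, uxx, ψx, hux, huxx, hψx, mux, muxx, mψx⟩, -,
    ⟨px, pxx, hpx, hpxx, mpxx⟩, ut, ψt, hut, hψt, hutc, hψtc⟩ := hK
  obtain ⟨⟨ut', ux', uxx', ψt', ψx', hut', hux', huxx', hψt', hψx', heq⟩, htr, hu0, hψ0⟩ := hs
  refine ⟨ut, ux, uxx, ψt, ψx, pxx, ⟨memLinfL2_of_continuousOn hutc, mux, muxx,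
    memLinfL2_of_continuousOn hψtc, mψx, mpxx⟩, fun t ht => ?_, fun t ht => ?_, ?_⟩
  · rw [← hu0]; exact hut.eq_add_primitive hT huc ht
  · rw [← hψ0]; exact hψt.eq_add_primitive hT hψc ht
  · filter_upwards [hux, huxx, hψx, hpx, hpxx, htr, heq, hut.ae_unique hut',
      hψt.ae_unique hψt', hux', huxx', hψx'] with t h1 h2 h3 h4 h5 h6 h7 h8 h9 h10 h11 h12
    have e1 := h1.unique h10
    have e2 := h3.unique h12
    rw [← e1] at h11
    have e3 := h2.unique h11
    have e4 := h4.unique h3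
    rw [e4] at h5
    rw [h8, h9, e1, e2, e3]
    rw [e1, e3] at h2
    rw [e1] at h1
    rw [e2] at h3 h5
    exact ⟨⟨h1, h2, h3, h5⟩, h6, h7⟩

/-- The derivatives of a solution of the inviscid problem in the class `𝓚⁰`. The bound of `ψ_{xt}`
makes the trace of `ψ` at `0` Lipschitz continuous in time. -/
theorem IsInviscidSolution.exists_derivs (hL : 0 < L) (hT : 0 < T) {U₀ lam : ℝ} {f g : ℝ → L2 L}
    {uInit ψInit : L2 L} {u ψ : ℝ → L2 L} (hK : ClassK0 U₀ lam T u ψ)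
    (hs : IsInviscidSolution U₀ lam T f g uInit ψInit u ψ) :
    ∃ ut ux uxx ψt ψx ψxx : ℝ → L2 L, ∃ d : ℝ, ∃ κ : ℝ → ℝ,
      (MemLinfL2 T ut ∧ MemLinfL2 T ux ∧ MemLinfL2 T uxx ∧ MemLinfL2 T ψt ∧ MemLinfL2 T ψx ∧
        MemLinfL2 T ψxx ∧ MemLp κ ∞ (intervalMeasure T)) ∧
      (∀ t ∈ Icc 0 T, u t = uInit + ∫ s in (0 : ℝ)..t, ut s) ∧
      (∀ t ∈ Icc 0 T, ψ t = ψInit + ∫ s in (0 : ℝ)..t, ψt s) ∧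
      ∀ᵐ t ∂(intervalMeasure T), (HasWeakDeriv (u t) (ux t) ∧ HasWeakDeriv (ux t) (uxx t) ∧
        HasWeakDeriv (ψ t) (ψx t) ∧ HasWeakDeriv (ψx t) (ψxx t)) ∧
        (pointValue (ψ t) 0 = d + ∫ s in (0 : ℝ)..t, κ s) ∧
        (pointValue (u t) 0 + U₀ * lam ^ 2 * pointValue (ψ t) 0 = 0 ∧ pointValue (u t) L = 0) ∧
        ut t + U₀ • ux t + ψx t = f t ∧
        ψt t + U₀ • ψx t + (lam ^ 2)⁻¹ • ux t = g t := by
  obtain ⟨⟨⟨huc, hψc⟩, -, ux, ψx, hux, hψx, mux, mψx⟩, ⟨vx, vxt, hvx, hvxt, mvxt⟩,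
    ⟨qx, qxx, hqx, hqxx, mqxx⟩, ⟨px, pxx, hpx, hpxx, mpxx⟩, ut, ψt, hut, hψt, hutc, hψtc⟩ := hK
  obtain ⟨⟨ut', ux', ψt', ψx', hut', hux', hψt', hψx', heq⟩, htr, hu0, hψ0⟩ := hs
  obtain ⟨e₀, e₁, he⟩ := exists_trace_functional hL
  have mψt := memLinfL2_of_continuousOn hψtc
  obtain ⟨c, hc⟩ := exists_ae_eq_const_add_primitive hT hvxt.1 hvxt.2.1 hvxt.2.2
  have mκ : MemLp (fun t => (inner ℝ e₀ (ψt t) : ℝ) + inner ℝ e₁ (vxt t)) ∞ (intervalMeasure T) :=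
    ((innerSL ℝ e₀).comp_memLp' mψt).add ((innerSL ℝ e₁).comp_memLp' mvxt)
  refine ⟨ut, ux, qxx, ψt, ψx, pxx, inner ℝ e₀ ψInit + inner ℝ e₁ c,
    fun t => inner ℝ e₀ (ψt t) + inner ℝ e₁ (vxt t), ⟨memLinfL2_of_continuousOn hutc, mux, mqxx,
    mψt, mψx, mpxx, mκ⟩, fun t ht => ?_, fun t ht => ?_, ?_⟩
  · rw [← hu0]; exact hut.eq_add_primitive hT huc ht
  · rw [← hψ0]; exact hψt.eq_add_primitive hT hψc ht
  · filter_upwards [hux, hψx, hpx, hpxx, htr, heq, hut.ae_unique hut',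
      hψt.ae_unique hψt', hux', hψx', hqx, hqxx, hvx, hc, ae_restrict_mem measurableSet_Ioo]
      with t h1 h3 h4 h5 h6 h7 h8 h9 h10 h12 h13 h14 h15 h16 htT
    have ht := Ioo_subset_Icc_self htT
    have h0 : (0 : ℝ) ∈ Icc 0 T := left_mem_Icc.2 hT.le
    have e1 := h1.unique h10
    have e2 := h3.unique h12
    have e3 := h13.unique h10
    have e4 := h4.unique h12
    have htrace : pointValue (ψ t) 0 = inner ℝ e₀ ψInit + inner ℝ e₁ c +
        ∫ s in (0 : ℝ)..t, (inner ℝ e₀ (ψt s) + inner ℝ e₁ (vxt s)) := by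
      have i0 := intervalIntegrable_of_Ioo_of_mem hψt.2.1 h0 ht
      have i1 := intervalIntegrable_of_Ioo_of_mem hvxt.2.1 h0 ht
      have j0 := intervalIntegrable_of_Ioo_of_mem ((innerSL ℝ e₀).integrable_comp hψt.2.1) h0 ht
      have j1 := intervalIntegrable_of_Ioo_of_mem ((innerSL ℝ e₁).integrable_comp hvxt.2.1) h0 ht
      have k0 := (innerSL ℝ e₀).intervalIntegral_comp_comm i0
      have k1 := (innerSL ℝ e₁).intervalIntegral_comp_comm i1
      simp only [innerSL_apply_apply] at j0 j1 k0 k1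
      rw [he _ _ h15, h16, hψt.eq_add_primitive hT hψc ht, hψ0, inner_add_right, inner_add_right,
        intervalIntegral.integral_add j0 j1, k0, k1]
      ring
    rw [e3] at h14
    rw [e4] at h5
    rw [h8, h9, e1, e2]
    exact ⟨⟨h10, h14, h12, h5⟩, htrace, h6, h7⟩

/-- Compatibility at the corner `(0, 0)`: since a viscous solution with zero traces has the same
initial value, the trace of `ψ⁰` at `0` vanishes initially. -/
theorem initial_trace_eq_zero (hL : 0 < L) (hT : 0 < T) {ψ ψ0 ψx ψx0 : ℝ → L2 L} {d : ℝ}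
    {κ : ℝ → ℝ} (hκ : IntegrableOn κ (Ioo 0 T)) (hψ : ContinuousOn ψ (Icc 0 T))
    (hψ0 : ContinuousOn ψ0 (Icc 0 T)) (h0 : ψ 0 = ψ0 0) (mψx : MemLinfL2 T ψx)
    (mψx0 : MemLinfL2 T ψx0)
    (h : ∀ᵐ t ∂(intervalMeasure T), HasWeakDeriv (ψ t) (ψx t) ∧ HasWeakDeriv (ψ0 t) (ψx0 t) ∧
      pointValue (ψ t) 0 = 0 ∧ pointValue (ψ0 t) 0 = d + ∫ s in (0 : ℝ)..t, κ s) : d = 0 := by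
  obtain ⟨M, hM0, hM⟩ := exists_bound_of_memLp_top mψx
  obtain ⟨M', hM0', hM'⟩ := exists_bound_of_memLp_top mψx0
  have hD := (hψ.sub hψ0).norm
  have key := le_of_ae_le_of_continuousOn hT
    (f := fun t => (d + ∫ s in (0 : ℝ)..t, κ s) ^ 2 -
      (‖ψ t - ψ0 t‖ ^ 2 / L + 2 * ‖ψ t - ψ0 t‖ * (M + M'))) (c := 0)
    (((continuousOn_const.add (continuousOn_primitive_Icc hT.le hκ)).pow 2).sub
      (((hD.pow 2).div_const L).add ((continuousOn_const.mul hD).mul continuousOn_const))) (by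
    filter_upwards [h, hM, hM'] with t ht h1 h2
    obtain ⟨a1, a2, a3, a4⟩ := ht
    have h0' : (0 : ℝ) ∈ Icc 0 L := left_mem_Icc.2 hL.le
    have e := pointValue_sq_le hL (a1.sub a2) h0'
    rw [pointValue_sub hL a1 a2 h0', a3, a4, zero_sub, neg_sq] at e
    have e2 : ‖ψx t - ψx0 t‖ ≤ M + M' := (norm_sub_le _ _).trans (add_le_add h1 h2)
    have e3 : 2 * ‖ψ t - ψ0 t‖ * ‖ψx t - ψx0 t‖ ≤ 2 * ‖ψ t - ψ0 t‖ * (M + M') := by gcongr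
    linarith) (left_mem_Icc.2 hT.le)
  simp only [intervalIntegral.integral_same, add_zero, h0, sub_self, norm_zero] at key
  have : d ^ 2 ≤ 0 := by
    refine le_trans (le_of_eq ?_) key
    simp
  exact pow_eq_zero_iff (two_ne_zero) |>.1 (le_antisymm this (sq_nonneg d))

end Solutions

/-! ### The error system of the corrected approximation -/

section Assembly

variable {L T : ℝ}

theorem rate_pos {U₀ lam : ℝ} (hU : 0 < U₀) (hlam : 0 < lam) (hUlam : U₀ < lam⁻¹) :
    0 < rate U₀ lam := by
  have h1 : U₀ * lam < 1 := by
    calc U₀ * lam < lam⁻¹ * lam := by gcongr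
      _ = 1 := inv_mul_cancel₀ hlam.ne'
  have h2 : (U₀ * lam) ^ 2 < 1 := pow_lt_one₀ (by positivity) h1 two_ne_zero
  have e : rate U₀ lam = (1 - (U₀ * lam) ^ 2) / (2 * U₀ * lam ^ 2) := by
    rw [rate]; field_simp
  rw [e]
  exact div_pos (by linarith) (by positivity)

/-- The rate `r` is the one for which the layer solves the leading-order equation
`(U₀ - 1 / (U₀ λ²)) θ_x = 2 ε θ_xx`. -/
theorem two_mul_rate {U₀ : ℝ} (lam : ℝ) (hU : U₀ ≠ 0) :
    2 * rate U₀ lam = (lam ^ 2)⁻¹ / U₀ - U₀ := by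
  rcases eq_or_ne lam 0 with rfl | h
  · simp [rate]; ring
  · rw [rate]; field_simp

/-- The difference of a viscous solution and the corrected inviscid solution satisfies an error
system, with constants that do not depend on the viscosity `ε = σ²`. -/
theorem exists_errorSystem {a lam : ℝ} (hU : 0 < a) (hlam : 0 < lam) (hUlam : a < lam⁻¹)
    (hL : 0 < L) (hT : 0 < T) {f g : ℝ → L2 L} {uInit ψInit : L2 L} {u0 ψ0 : ℝ → L2 L}
    (hK0 : ClassK0 a lam T u0 ψ0)
    (hs0 : IsInviscidSolution a lam T f g uInit ψInit u0 ψ0) :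
    ∃ N : ℝ, ∀ σ : ℝ, 0 < σ → σ ≤ 1 → ∀ u ψ : ℝ → L2 L, ClassK T u ψ →
      IsViscousSolution a lam T (σ ^ 2) f g uInit ψInit u ψ →
      ∃ (k : ℝ → L2 L) (η : ℝ → ℝ) (U Ut Ux Uxx P S Px Pxx : ℝ → L2 L),
        ErrorSystem T a (lam ^ 2)⁻¹ σ N (layer L (rate a lam) (σ ^ 2))
          (layerDeriv L (rate a lam) (σ ^ 2)) k η U Ut Ux Uxx P S Px Pxx ∧
        (∀ᵐ t ∂(intervalMeasure T), remainderU a lam (σ ^ 2) u u0 t = U t) ∧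
        (∀ᵐ t ∂(intervalMeasure T), remainderPsi a lam (σ ^ 2) ψ ψ0 u0 t = P t) := by
  have hr := rate_pos hU hlam hUlam
  obtain ⟨vt, vx, vxx, qt, qx, qxx, d, κ, ⟨mvt, mvx, mvxx, mqt, mqx, mqxx, mκ⟩, hv, hq, hae0⟩ :=
    hs0.exists_derivs hL hT hK0
  obtain ⟨N₀, hN₀⟩ := exists_layerProfile hL hr
  have mη : MemLp (fun t => -(a * lam ^ 2) * κ t) ∞ (intervalMeasure T) := mκ.const_mul _
  obtain ⟨M₁, -, hM₁⟩ := exists_bound_of_memLp_top mvxx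
  obtain ⟨M₂, -, hM₂⟩ := exists_bound_of_memLp_top mη
  refine ⟨max N₀ (max M₁ M₂), fun σ hσ hσ1 u ψ hK hs => ?_⟩
  obtain ⟨ut, ux, uxx, pt, px, pxx, ⟨mutu, mux, muxx, mpt, mpx, mpxx⟩, hu, hp, hae⟩ :=
    hs.exists_derivs hT hK
  have hd : d = 0 := initial_trace_eq_zero hL hT (mκ.integrable (by simp)) hK.1.1.2 hK0.1.1.2
    (hs.2.2.2.trans hs0.2.2.2.symm) mpx mqx (by
      filter_upwards [hae, hae0] with t h1 h2
      exact ⟨h1.1.2.2.1, h2.1.2.2.1, h1.2.1.2.2, h2.2.1⟩)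
  set b := (lam ^ 2)⁻¹ with hb
  have hl2 : lam ^ 2 = b⁻¹ := by rw [hb, inv_inv]
  have hb0 : 0 < b := by positivity
  set r := rate a lam with hr'
  set ρ := layer L r (σ ^ 2) with hρ
  set ρx := layerDeriv L r (σ ^ 2)
  have dρ : HasWeakDeriv ρ ρx := hasWeakDeriv_layer hL r (σ ^ 2)
  have dρx : HasWeakDeriv ρx ((-(r / σ ^ 2)) • ρx) := hasWeakDeriv_layerDeriv hL r (σ ^ 2)
  have hρ0 : pointValue ρ 0 = 1 := pointValue_layer_zero hL hr (by positivity)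
  have hρL : pointValue ρ L = 0 := pointValue_layer_right hL
  set η : ℝ → ℝ := fun t => -(a * lam ^ 2) * κ t
  set h : ℝ → ℝ := fun t => ∫ s in (0 : ℝ)..t, η s
  have iη : IntegrableOn η (Ioo 0 T) := mη.integrable (by simp)
  have ch : ContinuousOn h (Icc 0 T) := continuousOn_primitive_Icc hT.le iη
  have mh : ∀ (c : ℝ) (p : L2 L), MemLinfL2 T (fun t => (c * h t) • p) := fun c p =>
    memLinfL2_of_continuousOn ((continuousOn_const.mul ch).smul continuousOn_const)
  have mηs : ∀ (c : ℝ) (p : L2 L), MemLinfL2 T (fun t => (c * η t) • p) := fun c p =>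
    (ContinuousLinearMap.toSpanSingleton ℝ p).comp_memLp' (mη.const_mul c)
  -- The amplitude `h` of the layer is the trace of `u⁰` at the inflow boundary; it starts from
  -- zero because `d = 0`.
  have hamp : ∀ᵐ t ∂(intervalMeasure T), pointValue (u0 t) 0 = h t ∧
      pointValue (ψ0 t) 0 = -(b / a * h t) := by
    filter_upwards [hae0] with t ht
    obtain ⟨-, h1, ⟨h2, -⟩, -⟩ := ht
    have e : h t = -(a * lam ^ 2) * ∫ s in (0 : ℝ)..t, κ s :=
      intervalIntegral.integral_const_mul _ _
    rw [hd, zero_add] at h1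
    rw [e, h1, hl2]
    rw [h1, hl2] at h2
    refine ⟨by linarith, ?_⟩
    field_simp
  have hprim : ∀ (c : ℝ) (x y : ℝ → L2 L), MemLinfL2 T x → MemLinfL2 T y → ∀ t ∈ Icc 0 T,
      ∫ s in (0 : ℝ)..t, (x s - y s + (c * η s) • ρ) =
        (∫ s in (0 : ℝ)..t, x s) - (∫ s in (0 : ℝ)..t, y s) + (c * h t) • ρ := by
    intro c x y mx my t ht
    have h0 : (0 : ℝ) ∈ Icc 0 T := left_mem_Icc.2 hT.le
    have ix := intervalIntegrable_of_Ioo_of_mem (mx.integrable (by simp)) h0 ht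
    have iy := intervalIntegrable_of_Ioo_of_mem (my.integrable (by simp)) h0 ht
    have iz := intervalIntegrable_of_Ioo_of_mem ((mηs c ρ).integrable (by simp)) h0 ht
    rw [intervalIntegral.integral_add (ix.sub iy) iz, intervalIntegral.integral_sub ix iy,
      intervalIntegral.integral_smul_const, intervalIntegral.integral_const_mul]
  refine ⟨vxx, η, fun t => u t - u0 t + (1 * h t) • ρ, fun t => ut t - vt t + (1 * η t) • ρ,
    fun t => ux t - vx t + (1 * h t) • ρx,
    fun t => uxx t - vxx t + (1 * h t) • (-(r / σ ^ 2)) • ρx,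
    fun t => ψ t - ψ0 t + (-(b / a) * h t) • ρ, fun t => pt t - qt t + (-(b / a) * η t) • ρ,
    fun t => px t - qx t + (-(b / a) * h t) • ρx,
    fun t => pxx t - qxx t + (-(b / a) * h t) • (-(r / σ ^ 2)) • ρx,
    ⟨hN₀ _ σ (le_max_left _ _) hσ hσ1, ?_, (mutu.sub mvt).add (mηs _ _), (mux.sub mvx).add (mh _ _),
      (muxx.sub mvxx).add (mh _ _), (mpt.sub mqt).add (mηs _ _), (mpx.sub mqx).add (mh _ _),
      (mpxx.sub mqxx).add (mh _ _), mη, fun t ht => ?_, fun t ht => ?_⟩, ?_, ?_⟩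
  · filter_upwards [hae, hae0, hamp, hM₁, hM₂] with t h1 h2 h3 h4 h5
    obtain ⟨⟨d1, d2, d3, d4⟩, ⟨t1, t2, t3⟩, e1, e2⟩ := h1
    obtain ⟨⟨d1', d2', d3', d4'⟩, -, ⟨-, t2'⟩, e1', e2'⟩ := h2
    have hm0 : (0 : ℝ) ∈ Icc 0 L := left_mem_Icc.2 hL.le
    have hmL : L ∈ Icc 0 L := right_mem_Icc.2 hL.le
    refine ⟨(d1.sub d1').add (dρ.smul _), (d2.sub d2').add (dρx.smul _),
      (d3.sub d3').add (dρ.smul _), (d4.sub d4').add (dρx.smul _), ?_, ?_, ?_, ?_, ?_,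
      h4.trans ((le_max_left _ _).trans (le_max_right _ _)),
      h5.trans ((le_max_right _ _).trans (le_max_right _ _))⟩
    · rw [pointValue_add hL (d1.sub d1') (dρ.smul _) hm0, pointValue_sub hL d1 d1' hm0,
        pointValue_smul hL dρ _ hm0, t1, h3.1, hρ0]
      ring
    · rw [pointValue_add hL (d1.sub d1') (dρ.smul _) hmL, pointValue_sub hL d1 d1' hmL,
        pointValue_smul hL dρ _ hmL, t2, t2', hρL]
      ring
    · rw [pointValue_add hL (d3.sub d3') (dρ.smul _) hm0, pointValue_sub hL d3 d3' hm0,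
        pointValue_smul hL dρ _ hm0, t3, h3.2, hρ0]
      ring
    · have e : (2 * σ ^ 2) * (-(r / σ ^ 2)) = a - b / a := by
        have h6 := two_mul_rate lam hU.ne'
        rw [← hr'] at h6
        have : (2 * σ ^ 2) * (-(r / σ ^ 2)) = -(2 * r) := by field_simp
        rw [this, h6]; ring
      have e' : (2 * σ ^ 2) • (1 * h t) • (-(r / σ ^ 2)) • ρx = (h t * (a - b / a)) • ρx := by
        rw [smul_smul, smul_smul, ← e]; congr 1; ring
      rw [smul_add a, smul_add (2 * σ ^ 2), e']
      have e3 := sub_eq_zero.2 (e1.trans e1'.symm)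
      rw [← sub_eq_zero, ← e3]
      module
    · have e3 := sub_eq_zero.2 (e2.trans e2'.symm)
      have e4 : a * (-(b / a) * h t) = -(b * h t) := by field_simp
      rw [smul_add a, smul_smul a, e4, ← sub_eq_zero, ← e3]
      module
  · rw [hprim _ _ _ mutu mvt t ht, hu t ht, hv t ht]
    abel
  · rw [hprim _ _ _ mpt mqt t ht, hp t ht, hq t ht]
    abel
  · filter_upwards [hamp] with t ht
    rw [remainderU, thetaU_eq, ht.1]
    simp [hρ, hr']
  · filter_upwards [hamp] with t ht
    rw [remainderPsi, thetaPsi_eq, ht.1]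
    simp [hρ, hr', ← sub_eq_add_neg, hb]

/-! ### Norms of pairs -/

theorem norm_toLp_prod_le {E F : Type*} [SeminormedAddCommGroup E] [SeminormedAddCommGroup F]
    (x : E) (y : F) : ‖WithLp.toLp 2 (x, y)‖ ≤ ‖x‖ + ‖y‖ := by
  refine abs_le_of_sq_le_sq' ?_ (by positivity) |>.2
  rw [WithLp.prod_norm_sq_eq_of_L2]
  change ‖x‖ ^ 2 + ‖y‖ ^ 2 ≤ _
  nlinarith [mul_nonneg (norm_nonneg x) (norm_nonneg y)]

theorem norm_vec_two_le (x y : ℝ) : ‖!₂[x, y]‖ ≤ |x| + |y| := by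
  refine abs_le_of_sq_le_sq' ?_ (by positivity) |>.2
  rw [EuclideanSpace.norm_sq_eq]
  simp only [Fin.sum_univ_two, Real.norm_eq_abs]
  simp
  nlinarith [mul_nonneg (abs_nonneg x) (abs_nonneg y), sq_abs x, sq_abs y]

theorem aestronglyMeasurable_pairH {v w : ℝ → L2 L}
    (hv : AEStronglyMeasurable v (intervalMeasure T))
    (hw : AEStronglyMeasurable w (intervalMeasure T)) :
    AEStronglyMeasurable (pairH v w) (intervalMeasure T) :=
  (WithLp.prod_continuous_toLp 2 (L2 L) (L2 L)).comp_aestronglyMeasurable (hv.prodMk hw)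

theorem eLpNorm_pairH_le {p : ℝ≥0∞} (hp : 1 ≤ p) {v w : ℝ → L2 L}
    (hv : AEStronglyMeasurable v (intervalMeasure T))
    (hw : AEStronglyMeasurable w (intervalMeasure T)) :
    eLpNorm (pairH v w) p (intervalMeasure T) ≤
      eLpNorm v p (intervalMeasure T) + eLpNorm w p (intervalMeasure T) := by
  calc eLpNorm (pairH v w) p (intervalMeasure T)
      ≤ eLpNorm ((fun t => ‖v t‖) + fun t => ‖w t‖) p (intervalMeasure T) :=
        eLpNorm_mono_real fun t => norm_toLp_prod_le (v t) (w t)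
    _ ≤ _ := (eLpNorm_add_le hv.norm hw.norm hp).trans (by rw [eLpNorm_norm, eLpNorm_norm])

theorem memLp_pairH {p : ℝ≥0∞} (hp : 1 ≤ p) {v w : ℝ → L2 L} (hv : MemLp v p (intervalMeasure T))
    (hw : MemLp w p (intervalMeasure T)) : MemLp (pairH v w) p (intervalMeasure T) :=
  ⟨aestronglyMeasurable_pairH hv.1 hw.1,
    (eLpNorm_pairH_le hp hv.1 hw.1).trans_lt (ENNReal.add_lt_top.2 ⟨hv.2, hw.2⟩)⟩

theorem eLpNorm_two_le {v : ℝ → L2 L} (hv : MemLp v 2 (intervalMeasure T)) {C s : ℝ} (hC : 0 ≤ C)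
    (hs : 0 ≤ s) (h : ∫ t in Ioo 0 T, ‖v t‖ ^ 2 ≤ C * s ^ 2) :
    eLpNorm v 2 (intervalMeasure T) ≤ ENNReal.ofReal ((1 + C) * s) := by
  rw [hv.eLpNorm_eq_integral_rpow_norm (by simp) (by simp)]
  refine ENNReal.ofReal_le_ofReal ?_
  have h0 : 0 ≤ ∫ t in Ioo 0 T, ‖v t‖ ^ 2 := integral_nonneg fun t => by positivity
  simp only [ENNReal.toReal_ofNat, Real.rpow_two, ← one_div, ← Real.sqrt_eq_rpow]
  refine le_mul_of_sq_le hC hs ?_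
  rwa [Real.sq_sqrt h0]

theorem eLpNorm_top_le {v : ℝ → L2 L} {c : ℝ} (h : ∀ᵐ t ∂(intervalMeasure T), ‖v t‖ ≤ c) :
    eLpNorm v ∞ (intervalMeasure T) ≤ ENNReal.ofReal c := by
  rw [eLpNorm_exponent_top]
  exact eLpNormEssSup_le_of_ae_bound h

theorem normLinfLinf_le {v w : ℝ → L2 L} {c : ℝ}
    (h : ∀ᵐ t ∂(intervalMeasure T), ∀ᵐ x ∂(intervalMeasure L), |v t x| ≤ c ∧ |w t x| ≤ c) :
    normLinfLinf T v w ≤ ENNReal.ofReal (2 * c) := by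
  refine essSup_le_of_ae_le _ ?_
  filter_upwards [h] with t ht
  rw [eLpNorm_exponent_top]
  refine eLpNormEssSup_le_of_ae_bound ?_
  filter_upwards [ht] with x hx
  exact (norm_vec_two_le _ _).trans (by linarith [hx.1, hx.2])

/-- The interpolation `‖v‖_∞² ≤ ‖v‖² / L + 2 ‖v‖ ‖v_x‖` turns a bound of order `σ²` in `L²` and
a bounded gradient into a bound of order `σ` in `L^∞`. -/
theorem ae_abs_le_of_norm_le (hL : 0 < L) {v w : L2 L} (h : HasWeakDeriv v w) {C σ : ℝ}
    (hσ : 0 < σ) (hσ1 : σ ≤ 1) (hv : ‖v‖ ≤ C * σ ^ 2) (hw : ‖w‖ ≤ C) :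
    ∀ᵐ x ∂(intervalMeasure L), |v x| ≤ (1 + (C ^ 2 / L + 2 * C ^ 2)) * σ := by
  have hC : 0 ≤ C := (norm_nonneg w).trans hw
  filter_upwards [ae_sq_le hL h] with x hx
  refine le_mul_of_sq_le (by positivity) hσ.le ?_
  rw [sq_abs]
  have h1 : ‖v‖ ^ 2 / L ≤ C ^ 2 / L * σ ^ 2 := by
    calc ‖v‖ ^ 2 / L ≤ (C * σ ^ 2) ^ 2 / L := by gcongr
      _ = C ^ 2 / L * σ ^ 2 * σ ^ 2 := by ring
      _ ≤ C ^ 2 / L * σ ^ 2 * 1 := by gcongr; exact pow_le_one₀ hσ.le hσ1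
      _ = C ^ 2 / L * σ ^ 2 := mul_one _
  have h2 : 2 * ‖v‖ * ‖w‖ ≤ 2 * (C * σ ^ 2) * C := by gcongr
  nlinarith

end Assembly

end BoundaryLayer

theorem theorem1p1
    (U₀ lam L T : ℝ) (hU : 0 < U₀) (hlam : 0 < lam) (hUlam : U₀ < lam⁻¹)
    (hL : 0 < L) (hT : 0 < T)
    (f g : ℝ → BoundaryLayer.L2 L) (uInit ψInit : BoundaryLayer.L2 L)
    (u0 ψ0 : ℝ → BoundaryLayer.L2 L)
    (hK0 : BoundaryLayer.ClassK0 U₀ lam T u0 ψ0)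
    (hsol0 : BoundaryLayer.IsInviscidSolution U₀ lam T f g uInit ψInit u0 ψ0) :
    ∃ C : ℝ, ∀ ε : ℝ, 0 < ε → ε ≤ 1 → ∀ u ψ : ℝ → BoundaryLayer.L2 L,
      BoundaryLayer.ClassK T u ψ →
      BoundaryLayer.IsViscousSolution U₀ lam T ε f g uInit ψInit u ψ →
      ∃ Ux Ψx : ℝ → BoundaryLayer.L2 L,
        BoundaryLayer.HasWeakSpaceDeriv T
          (BoundaryLayer.remainderU U₀ lam ε u u0) Ux ∧
        BoundaryLayer.HasWeakSpaceDeriv T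
          (BoundaryLayer.remainderPsi U₀ lam ε ψ ψ0 u0) Ψx ∧
        MemLp (BoundaryLayer.pairH (BoundaryLayer.remainderU U₀ lam ε u u0)
          (BoundaryLayer.remainderPsi U₀ lam ε ψ ψ0 u0)) ∞
          (BoundaryLayer.intervalMeasure T) ∧
        MemLp (BoundaryLayer.pairH Ux Ψx) 2 (BoundaryLayer.intervalMeasure T) ∧
        eLpNorm (BoundaryLayer.pairH (BoundaryLayer.remainderU U₀ lam ε u u0)
            (BoundaryLayer.remainderPsi U₀ lam ε ψ ψ0 u0)) ∞
            (BoundaryLayer.intervalMeasure T)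
          + ENNReal.ofReal (ε ^ (1 / 2 : ℝ)) *
            eLpNorm (BoundaryLayer.pairH Ux Ψx) 2 (BoundaryLayer.intervalMeasure T)
          ≤ ENNReal.ofReal (C * ε) ∧
        BoundaryLayer.normLinfLinf T (BoundaryLayer.remainderU U₀ lam ε u u0)
            (BoundaryLayer.remainderPsi U₀ lam ε ψ ψ0 u0)
          ≤ ENNReal.ofReal (C * ε ^ (1 / 2 : ℝ)) := by
  obtain ⟨N, hN⟩ := BoundaryLayer.exists_errorSystem hU hlam hUlam hL hT hK0 hsol0
  obtain ⟨C, hC, hbound⟩ := BoundaryLayer.ErrorSystem.exists_bound (N := N) hL hT hU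
    (inv_pos.2 (pow_pos hlam 2))
  have hC' : 0 ≤ C ^ 2 / L + 2 * C ^ 2 := by positivity
  refine ⟨2 + 4 * C + 2 * (1 + (C ^ 2 / L + 2 * C ^ 2)), fun ε hε hε1 u ψ hK hs => ?_⟩
  -- The estimates are expressed in powers of `σ = √ε`.
  obtain ⟨σ, hσ, hσ1, rfl⟩ : ∃ σ : ℝ, 0 < σ ∧ σ ≤ 1 ∧ ε = σ ^ 2 :=
    ⟨√ε, Real.sqrt_pos.2 hε, Real.sqrt_le_one.2 hε1, (Real.sq_sqrt hε.le).symm⟩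
  rw [← Real.sqrt_eq_rpow, Real.sqrt_sq hσ.le]
  obtain ⟨k, η, U, Ut, Ux, Uxx, P, S, Px, Pxx, hE, hrU, hrP⟩ := hN σ hσ hσ1 u ψ hK hs
  obtain ⟨hsup, hUx2, hPx2⟩ := hbound σ _ _ _ _ _ _ _ _ _ _ _ _ hσ hσ1 hE
  have mU : MemLp (BoundaryLayer.remainderU U₀ lam (σ ^ 2) u u0) ∞
      (BoundaryLayer.intervalMeasure T) :=
    (BoundaryLayer.memLinfL2_of_continuousOn (hE.continuousOn_U hT.le)).ae_eq
      (hrU.mono fun t ht => ht.symm)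
  have mP : MemLp (BoundaryLayer.remainderPsi U₀ lam (σ ^ 2) ψ ψ0 u0) ∞
      (BoundaryLayer.intervalMeasure T) :=
    (BoundaryLayer.memLinfL2_of_continuousOn (hE.continuousOn_P hT.le)).ae_eq
      (hrP.mono fun t ht => ht.symm)
  have mUx : MemLp Ux 2 (BoundaryLayer.intervalMeasure T) := hE.memUx.mono_exponent le_top
  have mPx : MemLp Px 2 (BoundaryLayer.intervalMeasure T) := hE.memPx.mono_exponent le_top
  refine ⟨Ux, Px, ?_, ?_, BoundaryLayer.memLp_pairH le_top mU mP,
    BoundaryLayer.memLp_pairH one_le_two mUx mPx, ?_, ?_⟩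
  · filter_upwards [hrU, hE.slice] with t h1 h2
    rw [h1]
    exact h2.dU
  · filter_upwards [hrP, hE.slice] with t h1 h2
    rw [h1]
    exact h2.dP
  · have b1 := BoundaryLayer.eLpNorm_top_le (v := BoundaryLayer.remainderU U₀ lam (σ ^ 2) u u0)
      (c := C * σ ^ 2) (by filter_upwards [hrU, hsup] with t h1 h2; rw [h1]; exact h2.1)
    have b2 := BoundaryLayer.eLpNorm_top_le (v := BoundaryLayer.remainderPsi U₀ lam (σ ^ 2) ψ ψ0 u0)
      (c := C * σ ^ 2) (by filter_upwards [hrP, hsup] with t h1 h2; rw [h1]; exact h2.2.1)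
    have b3 := BoundaryLayer.eLpNorm_two_le mUx hC hσ.le hUx2
    have b4 := BoundaryLayer.eLpNorm_two_le mPx hC hσ.le hPx2
    calc _ ≤ (ENNReal.ofReal (C * σ ^ 2) + ENNReal.ofReal (C * σ ^ 2)) + ENNReal.ofReal σ *
          (ENNReal.ofReal ((1 + C) * σ) + ENNReal.ofReal ((1 + C) * σ)) :=
          add_le_add ((BoundaryLayer.eLpNorm_pairH_le le_top mU.1 mP.1).trans (add_le_add b1 b2))
            (mul_le_mul_right ((BoundaryLayer.eLpNorm_pairH_le one_le_two mUx.1 mPx.1).trans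
              (add_le_add b3 b4)) _)
      _ = ENNReal.ofReal ((2 + 4 * C) * σ ^ 2) := by
          rw [← ENNReal.ofReal_add (by positivity) (by positivity),
            ← ENNReal.ofReal_add (by positivity) (by positivity),
            ← ENNReal.ofReal_mul hσ.le, ← ENNReal.ofReal_add (by positivity) (by positivity)]
          congr 1; ring
      _ ≤ _ := by
          refine ENNReal.ofReal_le_ofReal (mul_le_mul_of_nonneg_right ?_ (sq_nonneg σ))
          linarith
  · -- The bound `O(σ²)` in `L²` and the bounded gradient give `O(σ)` in `L^∞`.
    refine (BoundaryLayer.normLinfLinf_le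
      (c := (1 + (C ^ 2 / L + 2 * C ^ 2)) * σ) ?_).trans ?_
    · filter_upwards [hrU, hrP, hE.slice, hsup] with t h1 h2 h3 h4
      rw [h1, h2]
      filter_upwards [BoundaryLayer.ae_abs_le_of_norm_le hL h3.dU hσ hσ1 h4.1 h4.2.2.1,
        BoundaryLayer.ae_abs_le_of_norm_le hL h3.dP hσ hσ1 h4.2.1 h4.2.2.2] with x hx hx'
      exact ⟨hx, hx'⟩
    · refine ENNReal.ofReal_le_ofReal ?_
      rw [← mul_assoc]
      refine mul_le_mul_of_nonneg_right ?_ hσ.le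
      linarith
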